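/- **Causality principle.** Let $\mathcal E_1:[0,\infty)\to\mathbb C$ be locally integrable, not a.e. zero, with $\int_0^\infty(1+t)|\mathcal E_1(t)|\,dt<\infty$. For $\Im k\ge 0$ let $\varphi(t;k)\in\mathbb C^2$ be the (unique) absolutely continuous solution on $[0,\infty)$ of $$\varphi_t=-\Big(ik\sigma_3+\tfrac12\begin{pmatrix}0&\mathcal E_1\\-\overline{\mathcal E_1}&0\end{pmatrix}\Big)\varphi,\qquad \lim_{t\to\infty}\varphi(t;k)e^{-ikt}=\binom01,\qquad \sigma_3=\begin{pmatrix}1&0\\0&-1\end{pmatrix},$$ and put $\binom{b(k)}{a(k)}=\varphi(0;k)$, $r=b/a$. Write $f^*(k)=\overline{f(\bar k)}$, $\theta=\theta(t,x;k)=kt-\big(k+\frac1{4k}\big)x$, $\Omega_\pm=\{\pm\Im k>0,|k|>\frac12\}$, $D_\pm=\{\pm\Im k>0,|k|<\frac12\}$, and let $\Sigma$ be the union of $\mathbb R$ and the circle $|k|=\frac12$, with $\mathbb R$ and both open semicircles $C_u$ (upper), $C_d$ (lower) oriented from left to right; the $+$ side is on the left. Assume that $a(k)\ne0$ for real $|k|\ge\frac12$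 and $b(k)\neq0$ for real $|k|\le\frac12$ (so that the jump matrices below are finite on the real line and bounded near $0,\pm\frac12$). *RH problem.* Let $Z_a$ be the set of zeros of $a$ in $\Omega_+\cup C_u$ and $Z_b$ the set of zeros of $b$ in $D_+\cup C_u$. For $z\in Z_a$ let $p_z(k)$ be the principal part at $z$ of the Laurent expansion of $b/a$; for $z\in Z_b$ let $q_z(k)$ be that of $a/b$. Find a $2\times2$ matrix $M(t,x;k)$ such that: 1. $M$ is analytic in $k$ off $\Sigma$, $Z_a$, $Z_b$ and their complex conjugates, and extends continuously from each of $\Omega_\pm,D_\pm$ to its boundary, except at $0,\pm\frac12$, and at the points of $Z_a\cap C_u$ (for $\Omega_+$), $Z_b\cap C_u$ (for $D_+$) and their conjugates (for $\Omega_-$, $D_-$); 2. for $z\in Z_a$: $M\begin{pmatrix}1&-p_z e^{-2i\theta}\\0&1\end{pmatrix}=O(1)$ as $k\to z$ in $\Omega_+$ and $M\begin{pmatrix}1&0\\p_z^*e^{2i\theta}&1\end{pmatrix}=O(1)$ as $k\to\bar z$ in $\Omega_-$; 3. for $z\in Z_b$: $M\begin{pmatrix}1&0\\-q_ze^{2i\theta}&1\end{pmatrix}=O(1)$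 as $k\to z$ in $D_+$ and $M\begin{pmatrix}1&q_z^*e^{-2i\theta}\\0&1\end{pmatrix}=O(1)$ as $k\to\bar z$ in $D_-$; 4. $M_-=M_+J$ on $\Sigma\setminus\{0,\pm\frac12\}$ (excluding the zeros of $a,b$ on $C_u$ and their conjugates on $C_d$), where $J$ equals $$\begin{pmatrix}1+|r|^2&-re^{-2i\theta}\\-r^*e^{2i\theta}&1\end{pmatrix},\ \begin{pmatrix}1&-(r^*)^{-1}e^{-2i\theta}\\-r^{-1}e^{2i\theta}&1+|r|^{-2}\end{pmatrix},\ \begin{pmatrix}0&-re^{-2i\theta}\\r^{-1}e^{2i\theta}&1\end{pmatrix},\ \begin{pmatrix}0&(r^*)^{-1}e^{-2i\theta}\\-r^*e^{2i\theta}&1\end{pmatrix}$$ for real $|k|>\frac12$, for real $0<|k|<\frac12$, on $C_u$, and on $C_d$, respectively; 5. $M$ is bounded near $0,\pm\frac12$; 6. $M=I+O(k^{-1})$ as $k\to\infty$. *Claim.* Let $x>0$ and $0\le t\le x$. If $r(k)=O(k^{-1})$ as $k\to\infty$ in $\Im k\ge0$, the RH problem has a solution. Every solution is trivial up to an explicit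 triangular factor, and hence the solution is unique: off $\Sigma$ and the poles, $M(t,x;k)\,G(t,x;k)\equiv I$, where $$G=\begin{pmatrix}1&-re^{-2i\theta}\\0&1\end{pmatrix},\ \begin{pmatrix}1&0\\r^*e^{2i\theta}&1\end{pmatrix},\ \begin{pmatrix}1&0\\-r^{-1}e^{2i\theta}&1\end{pmatrix},\ \begin{pmatrix}1&(r^*)^{-1}e^{-2i\theta}\\0&1\end{pmatrix}$$ in $\Omega_+,\Omega_-,D_+,D_-$, respectively. Consequently, for every solution $M$: - $M(t,x;+i0)=I$, so that the functions $\mathcal N,\rho$ defined by $\begin{pmatrix}\mathcal N&\rho\\\bar\rho&-\mathcal N\end{pmatrix}=M(t,x;+i0)\,\sigma_3\,M(t,x;+i0)^{-1}$ are $\mathcal N(t,x)=1$, $\rho(t,x)=0$; - $\mathcal E(t,x):=-\lim_{k\to\infty}4ikM_{12}(t,x;k)=0$ for $t<x$, the limit being taken in every set $|\Im k|\ge c|k|$, $c>0$. The same holds also on the light cone $t=x$ if $k\,r(k)\to0$ as $k\to\infty$ in every set $\Im k\ge c|k|$, $c>0$; and if $k\,r(k)\to0$ as $k\to\infty$ without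 restriction in $\Im k\ge0$, then for all $t\le x$ the limit is $0$ as $k\to\infty$ without restriction (off $\Sigma$). -/

import Mathlib

open Filter Topology MeasureTheory Set Asymptotics

noncomputable section

namespace MaxwellBloch

/-- The Schwarz reflection `f^*(k) = conj (f (conj k))`. -/
def schwarz (f : ℂ → ℂ) (k : ℂ) : ℂ := starRingEnd ℂ (f (starRingEnd ℂ k))

/-! ### Spectral functions of the boundary pulse -/

def sigma3 : Matrix (Fin 2) (Fin 2) ℂ := !![1, 0; 0, -1]

/-- The matrix `H` of the Lax pair, for the field value `e`. -/
def laxH (e : ℂ) : Matrix (Fin 2) (Fin 2) ℂ :=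
  (1 / 2 : ℂ) • !![0, e; -starRingEnd ℂ e, 0]

/-- The matrix `U = -(i k σ₃ + H)` of the `t`-equation, for the field value `e`. -/
def laxU (e k : ℂ) : Matrix (Fin 2) (Fin 2) ℂ := -((Complex.I * k) • sigma3 + laxH e)

/-- `φ` is the second column of the Jost solution `Φ(t; k)` of the `t`-equation at `x = 0`:
an absolutely continuous solution of `φ' = U φ` on `[0, ∞)` with
`φ(t) e^{-i k t} → (0, 1)` as `t → ∞`. For `Im k ≥ 0` and an integrable pulse
there is exactly one such `φ` on `[0, ∞)`. -/
structure IsJostColumn (E₁ : ℝ → ℂ) (k : ℂ) (φ : ℝ → Fin 2 → ℂ) : Prop where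
  continuousOn : ContinuousOn φ (Ici 0)
  equation : ∀ t : ℝ, 0 ≤ t → φ t = φ 0 + ∫ s in (0 : ℝ)..t, (laxU (E₁ s) k).mulVec (φ s)
  normalization : Tendsto (fun t : ℝ => Complex.exp (-(Complex.I * k * t)) • φ t) atTop
    (𝓝 ![0, 1])

open Classical in
/-- The value at `t = 0` of the second Jost column, `(B(k), A(k))`; used for `Im k ≥ 0`. -/
def jostAtZero (E₁ : ℝ → ℂ) (k : ℂ) : Fin 2 → ℂ :=
  if h : ∃ φ, IsJostColumn E₁ k φ then h.choose 0 else 0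

/-- The spectral function `a = A` (on the closed upper half-plane). -/
def specA (E₁ : ℝ → ℂ) (k : ℂ) : ℂ := jostAtZero E₁ k 1

/-- The spectral function `b = B` (on the closed upper half-plane). -/
def specB (E₁ : ℝ → ℂ) (k : ℂ) : ℂ := jostAtZero E₁ k 0

/-- The reflection coefficient `r = b / a`. -/
def refl (a b : ℂ → ℂ) (k : ℂ) : ℂ := b k / a k

/-! ### Contour, domains, phase -/

def OmegaP : Set ℂ := {k | 0 < k.im ∧ 1 / 2 < ‖k‖}
def OmegaM : Set ℂ := {k | k.im < 0 ∧ 1 / 2 < ‖k‖}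
def DP : Set ℂ := {k | 0 < k.im ∧ ‖k‖ < 1 / 2}
def DM : Set ℂ := {k | k.im < 0 ∧ ‖k‖ < 1 / 2}

/-- The contour: the real axis and the circle of radius `1/2`. -/
def contour : Set ℂ := {k | k.im = 0 ∨ ‖k‖ = 1 / 2}

/-- The phase `θ(t, x; k) = k t - (k + 1/(4k)) x`. -/
def theta (t x : ℝ) (k : ℂ) : ℂ := k * t - (k + 1 / (4 * k)) * x

/-- `e^{2 i θ}`. -/
def ePlus (t x : ℝ) (k : ℂ) : ℂ := Complex.exp (2 * Complex.I * theta t x k)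
/-- `e^{-2 i θ}`. -/
def eMinus (t x : ℝ) (k : ℂ) : ℂ := Complex.exp (-(2 * Complex.I * theta t x k))

/-! ### Pole data -/

/-- Zeros of `a` in `Ω₊`, including those on the open upper semicircle. -/
def zerosA (a : ℂ → ℂ) : Set ℂ := {k | 0 < k.im ∧ 1 / 2 ≤ ‖k‖ ∧ a k = 0}
/-- Zeros of `b` in `D₊`, including those on the open upper semicircle. -/
def zerosB (b : ℂ → ℂ) : Set ℂ := {k | 0 < k.im ∧ ‖k‖ ≤ 1 / 2 ∧ b k = 0}

/-- `T_q`: the coefficient of `(k - z)^{-q}` in the Laurent expansion of `1 / f` at a zero `z`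
of order `n` of `f`. Writing `f = (k - z)^n g`, the function `g` is the `n`-fold divided
difference of `f` at `z`, and `T_q` is the Taylor coefficient of `1 / g` of degree `n - q`. -/
def laurentT (f : ℂ → ℂ) (z : ℂ) (q : ℕ) : ℂ :=
  iteratedDeriv (analyticOrderNatAt f z - q)
    (fun k => (((Function.swap dslope z)^[analyticOrderNatAt f z]) f k)⁻¹) z /
      (Nat.factorial (analyticOrderNatAt f z - q) : ℂ)

/-- `A_p = ∑_{q=0}^{n-p} T_{q+p} μ_q / q!` with `μ_q = g^{(q)}(z)`. -/
def poleCoeff (f g : ℂ → ℂ) (z : ℂ) (p : ℕ) : ℂ :=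
  ∑ q ∈ Finset.range (analyticOrderNatAt f z - p + 1),
    laurentT f z (q + p) * iteratedDeriv q g z / (Nat.factorial q : ℂ)

/-- `∑_{q=1}^{n} A_q / (k - z)^q`. -/
def polarSum (f g : ℂ → ℂ) (z k : ℂ) : ℂ :=
  ∑ q ∈ Finset.Icc 1 (analyticOrderNatAt f z), poleCoeff f g z q / (k - z) ^ q

/-- The points off the contour and off the poles. -/
def regularSet (a b : ℂ → ℂ) : Set ℂ :=
  {k | k ∉ contour ∧ k ∉ zerosA a ∧ starRingEnd ℂ k ∉ zerosA a ∧
    k ∉ zerosB b ∧ starRingEnd ℂ k ∉ zerosB b}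

/-! ### The Riemann–Hilbert problem -/

/-- `M` is bounded, entry by entry, along the filter `l`. -/
def BoundedAlong (M : ℂ → Matrix (Fin 2) (Fin 2) ℂ) (l : Filter ℂ) : Prop :=
  ∀ i j, (fun k => M k i j) =O[l] (fun _ => (1 : ℝ))

/-- `M` has a limit at every boundary point of `R` outside `S`, from inside `R`. -/
def ContinuousUpTo (M : ℂ → Matrix (Fin 2) (Fin 2) ℂ) (R S : Set ℂ) : Prop :=
  ∀ k ∈ frontier R \ S, ∃ L, Tendsto M (𝓝[R] k) (𝓝 L)

/-- `M₋ = M₊ J` at `k`, with boundary values from `P` (plus side) and `N` (minus side). -/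
def HasJump (M : ℂ → Matrix (Fin 2) (Fin 2) ℂ) (P N : Set ℂ) (k : ℂ)
    (J : Matrix (Fin 2) (Fin 2) ℂ) : Prop :=
  ∃ Mp Mm, Tendsto M (𝓝[P] k) (𝓝 Mp) ∧ Tendsto M (𝓝[N] k) (𝓝 Mm) ∧ Mm = Mp * J

/-- Jump matrix on the real axis, `|k| > 1/2`. -/
def jumpOuter (r : ℂ → ℂ) (t x : ℝ) (k : ℂ) : Matrix (Fin 2) (Fin 2) ℂ :=
  !![1 + (‖r k‖ : ℂ) ^ 2, -(r k * eMinus t x k); -(schwarz r k * ePlus t x k), 1]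

/-- Jump matrix on the real axis, `0 < |k| < 1/2`. -/
def jumpInner (r : ℂ → ℂ) (t x : ℝ) (k : ℂ) : Matrix (Fin 2) (Fin 2) ℂ :=
  !![1, -((schwarz r k)⁻¹ * eMinus t x k);
     -((r k)⁻¹ * ePlus t x k), 1 + ((‖r k‖ : ℂ) ^ 2)⁻¹]

/-- Jump matrix on the upper semicircle. -/
def jumpUp (r : ℂ → ℂ) (t x : ℝ) (k : ℂ) : Matrix (Fin 2) (Fin 2) ℂ :=
  !![0, -(r k * eMinus t x k); (r k)⁻¹ * ePlus t x k, 1]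

/-- Jump matrix on the lower semicircle. -/
def jumpDown (r : ℂ → ℂ) (t x : ℝ) (k : ℂ) : Matrix (Fin 2) (Fin 2) ℂ :=
  !![0, (schwarz r k)⁻¹ * eMinus t x k; -(schwarz r k * ePlus t x k), 1]

/-- `M = M(t, x; ·)` solves the Riemann–Hilbert problem with spectral functions `a`, `b`.
Only the values of `M` on `regularSet a b` are relevant. -/
structure IsRHSolution (a b : ℂ → ℂ) (t x : ℝ) (M : ℂ → Matrix (Fin 2) (Fin 2) ℂ) : Prop where
  analytic : ∀ i j, DifferentiableOn ℂ (fun k => M k i j) (regularSet a b)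
  cont_OmegaP : ContinuousUpTo M OmegaP ({-(1 / 2), 1 / 2} ∪ zerosA a)
  cont_OmegaM : ContinuousUpTo M OmegaM ({-(1 / 2), 1 / 2} ∪ starRingEnd ℂ ⁻¹' zerosA a)
  cont_DP : ContinuousUpTo M DP ({-(1 / 2), 0, 1 / 2} ∪ zerosB b)
  cont_DM : ContinuousUpTo M DM ({-(1 / 2), 0, 1 / 2} ∪ starRingEnd ℂ ⁻¹' zerosB b)
  pole_a : ∀ z ∈ zerosA a,
    BoundedAlong (fun k => M k * !![1, -(polarSum a b z k * eMinus t x k); 0, 1])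
      (𝓝[OmegaP \ {z}] z)
  pole_a_conj : ∀ z ∈ zerosA a,
    BoundedAlong (fun k => M k * !![1, 0; schwarz (polarSum a b z) k * ePlus t x k, 1])
      (𝓝[OmegaM \ {starRingEnd ℂ z}] (starRingEnd ℂ z))
  pole_b : ∀ z ∈ zerosB b,
    BoundedAlong (fun k => M k * !![1, 0; -(polarSum b a z k * ePlus t x k), 1])
      (𝓝[DP \ {z}] z)
  pole_b_conj : ∀ z ∈ zerosB b,
    BoundedAlong (fun k => M k * !![1, schwarz (polarSum b a z) k * eMinus t x k; 0, 1])
      (𝓝[DM \ {starRingEnd ℂ z}] (starRingEnd ℂ z))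
  jump_outer : ∀ s : ℝ, 1 / 2 < |s| →
    HasJump M OmegaP OmegaM s (jumpOuter (refl a b) t x s)
  jump_inner : ∀ s : ℝ, s ≠ 0 → |s| < 1 / 2 →
    HasJump M DP DM s (jumpInner (refl a b) t x s)
  jump_up : ∀ k : ℂ, 0 < k.im → ‖k‖ = 1 / 2 → a k ≠ 0 → b k ≠ 0 →
    HasJump M OmegaP DP k (jumpUp (refl a b) t x k)
  jump_down : ∀ k : ℂ, k.im < 0 → ‖k‖ = 1 / 2 → schwarz a k ≠ 0 → schwarz b k ≠ 0 →
    HasJump M DM OmegaM k (jumpDown (refl a b) t x k)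
  bounded : ∀ p ∈ ({-(1 / 2), 0, 1 / 2} : Set ℂ), BoundedAlong M (𝓝[regularSet a b] p)
  normalization : ∀ i j, (fun k => M k i j - (1 : Matrix (Fin 2) (Fin 2) ℂ) i j)
    =O[Bornology.cobounded ℂ ⊓ 𝓟 (regularSet a b)] (fun k => k⁻¹)

open Classical in
/-- The triangular factor that removes all jumps and poles of the problem. -/
def factorG (r : ℂ → ℂ) (t x : ℝ) (k : ℂ) : Matrix (Fin 2) (Fin 2) ℂ :=
  if k ∈ OmegaP then !![1, -(r k * eMinus t x k); 0, 1]
  else if k ∈ OmegaM then !![1, 0; schwarz r k * ePlus t x k, 1]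
  else if k ∈ DP then !![1, 0; -((r k)⁻¹ * ePlus t x k), 1]
  else if k ∈ DM then !![1, (schwarz r k)⁻¹ * eMinus t x k; 0, 1]
  else 1

/-! ### Reconstruction of the fields -/

/-- `f(k) → l` as `k → ∞` in `S`, within every sector that avoids the real directions. -/
def TendstoSector (f : ℂ → ℂ) (S : Set ℂ) (l : ℂ) : Prop :=
  ∀ c : ℝ, 0 < c →
    Tendsto f (Bornology.cobounded ℂ ⊓ 𝓟 (S ∩ {k | c * ‖k‖ ≤ |k.im|})) (𝓝 l)

/-- `e = - lim 4 i k M₁₂(k)`, `k → ∞` non-tangentially to the real axis. -/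
def HasField (M : ℂ → Matrix (Fin 2) (Fin 2) ℂ) (e : ℂ) : Prop :=
  TendstoSector (fun k => -(4 * Complex.I * k * M k 0 1)) univ e

/-- `e = - lim 4 i k M₁₂(k)`, `k → ∞` without any restriction (off the contour). -/
def HasFieldUnrestricted (M : ℂ → Matrix (Fin 2) (Fin 2) ℂ) (e : ℂ) : Prop :=
  Tendsto (fun k => -(4 * Complex.I * k * M k 0 1))
    (Bornology.cobounded ℂ ⊓ 𝓟 contourᶜ) (𝓝 e)

/-- `M₀ = M(+i0)`. -/
def HasValueAtZero (M : ℂ → Matrix (Fin 2) (Fin 2) ℂ) (M₀ : Matrix (Fin 2) (Fin 2) ℂ) : Prop :=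
  Tendsto (fun y : ℝ => M (Complex.I * y)) (𝓝[>] 0) (𝓝 M₀)

/-- `(N, ρ; conj ρ, -N) = M(+i0) σ₃ M(+i0)⁻¹`. -/
def HasMedium (M : ℂ → Matrix (Fin 2) (Fin 2) ℂ) (N : ℝ) (ρ : ℂ) : Prop :=
  ∃ M₀, HasValueAtZero M M₀ ∧ IsUnit M₀.det ∧
    M₀ * sigma3 * M₀⁻¹ = !![(N : ℂ), ρ; starRingEnd ℂ ρ, -(N : ℂ)]

end MaxwellBloch

end

/-! Both `a` and `b` are continuous for `Im k ≥ 0` and holomorphic for `Im k > 0`, so `r = b / a`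
makes sense off the real axis, and every jump matrix of the problem splits into triangular factors:
`J G₋ = G₊` on each piece of the contour, where `G` is `factorG`. Hence `M G` has no jump for any
solution `M`. The pole conditions say exactly that `M G` stays bounded at the zeros of `a` and `b`
and their conjugates, because the triangular matrices multiply by adding their entries and `p_z`,
`q_z` are the principal parts of `b / a`, `a / b`.

Causality enters through the size of the exponentials. Since `Im θ = Im k (t - x + x / (4|k|²))`,
for `t ≤ x` the factor `e^{-2iθ}` is at most `e^x` in `Ω₊`, and for `t ≥ 0` the factor `e^{2iθ}` is
at most `1` in `D₊`, in spite of its essential singularity at `0`; reflection gives the lower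
half-plane. So `G` is bounded near `0` and `±1/2` and tends to `I` at infinity as `r → 0`. By
Morera, Riemann and Liouville (`eq_const_of_removable_contour`), `M G` is constantly `I`
(`IsRHSolution.mul_factorG`). Conversely `G⁻¹` satisfies all conditions; only its rate of approach
to `I` needs `r = O(1/k)` (`IsSpectralPair.isRHSolution_inv`). Field and medium are then read off
from `G⁻¹`: in `Ω₊` its (1,2) entry is `r e^{-2iθ}`, in `Ω₋` it is `0`, and along the positive
imaginary axis near `0` the factor `e^{2iθ}` kills the off-diagonal entry.

The facts about `a` and `b` come from the Volterra equation for `φ e^{-ikt}`. Its Neumann series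
converges uniformly on the closed upper half-plane in a weighted sup norm
(`exists_volterra_weight`); this gives existence, uniqueness, continuity and holomorphy. A
Riemann–Lebesgue argument uniform in `t` (`eventually_norm_psiOne_le`) gives `a → 1`, `b → 0` at
infinity. The nonvanishing of `a` and `b` on their parts of the real axis keeps the zeros from
accumulating there, so the exceptional points form a closed discrete set
(`eventually_notMem_zeros`). -/

namespace MaxwellBloch

/-! ### Removing the contour -/

/-- A continuous function that is holomorphic off the real axis is holomorphic. -/
theorem differentiableOn_of_differentiableOn_diff_real {f : ℂ → ℂ} {U : Set ℂ} (hU : IsOpen U)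
    (hc : ContinuousOn f U) (hd : DifferentiableOn ℂ f (U \ {z | z.im = 0})) :
    DifferentiableOn ℂ f U := by
  -- Morera's theorem: only the integrals over boundaries of rectangles matter. If the real axis
  -- misses the interior of the rectangle, Cauchy's theorem with mere continuity on the boundary
  -- applies (`key`).
  rw [← Complex.isConservativeOn_and_continuousOn_iff_isDifferentiableOn hU]
  refine ⟨fun z w hzw => ?_, hc⟩
  have key : ∀ z w : ℂ, Complex.Rectangle z w ⊆ U →
      (0 : ℝ) ∉ Ioo (min z.im w.im) (max z.im w.im) →
      (∫ x : ℝ in z.re..w.re, f (x + z.im * Complex.I)) -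
      (∫ x : ℝ in z.re..w.re, f (x + w.im * Complex.I)) +
      Complex.I • (∫ y : ℝ in z.im..w.im, f (w.re + y * Complex.I)) -
      Complex.I • (∫ y : ℝ in z.im..w.im, f (z.re + y * Complex.I)) = 0 := by
    intro z w hzw h0
    refine Complex.integral_boundary_rect_eq_zero_of_continuousOn_of_differentiableOn f z w
      (hc.mono hzw) (hd.mono ?_)
    rintro k ⟨hk1, hk2⟩
    refine ⟨hzw ⟨?_, ?_⟩, ?_⟩
    · exact Ioo_subset_Icc_self hk1
    · exact Ioo_subset_Icc_self hk2
    · intro (hk : k.im = 0)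
      exact h0 (hk ▸ hk2)
  rw [← add_eq_zero_iff_eq_neg, Complex.wedgeIntegral_add_wedgeIntegral_eq]
  -- A rectangle that meets the axis is cut along it: the integrals over the common side cancel and
  -- the vertical sides add up.
  by_cases h0 : (0 : ℝ) ∈ uIcc z.im w.im
  · have hz : Complex.Rectangle z ⟨w.re, 0⟩ ⊆ Complex.Rectangle z w := by
      rintro k ⟨hk1, hk2⟩
      exact ⟨hk1, uIcc_subset_uIcc left_mem_uIcc h0 hk2⟩
    have hw : Complex.Rectangle ⟨z.re, 0⟩ w ⊆ Complex.Rectangle z w := by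
      rintro k ⟨hk1, hk2⟩
      exact ⟨hk1, uIcc_subset_uIcc h0 right_mem_uIcc hk2⟩
    have e1 := key z ⟨w.re, 0⟩ (hz.trans hzw) (by
      simp only [mem_Ioo, lt_max_iff, min_lt_iff]; rintro ⟨h1 | h1, h2 | h2⟩ <;> linarith)
    have e2 := key ⟨z.re, 0⟩ w (hw.trans hzw) (by
      simp only [mem_Ioo, lt_max_iff, min_lt_iff]; rintro ⟨h1 | h1, h2 | h2⟩ <;> linarith)
    have hintegrable : ∀ r ∈ uIcc z.re w.re, ∀ p ∈ uIcc z.im w.im, ∀ q ∈ uIcc z.im w.im,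
        IntervalIntegrable (fun y : ℝ => f (r + y * Complex.I)) volume p q := by
      intro r hr p hp q hq
      refine ContinuousOn.intervalIntegrable ?_
      refine hc.comp (by fun_prop) ?_
      intro y hy
      refine hzw ⟨?_, ?_⟩
      · simpa using hr
      · simpa using uIcc_subset_uIcc hp hq hy
    have a1 := intervalIntegral.integral_add_adjacent_intervals
      (hintegrable w.re right_mem_uIcc z.im left_mem_uIcc 0 h0)
      (hintegrable w.re right_mem_uIcc 0 h0 w.im right_mem_uIcc)
    have a2 := intervalIntegral.integral_add_adjacent_intervals
      (hintegrable z.re left_mem_uIcc z.im left_mem_uIcc 0 h0)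
      (hintegrable z.re left_mem_uIcc 0 h0 w.im right_mem_uIcc)
    rw [← a1, ← a2]
    simp only [smul_eq_mul] at e1 e2 ⊢
    linear_combination e1 + e2
  · exact key z w hzw fun h => h0 (Ioo_subset_Icc_self h)

/-- A function that is continuous near a nonreal point of the circle `|k| = 1/2` and holomorphic
off the circle is holomorphic at the point. -/
theorem differentiableAt_of_differentiableOn_diff_circle {f : ℂ → ℂ} {U : Set ℂ} (hU : IsOpen U)
    (hc : ContinuousOn f U) (hd : DifferentiableOn ℂ f (U \ {z | ‖z‖ = 1 / 2}))
    {p : ℂ} (hp : p ∈ U) (hpi : p.im ≠ 0) : DifferentiableAt ℂ f p := by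
  -- The map `g` sends exactly the real axis to the circle, so `f ∘ g` falls under the previous
  -- result. Its right inverse `l` is holomorphic at `p`, as a nonreal point avoids the cut of the
  -- logarithm.
  set g : ℂ → ℂ := fun w => 1 / 2 * Complex.exp (Complex.I * w)
  set l : ℂ → ℂ := fun k => -Complex.I * Complex.log (2 * k)
  have hgd : Differentiable ℂ g := by fun_prop
  have hgl : ∀ k : ℂ, k ≠ 0 → g (l k) = k := by
    intro k hk
    have : Complex.I * (-Complex.I * Complex.log (2 * k)) = Complex.log (2 * k) := by
      rw [← mul_assoc]; simp
    simp only [g, l]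
    rw [this, Complex.exp_log (by simpa using hk)]; ring
  have hp0 : p ≠ 0 := by rintro rfl; simp at hpi
  have hV : IsOpen (g ⁻¹' U) := hU.preimage hgd.continuous
  have hdiff : DifferentiableOn ℂ (f ∘ g) (g ⁻¹' U) := by
    refine differentiableOn_of_differentiableOn_diff_real hV
      (hc.comp hgd.continuous.continuousOn fun _ h => h) ?_
    refine hd.comp hgd.differentiableOn ?_
    rintro w ⟨hw1, hw2⟩
    refine ⟨hw1, ?_⟩
    intro (h : ‖g w‖ = 1 / 2)
    simp only [g, norm_mul, Complex.norm_exp] at h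
    apply hw2
    simpa using h
  have hat : DifferentiableAt ℂ (f ∘ g) (l p) :=
    hdiff.differentiableAt (hV.mem_nhds (by simpa [hgl p hp0] using hp))
  have hl : DifferentiableAt ℂ l p := by
    refine DifferentiableAt.const_mul (DifferentiableAt.clog (by fun_prop) ?_) _
    exact Or.inr (by simpa using hpi)
  refine (hat.comp p hl).congr_of_eventuallyEq ?_
  filter_upwards [isOpen_ne.mem_nhds hp0] with k hk
  simp [hgl k hk]

theorem isClosed_contour : IsClosed contour :=
  (isClosed_eq Complex.continuous_im continuous_const).union
    (isClosed_eq continuous_norm continuous_const)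

theorem interior_contour : interior contour = ∅ := by
  have h1 : interior {k : ℂ | k.im = 0} = ∅ := by
    rw [eq_empty_iff_forall_notMem]
    intro k hk
    have : k ∈ interior {k : ℂ | k.im ≤ 0} :=
      interior_mono (s := {k : ℂ | k.im = 0}) (fun z hz => le_of_eq hz) hk
    rw [Complex.interior_setOfPred_im_le] at this
    have h0 : k.im = 0 := interior_subset (s := {k : ℂ | k.im = 0}) hk
    exact (ne_of_lt this) h0
  have h2 : interior {k : ℂ | ‖k‖ = 1 / 2} = ∅ := by
    have : {k : ℂ | ‖k‖ = 1 / 2} = Metric.sphere 0 (1 / 2) := by ext; simp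
    rw [this]; exact interior_sphere _ (by norm_num)
  have : contour = {k : ℂ | k.im = 0} ∪ {k : ℂ | ‖k‖ = 1 / 2} := rfl
  rw [this, interior_union_isClosed_of_interior_empty
    (isClosed_eq Complex.continuous_im continuous_const) h2, h1]

theorem isClosed_of_eventually_notMem {X : Set ℂ} (hX : ∀ p, ∀ᶠ k in 𝓝[≠] p, k ∉ X) :
    IsClosed X := by
  rw [← isOpen_compl_iff, isOpen_iff_mem_nhds]
  intro p hp
  have := eventually_nhdsWithin_iff.1 (hX p)
  filter_upwards [this] with k hk
  by_cases h : k = p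
  · exact h ▸ hp
  · exact hk h

theorem dense_compl_contour_union {X : Set ℂ} (hX : ∀ p, ∀ᶠ k in 𝓝[≠] p, k ∉ X) :
    Dense (contour ∪ X)ᶜ := by
  have h2 : interior X = ∅ := by
    rw [eq_empty_iff_forall_notMem]
    intro k hk
    have h1 : ∀ᶠ z in 𝓝[≠] k, z ∈ X :=
      nhdsWithin_le_nhds (mem_interior_iff_mem_nhds.1 hk)
    obtain ⟨z, hz1, hz2⟩ := ((hX k).and h1).exists
    exact hz1 hz2
  rw [← interior_eq_empty_iff_dense_compl,
    interior_union_isClosed_of_interior_empty isClosed_contour h2, interior_contour]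

/-- A function on the complement of the contour and of a discrete set `X`, with matching boundary
values on the contour off `X`, bounded near `X`, and with limit `c` at infinity, is constant. -/
theorem eq_const_of_removable_contour {f : ℂ → ℂ} {X : Set ℂ} {c : ℂ}
    (hX : ∀ p, ∀ᶠ k in 𝓝[≠] p, k ∉ X) (hm : -(1 / 2) ∈ X) (hp : 1 / 2 ∈ X)
    (hf : DifferentiableOn ℂ f (contour ∪ X)ᶜ)
    (hlim : ∀ p ∈ contour \ X, ∃ L, Tendsto f (𝓝[(contour ∪ X)ᶜ] p) (𝓝 L))
    (hbdd : ∀ p ∈ X, f =O[𝓝[(contour ∪ X)ᶜ] p] (fun _ => (1 : ℝ)))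
    (hinf : Tendsto f (Bornology.cobounded ℂ ⊓ 𝓟 (contour ∪ X)ᶜ) (𝓝 c)) :
    ∀ k ∈ (contour ∪ X)ᶜ, f k = c := by
  set R : Set ℂ := (contour ∪ X)ᶜ with hRdef
  have hXc := isClosed_of_eventually_notMem hX
  have hR : IsOpen R := (isClosed_contour.union hXc).isOpen_compl
  have hRd : Dense R := dense_compl_contour_union hX
  -- The extension by limits is continuous off `X`, hence holomorphic across the contour there; the
  -- points of `X` are removed afterwards by Riemann's theorem.
  set g := extendFrom R f with hg
  have hgR : ∀ k ∈ R, g k = f k := fun k hk =>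
    extendFrom_eq (hRd k) (hf.continuousOn k hk)
  have hlim' : ∀ p ∈ Xᶜ, ∃ L, Tendsto f (𝓝[R] p) (𝓝 L) := by
    intro p hp
    by_cases hpc : p ∈ contour
    · exact hlim p ⟨hpc, hp⟩
    · exact ⟨f p, hf.continuousOn p (by simp only [hRdef, mem_compl_iff, mem_union]; tauto)⟩
  have hgc : ContinuousOn g Xᶜ := continuousOn_extendFrom (fun p _ => hRd p) hlim'
  have hgdR : DifferentiableOn ℂ g R := hf.congr hgR
  have hgd : DifferentiableOn ℂ g Xᶜ := by
    intro p hpX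
    refine DifferentiableAt.differentiableWithinAt ?_
    by_cases hpc : p ∈ contour
    -- The axis and the circle meet only at `±1/2`, which belong to `X`, so near `p` the contour is
    -- either the line or the circle alone.
    · by_cases him : p.im = 0
      · have hn : ‖p‖ ≠ 1 / 2 := by
          intro hn
          have : p = ((p.re : ℝ) : ℂ) := by apply Complex.ext <;> simp [him]
          rw [this, Complex.norm_real, Real.norm_eq_abs] at hn
          rcases (abs_eq (by norm_num)).1 hn with h | h
          · apply hpX; rw [this, h]; simpa using hp
          · apply hpX; rw [this, h]; simpa using hm
        have hU : IsOpen (Xᶜ ∩ {k : ℂ | ‖k‖ ≠ 1 / 2}) :=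
          hXc.isOpen_compl.inter (isOpen_ne_fun continuous_norm continuous_const)
        refine (differentiableOn_of_differentiableOn_diff_real hU
          (hgc.mono inter_subset_left) (hgdR.mono ?_)).differentiableAt
            (hU.mem_nhds ⟨hpX, hn⟩)
        rintro k ⟨⟨h1, h2⟩, h3⟩ h
        rcases h with (h | h) | h
        exacts [h3 h, h2 h, h1 h]
      · have hU : IsOpen (Xᶜ ∩ {k : ℂ | k.im ≠ 0}) :=
          hXc.isOpen_compl.inter (isOpen_ne_fun Complex.continuous_im continuous_const)
        refine differentiableAt_of_differentiableOn_diff_circle hU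
          (hgc.mono inter_subset_left) (hgdR.mono ?_) ⟨hpX, him⟩ him
        rintro k ⟨⟨h1, h2⟩, h3⟩ h
        rcases h with (h | h) | h
        exacts [h2 h, h3 h, h1 h]
    · refine hgdR.differentiableAt (hR.mem_nhds ?_)
      simp only [hRdef, mem_compl_iff, mem_union]; tauto
  have hle : ∀ p ∈ X, 𝓝[R] p ≤ 𝓝[≠] p := by
    intro p hp
    refine nhdsWithin_mono p ?_
    rintro k hk rfl
    exact hk (Or.inr hp)
  have hXpt : ∀ p, ∀ᶠ z in 𝓝[≠] p, DifferentiableAt ℂ g z := by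
    intro p
    filter_upwards [hX p] with k hk using hgd.differentiableAt (hXc.isOpen_compl.mem_nhds hk)
  have hgdiff : Differentiable ℂ g := by
    intro p
    by_cases hpX : p ∈ X
    -- The bound on `f` is available only on `R`; density of `R` and continuity of `g` off `X` carry
    -- it to the nearby points of the contour.
    · have hb : IsBoundedUnder (· ≤ ·) (𝓝[≠] p) fun z => ‖g z - g p‖ := by
        obtain ⟨C, hC⟩ := (hbdd p hpX).bound
        have h1 := eventually_nhdsWithin_iff.1 hC
        obtain ⟨V, hV, hVo, hpV⟩ := eventually_nhds_iff.1 h1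
        refine ⟨C + ‖g p‖, ?_⟩
        rw [eventually_map]
        filter_upwards [hX p, nhdsWithin_le_nhds (hVo.mem_nhds hpV)] with k hkX hkV
        refine (norm_sub_le _ _).trans ?_
        gcongr
        have hk : k ∈ closure (V ∩ R) :=
          hRd.open_subset_closure_inter hVo hkV
        have hcl : ContinuousWithinAt (fun k => ‖g k‖) (V ∩ R) k :=
          ((hgc.continuousAt (hXc.isOpen_compl.mem_nhds hkX)).norm).continuousWithinAt
        have : NeBot (𝓝[V ∩ R] k) := mem_closure_iff_nhdsWithin_neBot.1 hk
        refine le_of_tendsto hcl ?_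
        filter_upwards [self_mem_nhdsWithin] with z hz
        rw [hgR z hz.2]
        simpa using hV z hz.1 hz.2
      have ht := Complex.tendsto_limUnder_of_differentiable_on_punctured_nhds_of_bounded_under
        (hXpt p) hb
      have : NeBot (𝓝[R] p) := mem_closure_iff_nhdsWithin_neBot.1 (hRd p)
      -- Once the punctured limit of `g` is known to exist, `extendFrom` already takes this value at
      -- `p`, so `g` needs no redefinition there.
      have ht2 : Tendsto f (𝓝[R] p) (𝓝 (limUnder (𝓝[≠] p) g)) := by
        refine (ht.mono_left (hle p hpX)).congr' ?_
        filter_upwards [self_mem_nhdsWithin] with z hz using hgR z hz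
      have : g p = limUnder (𝓝[≠] p) g := extendFrom_eq (hRd p) ht2
      rw [← this] at ht
      exact (Complex.analyticAt_of_differentiable_on_punctured_nhds_of_continuousAt (hXpt p)
        (continuousAt_iff_punctured_nhds.2 ht)).differentiableAt
    · exact hgd.differentiableAt (hXc.isOpen_compl.mem_nhds hpX)
  have hginf : Tendsto g (cocompact ℂ) (𝓝 c) := by
    rw [← Metric.cobounded_eq_cocompact]
    rw [Metric.tendsto_nhds]
    intro ε hε
    have h1 := (Metric.tendsto_nhds.1 hinf) (ε / 2) (by positivity)
    rw [eventually_inf_principal] at h1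
    obtain ⟨N, hN⟩ := (Metric.hasBasis_cobounded_compl_closedBall (0 : ℂ)).eventually_iff.1 h1
    refine (Metric.hasBasis_cobounded_compl_closedBall (0 : ℂ)).eventually_iff.2 ⟨N, trivial, ?_⟩
    intro k hk
    have hVo : IsOpen (Metric.closedBall (0 : ℂ) N)ᶜ := Metric.isClosed_closedBall.isOpen_compl
    have hk' := hRd.open_subset_closure_inter hVo hk
    have := mem_closure_iff_nhdsWithin_neBot.1 hk'
    refine lt_of_le_of_lt ?_ (half_lt_self hε)
    refine le_of_tendsto
      ((hgdiff.continuous.dist continuous_const).continuousWithinAt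
        (s := (Metric.closedBall (0 : ℂ) N)ᶜ ∩ R) (x := k)) ?_
    filter_upwards [self_mem_nhdsWithin] with z hz
    rw [hgR z hz.2]
    exact (hN.2 hz.1 hz.2).le
  intro k hk
  rw [← hgR k hk]
  exact hgdiff.apply_eq_of_tendsto_cocompact k hginf

/-! ### Principal parts -/

/-- Each `dslope` strips one factor `k - z`; at `z` itself, where it is a derivative, the value is
forced by continuity. This identifies the iterated divided difference in `laurentT` with the
nonvanishing cofactor. -/
theorem iterate_dslope_eventuallyEq {g : ℂ → ℂ} {z : ℂ} (hg : AnalyticAt ℂ g z) (n : ℕ)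
    {f : ℂ → ℂ} (hf : f =ᶠ[𝓝 z] fun k => (k - z) ^ n * g k) :
    ((Function.swap dslope z)^[n]) f =ᶠ[𝓝 z] g := by
  induction n generalizing f with
  | zero => simpa using hf
  | succ n ih =>
    rw [Function.iterate_succ_apply]
    refine ih ?_
    have hG : AnalyticAt ℂ (fun k => (k - z) ^ n * g k) z := by fun_prop
    have hfa : DifferentiableAt ℂ f z := by
      have : DifferentiableAt ℂ (fun k => (k - z) ^ (n + 1) * g k) z :=
        (by fun_prop : AnalyticAt ℂ (fun k => (k - z) ^ (n + 1) * g k) z).differentiableAt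
      exact this.congr_of_eventuallyEq hf
    have hne : Function.swap dslope z f =ᶠ[𝓝[≠] z] fun k => (k - z) ^ n * g k := by
      filter_upwards [self_mem_nhdsWithin, nhdsWithin_le_nhds hf] with k hk hfk
      have hfz : f z = 0 := by simpa using hf.self_of_nhds
      have hk' : k - z ≠ 0 := sub_ne_zero.2 hk
      simp only [Function.swap]
      rw [dslope_of_ne _ hk, slope_def_field, hfk, hfz]
      field_simp
      ring
    have hz : Function.swap dslope z f z = (z - z) ^ n * g z := by
      have h1 : Tendsto (Function.swap dslope z f) (𝓝[≠] z) (𝓝 (Function.swap dslope z f z)) :=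
        (continuousAt_dslope_same.2 hfa).tendsto.mono_left nhdsWithin_le_nhds
      have h2 : Tendsto (fun k => (k - z) ^ n * g k) (𝓝[≠] z) (𝓝 ((z - z) ^ n * g z)) :=
        hG.continuousAt.tendsto.mono_left nhdsWithin_le_nhds
      exact tendsto_nhds_unique (h1.congr' hne) h2
    filter_upwards [eventually_nhdsWithin_iff.1 hne] with k hk
    by_cases h : k = z
    · rw [h]; exact hz
    · exact hk h

theorem isBigO_sub_taylor {H : ℂ → ℂ} {z : ℂ} (hH : AnalyticAt ℂ H z) (n : ℕ) :
    (fun k => H k - ∑ j ∈ Finset.range n,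
      iteratedDeriv j H z / (Nat.factorial j : ℂ) * (k - z) ^ j) =O[𝓝 z]
      fun k => (k - z) ^ n := by
  have h := hH.hasFPowerSeriesAt.isBigO_sub_partialSum_pow n
  have ht : Tendsto (fun k : ℂ => k - z) (𝓝 z) (𝓝 0) := by
    have : ContinuousAt (fun k : ℂ => k - z) z := by fun_prop
    simpa [ContinuousAt] using this
  have h2 := h.comp_tendsto ht
  refine (h2.congr_left ?_).trans (IsBigO.of_bound 1 (Eventually.of_forall fun k => ?_))
  · intro k
    simp [FormalMultilinearSeries.partialSum, mul_comm]
  · simp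

/-- `polarSum f g z` is the principal part of `g / f` at the zero `z` of `f`. -/
theorem polarSum_sub_isBigO {f g : ℂ → ℂ} {z : ℂ} (hf : AnalyticAt ℂ f z) (hg : AnalyticAt ℂ g z)
    (hord : analyticOrderAt f z ≠ ⊤) :
    (fun k => g k / f k - polarSum f g z k) =O[𝓝[≠] z] (fun _ => (1 : ℝ)) := by
  set n := analyticOrderNatAt f z with hn
  obtain ⟨q, hq, hqz, hfq⟩ := (hf.analyticOrderAt_ne_top).1 hord
  have hfq' : f =ᶠ[𝓝 z] fun k => (k - z) ^ n * q k := by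
    filter_upwards [hfq] with k hk
    simpa using hk
  set h : ℂ → ℂ := fun k => (((Function.swap dslope z)^[n]) f k)⁻¹ with hh
  have hhq : h =ᶠ[𝓝 z] fun k => (q k)⁻¹ := by
    filter_upwards [iterate_dslope_eventuallyEq hq n hfq'] with k hk
    simp [hh, hk]
  have hha : AnalyticAt ℂ h z := (hq.fun_inv hqz).congr hhq.symm
  set H : ℂ → ℂ := fun k => h k * g k with hHdef
  have hHa : AnalyticAt ℂ H z := hha.mul hg
  -- With `f = (k - z)^n q`, the function `h` is `1 / q` near `z` and `g / f = H / (k - z)^n`. The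
  -- convolution defining `poleCoeff` is the Leibniz rule for the Taylor coefficient of `H = h g` of
  -- degree `n - p`.
  have hcoef : ∀ p ∈ Finset.Icc 1 n,
      poleCoeff f g z p = iteratedDeriv (n - p) H z / (Nat.factorial (n - p) : ℂ) := by
    intro p hp
    rw [Finset.mem_Icc] at hp
    rw [hHdef, iteratedDeriv_fun_mul hha.contDiffAt hg.contDiffAt, ← Finset.sum_range_reflect,
      Finset.sum_div]
    unfold poleCoeff
    rw [← hn]
    refine Finset.sum_congr rfl fun j hj => ?_
    have hj' : j ≤ n - p := Nat.lt_succ_iff.1 (Finset.mem_range.1 hj)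
    unfold laurentT
    rw [← hn, ← hh]
    have e1 : n - p + 1 - 1 - j = n - (j + p) := by omega
    have e2 : n - p - (n - (j + p)) = j := by omega
    rw [e1, e2]
    have hch : ((n - p).choose (n - (j + p)) : ℂ) =
        (Nat.factorial (n - p) : ℂ) /
          ((Nat.factorial (n - (j + p)) : ℂ) * (Nat.factorial j : ℂ)) := by
      rw [Nat.cast_choose ℂ (by omega : n - (j + p) ≤ n - p), e2]
    rw [hch]
    have f1 : (Nat.factorial (n - p) : ℂ) ≠ 0 := by exact_mod_cast Nat.factorial_ne_zero _
    have f2 : (Nat.factorial (n - (j + p)) : ℂ) ≠ 0 := by exact_mod_cast Nat.factorial_ne_zero _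
    have f3 : (Nat.factorial j : ℂ) ≠ 0 := by exact_mod_cast Nat.factorial_ne_zero _
    field_simp
  -- The polar sum is the Taylor polynomial of `H` of degree below `n`, divided by `(k - z)^n`; what
  -- remains is a Taylor remainder of order `n` over `(k - z)^n`.
  have hkey : (fun k => g k / f k - polarSum f g z k) =ᶠ[𝓝[≠] z]
      fun k => (H k - ∑ j ∈ Finset.range n,
        iteratedDeriv j H z / (Nat.factorial j : ℂ) * (k - z) ^ j) / (k - z) ^ n := by
    filter_upwards [self_mem_nhdsWithin, nhdsWithin_le_nhds hfq', nhdsWithin_le_nhds hhq,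
      nhdsWithin_le_nhds (hq.continuousAt.eventually_ne hqz)] with k hk hfk hhk hqk
    have hkz : k - z ≠ 0 := sub_ne_zero.2 hk
    rw [sub_div]
    congr 1
    · rw [hHdef]
      simp only [hhk, hfk]
      field_simp
    · unfold polarSum
      rw [← hn, Finset.sum_div, ← Finset.sum_range_reflect, Finset.range_eq_Ico,
        Finset.sum_Ico_eq_sum_range]
      rw [show Finset.Icc 1 n = Finset.Ico 1 (n + 1) from by ext; simp,
        Finset.sum_Ico_eq_sum_range]
      refine Finset.sum_congr (by simp) fun j hj => ?_
      have hj' : j < n := by simpa using hj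
      rw [hcoef _ (by simp; omega)]
      have e1 : n - 1 - (0 + j) = n - (1 + j) := by omega
      have e2 : (k - z) ^ n = (k - z) ^ (n - (1 + j)) * (k - z) ^ (1 + j) := by
        rw [← pow_add]; congr 1; omega
      rw [e1, e2]
      field_simp
  refine (IsBigO.congr' ?_ hkey.symm EventuallyEq.rfl)
  obtain ⟨C, hC⟩ := (isBigO_sub_taylor hHa n).bound
  refine IsBigO.of_bound C ?_
  filter_upwards [self_mem_nhdsWithin, nhdsWithin_le_nhds hC] with k hk hCk
  have hkz : 0 < ‖(k - z) ^ n‖ := norm_pos_iff.2 (pow_ne_zero _ (sub_ne_zero.2 hk))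
  rw [norm_div, div_le_iff₀ hkz]
  simpa using hCk

/-! ### Calculus preliminaries -/

theorem absolutelyContinuousOnInterval_of_dist_le {X Y : Type*} [PseudoMetricSpace X]
    [PseudoMetricSpace Y] {f : ℝ → X} {g : ℝ → Y} {a b : ℝ}
    (hg : AbsolutelyContinuousOnInterval g a b)
    (h : ∀ x ∈ uIcc a b, ∀ y ∈ uIcc a b, dist (f x) (f y) ≤ dist (g x) (g y)) :
    AbsolutelyContinuousOnInterval f a b := by
  rw [absolutelyContinuousOnInterval_iff] at hg ⊢
  intro ε hε
  obtain ⟨δ, hδ, H⟩ := hg ε hε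
  refine ⟨δ, hδ, fun E hE hlt => lt_of_le_of_lt (Finset.sum_le_sum fun i hi => ?_) (H E hE hlt)⟩
  have := hE.1 i hi
  exact h _ this.1 _ this.2

theorem absolutelyContinuousOnInterval_integral {v : ℝ → ℂ} {a b : ℝ}
    (hv : IntervalIntegrable v volume a b) :
    AbsolutelyContinuousOnInterval (fun x => ∫ s in a..x, v s) a b := by
  refine absolutelyContinuousOnInterval_of_dist_le
    (hv.norm.absolutelyContinuousOnInterval_intervalIntegral (c := a) left_mem_uIcc) ?_
  intro x hx y hy
  have hax : IntervalIntegrable v volume a x :=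
    hv.mono_set (uIcc_subset_uIcc left_mem_uIcc hx)
  have hay : IntervalIntegrable v volume a y :=
    hv.mono_set (uIcc_subset_uIcc left_mem_uIcc hy)
  rw [dist_eq_norm, dist_eq_norm, intervalIntegral.integral_interval_sub_left hax hay,
    intervalIntegral.integral_interval_sub_left hax.norm hay.norm]
  exact intervalIntegral.norm_integral_le_abs_integral_norm

/-- Integration by parts against a primitive of an integrable function. -/
theorem integral_deriv_mul_add_mul {u v g g' : ℝ → ℂ} {a b : ℝ}
    (hv : IntervalIntegrable v volume a b) (hu : ∀ t ∈ uIcc a b, u t = u a + ∫ s in a..t, v s)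
    (hg : ∀ t, HasDerivAt g (g' t) t) (hg' : Continuous g') :
    ∫ t in a..b, (g' t * u t + g t * v t) = g b * u b - g a * u a := by
  have hgc : Continuous g := continuous_iff_continuousAt.2 fun t => (hg t).continuousAt
  -- `u` is prescribed on the interval only; `U` agrees with it there and is defined on the whole
  -- line, so that two-sided derivatives make sense at the endpoints too.
  set U : ℝ → ℂ := fun t => u a + ∫ s in a..t, v s with hU
  have hVac := absolutelyContinuousOnInterval_integral hv
  have hUac : AbsolutelyContinuousOnInterval U a b :=
    absolutelyContinuousOnInterval_of_dist_le hVac fun x _ y _ => by simp [hU]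
  have hUd : ∀ᵐ x, x ∈ uIcc a b → HasDerivAt U (v x) x := by
    filter_upwards [hv.ae_hasDerivAt_integral] with x hx hxm
    exact (hx hxm a left_mem_uIcc).const_add (u a)
  have hgac : AbsolutelyContinuousOnInterval g a b := by
    refine ContDiffOn.absolutelyContinuousOnInterval (ContDiff.contDiffOn ?_)
    rw [contDiff_one_iff_deriv]
    exact ⟨fun t => (hg t).differentiableAt, by
      rwa [show deriv g = g' from funext fun t => (hg t).deriv]⟩
  have hw : IntervalIntegrable (fun t => g' t * U t + g t * v t) volume a b :=
    ((hg'.continuousOn).mul hUac.continuousOn).intervalIntegrable.add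
      (hv.continuousOn_mul hgc.continuousOn)
  have hprod : AbsolutelyContinuousOnInterval (fun t => g t * U t) a b := hgac.smul hUac
  have hWac := absolutelyContinuousOnInterval_integral hw
  -- As `v` is merely integrable, the product rule holds only almost everywhere; absolute continuity
  -- makes the difference of `g U` and the primitive of the expected derivative constant.
  obtain ⟨C, hC⟩ := (hprod.sub hWac).const_of_ae_hasDerivAt_zero (by
    filter_upwards [hUd, hw.ae_hasDerivAt_integral] with x h1 h2 hx
    have := ((hg x).fun_mul (h1 hx)).sub (h2 hx a left_mem_uIcc)
    simpa using this)
  have ea := hC a left_mem_uIcc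
  have eb := hC b right_mem_uIcc
  simp only [Pi.sub_apply, intervalIntegral.integral_same, sub_zero] at ea eb
  have e1 : ∫ t in a..b, (g' t * u t + g t * v t) = ∫ t in a..b, (g' t * U t + g t * v t) := by
    refine intervalIntegral.integral_congr fun t ht => ?_
    simp only [hU, hu t ht]
  have e2 : U a = u a := by simp [hU]
  have e3 : U b = u b := (hu b right_mem_uIcc).symm
  rw [e1]
  rw [← ea, e2, e3] at eb
  linear_combination -eb

/-- An integral depending holomorphically on a parameter. -/
theorem differentiableOn_integral_of_dominated {α : Type*} [MeasurableSpace α] {μ : Measure α}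
    {U : Set ℂ} (hU : IsOpen U) {f : ℂ → α → ℂ} {D : α → ℝ} (hD : Integrable D μ)
    (hmeas : ∀ k ∈ U, AEStronglyMeasurable (f k) μ)
    (hbd : ∀ᵐ s ∂μ, ∀ k ∈ U, ‖f k s‖ ≤ D s)
    (hdiff : ∀ᵐ s ∂μ, DifferentiableOn ℂ (fun k => f k s) U) :
    DifferentiableOn ℂ (fun k => ∫ s, f k s ∂μ) U := by
  intro k₀ hk₀
  obtain ⟨r, hr, hball⟩ := Metric.isOpen_iff.1 hU k₀ hk₀
  set ε := r / 2 with hε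
  have hε0 : 0 < ε := by positivity
  have hsub : ∀ x ∈ Metric.ball k₀ ε, ∀ y ∈ Metric.closedBall x (ε / 2), y ∈ U := by
    intro x hx y hy
    apply hball
    rw [Metric.mem_ball] at hx ⊢
    rw [Metric.mem_closedBall] at hy
    linarith [dist_triangle y x k₀]
  have hk₀s : ∀ᶠ x in 𝓝 k₀, x ∈ U := hU.mem_nhds hk₀
  -- The derivative in `k` is dominated by Cauchy's estimate on discs of radius `ε / 2`, which stay
  -- inside `U`.
  refine (hasDerivAt_integral_of_dominated_loc_of_deriv_le (F := f)
    (F' := fun k s => deriv (fun k => f k s) k)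
    (bound := fun s => D s / (ε / 2)) (Metric.ball_mem_nhds k₀ hε0)
    (hk₀s.mono hmeas) ?_ ?_ ?_ (hD.div_const _)
    ?_).2.differentiableAt.differentiableWithinAt
  · exact hD.mono' (hmeas k₀ hk₀) (hbd.mono fun s hs => hs k₀ hk₀)
  -- Measurability of the derivative in `s`: it is the almost everywhere limit of difference
  -- quotients along this sequence.
  · have hlim : Tendsto (fun n : ℕ => k₀ + ((ε / 2 / (n + 1) : ℝ) : ℂ)) atTop (𝓝[≠] k₀) := by
      refine tendsto_nhdsWithin_iff.2 ⟨?_, Eventually.of_forall fun n => ?_⟩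
      · have h1 : Tendsto (fun n : ℕ => (ε / 2 / (n + 1) : ℝ)) atTop (𝓝 0) :=
          by simpa [div_eq_mul_inv] using
            (tendsto_one_div_add_atTop_nhds_zero_nat (𝕜 := ℝ)).const_mul (ε / 2)
        have h2 := (Complex.continuous_ofReal.tendsto 0).comp h1
        simpa using h2.const_add k₀
      · have : (0 : ℝ) < ε / 2 / (n + 1) := by positivity
        simp only [mem_compl_iff, mem_singleton_iff, add_eq_left, Complex.ofReal_eq_zero]
        exact this.ne'
    refine aestronglyMeasurable_of_tendsto_ae atTop
      (f := fun (n : ℕ) s => slope (fun k => f k s) k₀ (k₀ + ((ε / 2 / (n + 1) : ℝ) : ℂ)))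
      (fun n => ?_) ?_
    · simp only [slope_def_module]
      refine ((AEStronglyMeasurable.sub (hmeas (k₀ + ((ε / 2 / (n + 1) : ℝ) : ℂ)) ?_)
        (hmeas k₀ hk₀)).const_smul (k₀ + ((ε / 2 / (n + 1) : ℝ) : ℂ) - k₀)⁻¹ :)
      refine hsub k₀ (Metric.mem_ball_self hε0) _ ?_
      have h0 : (0 : ℝ) ≤ ε / 2 / (n + 1) := by positivity
      rw [Metric.mem_closedBall, dist_eq_norm, add_sub_cancel_left, Complex.norm_real,
        Real.norm_of_nonneg h0]
      exact div_le_self (by positivity) (by linarith [(Nat.cast_nonneg n : (0 : ℝ) ≤ n)])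
    · filter_upwards [hdiff] with s hs
      have := (hs.differentiableAt (hU.mem_nhds hk₀)).hasDerivAt
      exact (hasDerivAt_iff_tendsto_slope.1 this).comp hlim
  · filter_upwards [hbd, hdiff] with s hs hds x hx
    refine Complex.norm_deriv_le_of_forall_mem_sphere_norm_le (by positivity) ?_ ?_
    · refine DifferentiableOn.diffContOnCl ?_
      refine hds.mono ?_
      rw [closure_ball _ (by positivity)]
      exact hsub x hx
    · intro z hz
      exact hs z (hsub x hx z (Metric.sphere_subset_closedBall hz))
  · filter_upwards [hdiff] with s hs x hx
    exact (hs.differentiableAt (hU.mem_nhds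
      (hsub x hx x (Metric.mem_closedBall_self (by positivity))))).hasDerivAt

theorem integral_Ioi_eq_sub {F : Type*} [NormedAddCommGroup F] [NormedSpace ℝ F] {h : ℝ → F}
    (hh : Integrable h) (a t : ℝ) :
    ∫ s in Ioi t, h s = (∫ s in Ioi a, h s) - ∫ s in a..t, h s := by
  have := intervalIntegral.integral_interval_add_Ioi (μ := volume) (f := h) (a := a) (b := t)
    hh.integrableOn hh.integrableOn
  rw [← this, add_sub_cancel_left]

theorem tendsto_integral_Ioi_zero {F : Type*} [NormedAddCommGroup F] [NormedSpace ℝ F] {h : ℝ → F}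
    (hh : Integrable h) : Tendsto (fun t => ∫ s in Ioi t, h s) atTop (𝓝 0) := by
  rw [show (fun t => ∫ s in Ioi t, h s) = _ from funext (integral_Ioi_eq_sub hh 0)]
  have := intervalIntegral_tendsto_integral_Ioi (μ := volume) 0 hh.integrableOn tendsto_id
  simpa using this.const_sub (∫ s in Ioi 0, h s)

/-- An integrable function admits a weight for which the Volterra operator is a
contraction. -/
theorem exists_volterra_weight {m : ℝ → ℝ} (hm : Integrable m) :
    ∃ (w : ℝ → ℝ) (c K : ℝ), Continuous w ∧ 0 < c ∧ (∀ t, c ≤ w t) ∧ (∀ t, w t ≤ K) ∧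
      ∀ t, ∫ s in Ioi t, m s * w s ≤ w t / 2 := by
  -- Take `g` continuous within `1/4` of `m` in `L¹` and `w = exp (-4 ∫₀ᵗ |g|)`. Then `w' = -4 |g|
  -- w`, so `|g|` contributes at most `w t / 4`; since `w` decreases, `m - g` contributes at most
  -- `(1/4) w t`.
  obtain ⟨g, -, hg1, hgc, hgi⟩ :=
    hm.exists_hasCompactSupport_integral_sub_le (ε := 1 / 4) (by norm_num)
  set F : ℝ → ℝ := fun t => ∫ s in (0 : ℝ)..t, |g s| with hF
  have hgai : Integrable fun s => |g s| := hgi.abs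
  have hFd : ∀ t, HasDerivAt F |g t| t := fun t =>
    intervalIntegral.integral_hasDerivAt_right (hgc.abs.intervalIntegrable _ _)
      hgc.abs.stronglyMeasurable.stronglyMeasurableAtFilter hgc.abs.continuousAt
  have hFb : ∀ t, |F t| ≤ ∫ s, |g s| := by
    intro t
    refine (intervalIntegral.norm_integral_le_integral_norm_uIoc (f := fun s => |g s|)).trans ?_
    simp only [Real.norm_eq_abs, abs_abs]
    exact setIntegral_le_integral hgai (Eventually.of_forall fun s => abs_nonneg _)
  set w : ℝ → ℝ := fun t => Real.exp (-4 * F t) with hw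
  have hwd : ∀ t, HasDerivAt w (-4 * (|g t| * w t)) t := by
    intro t
    have := ((hFd t).const_mul (-4)).exp
    convert this using 1
    simp only [hw]; ring
  have hwc : Continuous w := continuous_iff_continuousAt.2 fun t => (hwd t).continuousAt
  have hwanti : Antitone w := by
    refine antitone_of_deriv_nonpos (fun t => (hwd t).differentiableAt) fun t => ?_
    rw [(hwd t).deriv]
    have : 0 ≤ |g t| * w t := mul_nonneg (abs_nonneg _) (Real.exp_pos _).le
    linarith
  set K := Real.exp (4 * ∫ s, |g s|) with hK
  have hwK : ∀ t, w t ≤ K := fun t => by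
    apply Real.exp_le_exp.2
    have := (abs_le.1 (hFb t)).1
    linarith
  have hw0 : ∀ t, 0 < w t := fun t => Real.exp_pos _
  have hmul : ∀ {h : ℝ → ℝ}, Integrable h → Integrable fun s => h s * w s := fun hh =>
    hh.mul_bdd (c := K) hwc.aestronglyMeasurable
      (Eventually.of_forall fun s => by rw [Real.norm_of_nonneg (hw0 s).le]; exact hwK s)
  refine ⟨w, Real.exp (-4 * ∫ s, |g s|), K, hwc, Real.exp_pos _, fun t => ?_, hwK, fun t => ?_⟩
  · apply Real.exp_le_exp.2
    have := (abs_le.1 (hFb t)).2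
    linarith
  · have h1 : ∫ s in Ioi t, |g s| * w s ≤ w t / 4 := by
      have hlim : Tendsto w atTop (𝓝 (Real.exp (-4 * ∫ s in Ioi 0, |g s|))) := by
        have := intervalIntegral_tendsto_integral_Ioi (μ := volume) 0 hgai.integrableOn tendsto_id
        exact (Real.continuous_exp.tendsto _).comp (this.const_mul (-4))
      have := integral_Ioi_of_hasDerivAt_of_tendsto (a := t) (hwc.continuousWithinAt)
        (fun x _ => hwd x) (((hmul hgai).const_mul (-4)).integrableOn) hlim
      rw [integral_const_mul] at this
      have hp := Real.exp_pos (-4 * ∫ s in Ioi 0, |g s|)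
      linarith
    have h2 : ∫ s in Ioi t, |m s - g s| * w s ≤ w t / 4 := by
      have hmg : Integrable fun s => |m s - g s| := (hm.sub hgi).abs
      calc ∫ s in Ioi t, |m s - g s| * w s ≤ ∫ s in Ioi t, |m s - g s| * w t := by
            refine setIntegral_mono_on (hmul hmg).integrableOn
              (hmg.mul_const _).integrableOn measurableSet_Ioi fun s hs => ?_
            exact mul_le_mul_of_nonneg_left (hwanti (le_of_lt hs)) (abs_nonneg _)
        _ = (∫ s in Ioi t, |m s - g s|) * w t := integral_mul_const _ _
        _ ≤ 1 / 4 * w t := by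
            refine mul_le_mul_of_nonneg_right ?_ (hw0 t).le
            exact (setIntegral_le_integral hmg (Eventually.of_forall fun s => abs_nonneg _)).trans
              hg1
        _ = w t / 4 := by ring
    have hmg : Integrable fun s => |m s - g s| := (hm.sub hgi).abs
    calc ∫ s in Ioi t, m s * w s ≤ ∫ s in Ioi t, (|g s| * w s + |m s - g s| * w s) := by
          refine setIntegral_mono_on (hmul hm).integrableOn
            ((hmul hgai).add (hmul hmg)).integrableOn measurableSet_Ioi fun s hs => ?_
          rw [← add_mul]
          refine mul_le_mul_of_nonneg_right ?_ (hw0 s).le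
          have := abs_add_le (g s) (m s - g s)
          rw [add_sub_cancel] at this
          exact (le_abs_self _).trans this
      _ = _ := integral_add (hmul hgai).integrableOn (hmul hmg).integrableOn
      _ ≤ w t / 2 := by linarith

/-! ### The Volterra equation of the Jost column -/

/-- The off-diagonal Volterra operator that carries the oscillating factor. -/
noncomputable def volB (e : ℝ → ℂ) (k : ℂ) (f : ℝ → ℂ) (t : ℝ) : ℂ :=
  ∫ s in Ioi t, Complex.exp (2 * Complex.I * k * (s - t)) * (e s / 2) * f s

/-- The off-diagonal Volterra operator without the oscillating factor. -/
noncomputable def volC (e : ℝ → ℂ) (f : ℝ → ℂ) (t : ℝ) : ℂ :=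
  -∫ s in Ioi t, starRingEnd ℂ (e s) / 2 * f s

/-- The terms of the Neumann series of the second component. -/
noncomputable def neumannTerm (e : ℝ → ℂ) (k : ℂ) : ℕ → ℝ → ℂ
  | 0 => fun _ => 1
  | n + 1 => volC e (volB e k (neumannTerm e k n))

/-- The second component of the normalized Jost column. -/
noncomputable def psiTwo (e : ℝ → ℂ) (k : ℂ) (t : ℝ) : ℂ := ∑' n, neumannTerm e k n t

/-- The first component of the normalized Jost column. -/
noncomputable def psiOne (e : ℝ → ℂ) (k : ℂ) : ℝ → ℂ := volB e k (psiTwo e k)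

/-- A bounded family of continuous functions on the line, continuous in the parameter `k` on the
closed upper half-plane and holomorphic on the open one. -/
structure IsJostFamily (G : ℂ → ℝ → ℂ) (D : ℝ) : Prop where
  continuous : ∀ k : ℂ, 0 ≤ k.im → Continuous (G k)
  norm_le : ∀ k : ℂ, 0 ≤ k.im → ∀ t, ‖G k t‖ ≤ D
  continuousOn : ∀ t, ContinuousOn (fun k => G k t) {k | 0 ≤ k.im}
  differentiableOn : ∀ t, DifferentiableOn ℂ (fun k => G k t) {k | 0 < k.im}

theorem isOpen_upper : IsOpen {k : ℂ | 0 < k.im} := isOpen_lt continuous_const Complex.continuous_im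

theorem norm_exp_two_I_le_one {k : ℂ} (hk : 0 ≤ k.im) {s t : ℝ} (hst : t ≤ s) :
    ‖Complex.exp (2 * Complex.I * k * (s - t))‖ ≤ 1 := by
  rw [Complex.norm_exp, Real.exp_le_one_iff]
  have : (2 * Complex.I * k * ((s : ℂ) - t)).re = -(2 * k.im * (s - t)) := by
    simp [Complex.mul_re, Complex.mul_im]
  rw [this]
  have := mul_nonneg (mul_nonneg zero_le_two hk) (sub_nonneg.2 hst)
  linarith

/-! ### Estimates, continuity and termwise summation for the Volterra operators -/

section Volterra

variable {e : ℝ → ℂ}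

/-- For `s > t` and `Im k ≥ 0` the oscillating factor has modulus at most `1`. The bound on `f` is
required only where `e ≠ 0`, so a function controlled only on the positive half-line is admissible.
-/
theorem norm_volB_le {k : ℂ} (hk : 0 ≤ k.im) {f : ℝ → ℂ} {W : ℝ → ℝ} {t : ℝ}
    (hf : ∀ s > t, e s ≠ 0 → ‖f s‖ ≤ W s) (hW : IntegrableOn (fun s => ‖e s‖ / 2 * W s) (Ioi t)) :
    ‖volB e k f t‖ ≤ ∫ s in Ioi t, ‖e s‖ / 2 * W s := by
  refine norm_integral_le_of_norm_le hW ?_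
  filter_upwards [ae_restrict_mem measurableSet_Ioi] with s hs
  by_cases h0 : e s = 0
  · simp [h0]
  rw [norm_mul, norm_mul, norm_div, Complex.norm_ofNat]
  have h1 := norm_exp_two_I_le_one hk (le_of_lt hs)
  have h2 := hf s hs h0
  gcongr
  exact mul_le_of_le_one_left (by positivity) h1

theorem norm_volC_le {f : ℝ → ℂ} {W : ℝ → ℝ} {t : ℝ}
    (hf : ∀ s > t, e s ≠ 0 → ‖f s‖ ≤ W s) (hW : IntegrableOn (fun s => ‖e s‖ / 2 * W s) (Ioi t)) :
    ‖volC e f t‖ ≤ ∫ s in Ioi t, ‖e s‖ / 2 * W s := by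
  unfold volC
  rw [norm_neg]
  refine norm_integral_le_of_norm_le hW ?_
  filter_upwards [ae_restrict_mem measurableSet_Ioi] with s hs
  by_cases h0 : e s = 0
  · simp [h0]
  rw [norm_mul, norm_div, Complex.norm_ofNat, RCLike.norm_conj]
  have h2 := hf s hs h0
  gcongr

/-- The exponential may grow as `s → -∞`, but there `e` vanishes. -/
theorem integrable_exp_mul (he : Integrable e) (he0 : ∀ s ≤ 0, e s = 0) {k : ℂ} (hk : 0 ≤ k.im) :
    Integrable fun s : ℝ => Complex.exp (2 * Complex.I * k * s) * (e s / 2) := by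
  refine (he.div_const 2).mono
    (AEStronglyMeasurable.mul (Continuous.aestronglyMeasurable (by fun_prop))
      (he.div_const 2).aestronglyMeasurable) (Eventually.of_forall fun s => ?_)
  rcases le_or_gt s 0 with hs | hs
  · simp [he0 s hs]
  · rw [norm_mul]
    have := norm_exp_two_I_le_one hk hs.le
    simp only [Complex.ofReal_zero, sub_zero] at this
    exact mul_le_of_le_one_left (norm_nonneg _) this

theorem integrable_conj_div_two (he : Integrable e) :
    Integrable fun s : ℝ => starRingEnd ℂ (e s) / 2 :=
  (Complex.conjCLE.toContinuousLinearMap.integrable_comp he).div_const 2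

/-- Product of an integrable function supported on the half-line with a bounded function. -/
theorem integrable_mul_of_halfLine {κ f : ℝ → ℂ} (hκ : Integrable κ) (hκ0 : ∀ s ≤ 0, κ s = 0)
    {D : ℝ} (hf : AEStronglyMeasurable f (volume.restrict (Ioi 0))) (hfD : ∀ s > 0, ‖f s‖ ≤ D) :
    Integrable fun s => κ s * f s := by
  have h1 : IntegrableOn (fun s => κ s * f s) (Ioi 0) := by
    refine hκ.integrableOn.mul_bdd (c := D) hf ?_
    filter_upwards [ae_restrict_mem measurableSet_Ioi] with s hs using hfD s hs
  refine (integrableOn_iff_integrable_of_support_subset ?_).1 h1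
  intro s hs
  by_contra hneg
  exact hs (by simp [hκ0 s (not_lt.1 hneg)])

/-- Pulling the `t`-dependence out of the integrand leaves the tail of a fixed integral, from which
continuity in `t` and the differential equation are read off. -/
theorem volB_eq (e : ℝ → ℂ) (k : ℂ) (f : ℝ → ℂ) (t : ℝ) :
    volB e k f t = Complex.exp (-(2 * Complex.I * k * t)) *
      ∫ s in Ioi t, Complex.exp (2 * Complex.I * k * s) * (e s / 2) * f s := by
  rw [volB, ← integral_const_mul]
  congr 1 with s
  rw [← mul_assoc, ← mul_assoc, ← Complex.exp_add]
  congr 3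
  ring

theorem continuous_integral_Ioi {h : ℝ → ℂ} (hh : Integrable h) :
    Continuous fun t => ∫ s in Ioi t, h s := by
  rw [show (fun t => ∫ s in Ioi t, h s) = _ from funext (integral_Ioi_eq_sub hh 0)]
  exact continuous_const.sub (intervalIntegral.continuous_primitive
    (fun a b => hh.intervalIntegrable) 0)

theorem continuous_volB (he : Integrable e) (he0 : ∀ s ≤ 0, e s = 0) {k : ℂ} (hk : 0 ≤ k.im)
    {f : ℝ → ℂ} {D : ℝ} (hf : AEStronglyMeasurable f (volume.restrict (Ioi 0)))
    (hfD : ∀ s > 0, ‖f s‖ ≤ D) : Continuous (volB e k f) := by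
  rw [show volB e k f = _ from funext (volB_eq e k f)]
  refine Continuous.mul (by fun_prop) (continuous_integral_Ioi ?_)
  exact integrable_mul_of_halfLine (integrable_exp_mul he he0 hk) (fun s hs => by simp [he0 s hs])
    hf hfD

theorem continuous_volC (he : Integrable e) (he0 : ∀ s ≤ 0, e s = 0)
    {f : ℝ → ℂ} {D : ℝ} (hf : AEStronglyMeasurable f (volume.restrict (Ioi 0)))
    (hfD : ∀ s > 0, ‖f s‖ ≤ D) : Continuous (volC e f) := by
  refine (continuous_integral_Ioi ?_).neg
  exact integrable_mul_of_halfLine (integrable_conj_div_two he) (fun s hs => by simp [he0 s hs])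
    hf hfD

theorem integral_mul_tsum {κ : ℝ → ℂ} {S : Set ℝ} (hκ : IntegrableOn κ S) {f : ℕ → ℝ → ℂ}
    {d : ℕ → ℝ} (hd : Summable d) (hf : ∀ n, Continuous (f n)) (hfd : ∀ n s, ‖f n s‖ ≤ d n) :
    ∫ s in S, κ s * ∑' n, f n s = ∑' n, ∫ s in S, κ s * f n s := by
  have hintegrable : ∀ n, Integrable (fun s => κ s * f n s) (volume.restrict S) := fun n =>
    hκ.mul_bdd (c := d n) (hf n).aestronglyMeasurable (Eventually.of_forall (hfd n))
  have hd0 : ∀ n, 0 ≤ d n := fun n => (norm_nonneg _).trans (hfd n 0)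
  have hs := hasSum_integral_of_summable_integral_norm hintegrable (by
    refine Summable.of_nonneg_of_le (fun n => by positivity) (fun n => ?_)
      (hd.mul_left (∫ s in S, ‖κ s‖))
    rw [← integral_mul_const]
    refine integral_mono_of_nonneg (Eventually.of_forall fun s => by positivity)
      (hκ.norm.mul_const _) (Eventually.of_forall fun s => ?_)
    simp only [norm_mul]
    exact mul_le_mul_of_nonneg_left (hfd n s) (norm_nonneg _))
  rw [hs.tsum_eq]
  simp only [tsum_mul_left]

theorem integrableOn_kernel (he : Integrable e) {k : ℂ} (hk : 0 ≤ k.im) (t : ℝ) :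
    IntegrableOn (fun s : ℝ => Complex.exp (2 * Complex.I * k * (s - t)) * (e s / 2)) (Ioi t) := by
  have hc : Continuous fun s : ℝ => Complex.exp (2 * Complex.I * k * (s - t)) := by fun_prop
  refine Integrable.mono (he.div_const 2).integrableOn
    (hc.aestronglyMeasurable.mul (he.div_const 2).aestronglyMeasurable.restrict) ?_
  filter_upwards [ae_restrict_mem measurableSet_Ioi] with s hs
  rw [norm_mul]
  exact mul_le_of_le_one_left (norm_nonneg _) (norm_exp_two_I_le_one hk (le_of_lt hs))

theorem volB_tsum (he : Integrable e) {k : ℂ} (hk : 0 ≤ k.im) {f : ℕ → ℝ → ℂ}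
    {d : ℕ → ℝ} (hd : Summable d) (hf : ∀ n, Continuous (f n)) (hfd : ∀ n s, ‖f n s‖ ≤ d n)
    (t : ℝ) : volB e k (fun s => ∑' n, f n s) t = ∑' n, volB e k (f n) t :=
  integral_mul_tsum (integrableOn_kernel he hk t) hd hf hfd

theorem volC_tsum (he : Integrable e) {f : ℕ → ℝ → ℂ}
    {d : ℕ → ℝ} (hd : Summable d) (hf : ∀ n, Continuous (f n)) (hfd : ∀ n s, ‖f n s‖ ≤ d n)
    (t : ℝ) : volC e (fun s => ∑' n, f n s) t = ∑' n, volC e (f n) t := by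
  simp only [volC]
  rw [integral_mul_tsum (integrable_conj_div_two he).integrableOn hd hf hfd, tsum_neg]

theorem volB_sub (he : Integrable e) (he0 : ∀ s ≤ 0, e s = 0) {k : ℂ} (hk : 0 ≤ k.im)
    {f g : ℝ → ℂ} {D D' : ℝ} (hf : AEStronglyMeasurable f (volume.restrict (Ioi 0)))
    (hfD : ∀ s > 0, ‖f s‖ ≤ D) (hg : AEStronglyMeasurable g (volume.restrict (Ioi 0)))
    (hgD : ∀ s > 0, ‖g s‖ ≤ D') (t : ℝ) :
    volB e k f t - volB e k g t = volB e k (fun s => f s - g s) t := by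
  have hκ := integrable_exp_mul he he0 hk
  have hκ0 : ∀ s ≤ 0, Complex.exp (2 * Complex.I * k * (s : ℝ)) * (e s / 2) = 0 :=
    fun s hs => by simp [he0 s hs]
  rw [volB_eq, volB_eq, volB_eq, ← mul_sub, ← integral_sub
    (integrable_mul_of_halfLine hκ hκ0 hf hfD).integrableOn
    (integrable_mul_of_halfLine hκ hκ0 hg hgD).integrableOn]
  simp only [mul_sub]

theorem volC_sub (he : Integrable e) (he0 : ∀ s ≤ 0, e s = 0)
    {f g : ℝ → ℂ} {D D' : ℝ} (hf : AEStronglyMeasurable f (volume.restrict (Ioi 0)))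
    (hfD : ∀ s > 0, ‖f s‖ ≤ D) (hg : AEStronglyMeasurable g (volume.restrict (Ioi 0)))
    (hgD : ∀ s > 0, ‖g s‖ ≤ D') (t : ℝ) :
    volC e f t - volC e g t = volC e (fun s => f s - g s) t := by
  have hκ := integrable_conj_div_two he
  have hκ0 : ∀ s ≤ 0, starRingEnd ℂ (e s) / 2 = 0 := fun s hs => by simp [he0 s hs]
  simp only [volC, mul_sub]
  rw [integral_sub (integrable_mul_of_halfLine hκ hκ0 hf hfD).integrableOn
    (integrable_mul_of_halfLine hκ hκ0 hg hgD).integrableOn]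
  ring

/-- The integrand is dominated by `‖e‖ / 2 * D` for all `k` in the closed upper half-plane, so
continuity and holomorphy in `k` pass through the integral. -/
theorem IsJostFamily.volB (he : Integrable e) (he0 : ∀ s ≤ 0, e s = 0) {G : ℂ → ℝ → ℂ} {D : ℝ}
    (hG : IsJostFamily G D) :
    IsJostFamily (fun k => volB e k (G k)) (∫ s, ‖e s‖ / 2 * D) := by
  have hD : 0 ≤ D := (norm_nonneg _).trans (hG.norm_le 0 le_rfl 0)
  have hintegrable : Integrable fun s => ‖e s‖ / 2 * D := (he.norm.div_const 2).mul_const D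
  have hbd : ∀ k : ℂ, 0 ≤ k.im → ∀ t : ℝ, ∀ s ∈ Ioi t,
      ‖Complex.exp (2 * Complex.I * k * (s - t)) * (e s / 2) * G k s‖ ≤ ‖e s‖ / 2 * D := by
    intro k hk t s hs
    rw [norm_mul, norm_mul, norm_div, Complex.norm_ofNat]
    have h1 := norm_exp_two_I_le_one hk (le_of_lt hs)
    have h2 := hG.norm_le k hk s
    gcongr
    exact mul_le_of_le_one_left (by positivity) h1
  have hmeas : ∀ k : ℂ, 0 ≤ k.im → ∀ t : ℝ, AEStronglyMeasurable
      (fun s : ℝ => Complex.exp (2 * Complex.I * k * (s - t)) * (e s / 2) * G k s)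
      (volume.restrict (Ioi t)) := fun k hk t =>
    (integrableOn_kernel he hk t).aestronglyMeasurable.mul (hG.continuous k hk).aestronglyMeasurable
  refine ⟨fun k hk => ?_, fun k hk t => ?_, fun t => ?_, fun t => ?_⟩
  · exact continuous_volB he he0 hk (hG.continuous k hk).aestronglyMeasurable
      (fun s _ => hG.norm_le k hk s)
  · refine (norm_volB_le hk (W := fun _ => D) (fun s _ _ => hG.norm_le k hk s)
      hintegrable.integrableOn).trans ?_
    exact setIntegral_le_integral hintegrable (Eventually.of_forall fun s => by positivity)
  · refine continuousOn_of_dominated (bound := fun s => ‖e s‖ / 2 * D)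
      (fun k hk => hmeas k hk t) (fun k hk => ?_) hintegrable.integrableOn ?_
    · filter_upwards [ae_restrict_mem measurableSet_Ioi] with s hs using hbd k hk t s hs
    · refine Eventually.of_forall fun s => ?_
      exact ContinuousOn.mul (by fun_prop) (hG.continuousOn s)
  · refine differentiableOn_integral_of_dominated isOpen_upper (D := fun s => ‖e s‖ / 2 * D)
      hintegrable.integrableOn (fun k hk => hmeas k (le_of_lt hk) t) ?_ ?_
    · filter_upwards [ae_restrict_mem measurableSet_Ioi] with s hs k hk
      exact hbd k (le_of_lt hk) t s hs
    · refine Eventually.of_forall fun s => ?_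
      exact DifferentiableOn.mul (by fun_prop) (hG.differentiableOn s)

theorem IsJostFamily.volC (he : Integrable e) (he0 : ∀ s ≤ 0, e s = 0) {G : ℂ → ℝ → ℂ} {D : ℝ}
    (hG : IsJostFamily G D) :
    IsJostFamily (fun k => volC e (G k)) (∫ s, ‖e s‖ / 2 * D) := by
  have hD : 0 ≤ D := (norm_nonneg _).trans (hG.norm_le 0 le_rfl 0)
  have hintegrable : Integrable fun s => ‖e s‖ / 2 * D := (he.norm.div_const 2).mul_const D
  have hbd : ∀ k : ℂ, 0 ≤ k.im → ∀ s : ℝ,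
      ‖starRingEnd ℂ (e s) / 2 * G k s‖ ≤ ‖e s‖ / 2 * D := by
    intro k hk s
    rw [norm_mul, norm_div, Complex.norm_ofNat, RCLike.norm_conj]
    have h2 := hG.norm_le k hk s
    gcongr
  have hmeas : ∀ k : ℂ, 0 ≤ k.im → ∀ t : ℝ, AEStronglyMeasurable
      (fun s : ℝ => starRingEnd ℂ (e s) / 2 * G k s) (volume.restrict (Ioi t)) := fun k hk t =>
    (integrable_conj_div_two he).aestronglyMeasurable.restrict.mul
      (hG.continuous k hk).aestronglyMeasurable
  refine ⟨fun k hk => ?_, fun k hk t => ?_, fun t => ?_, fun t => ?_⟩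
  · exact continuous_volC he he0 (hG.continuous k hk).aestronglyMeasurable
      (fun s _ => hG.norm_le k hk s)
  · refine (norm_volC_le (W := fun _ => D) (fun s _ _ => hG.norm_le k hk s)
      hintegrable.integrableOn).trans ?_
    exact setIntegral_le_integral hintegrable (Eventually.of_forall fun s => by positivity)
  · refine (continuousOn_of_dominated (bound := fun s => ‖e s‖ / 2 * D)
      (fun k hk => hmeas k hk t) (fun k hk => ?_) hintegrable.integrableOn ?_).neg
    · exact Eventually.of_forall fun s => hbd k hk s
    · refine Eventually.of_forall fun s => ?_
      exact ContinuousOn.mul (by fun_prop) (hG.continuousOn s)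
  · refine (differentiableOn_integral_of_dominated isOpen_upper (D := fun s => ‖e s‖ / 2 * D)
      hintegrable.integrableOn (fun k hk => hmeas k (le_of_lt hk) t) ?_ ?_).neg
    · exact Eventually.of_forall fun s k hk => hbd k (le_of_lt hk) s
    · refine Eventually.of_forall fun s => ?_
      exact DifferentiableOn.mul (by fun_prop) (hG.differentiableOn s)

/-- A weight for which both Volterra operators are contractions with factor `1/2`. -/
structure IsVolterraWeight (e : ℝ → ℂ) (w : ℝ → ℝ) (c K : ℝ) : Prop where
  continuous : Continuous w
  pos : 0 < c
  le : ∀ t, c ≤ w t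
  le_bound : ∀ t, w t ≤ K
  integral_le : ∀ t, ∫ s in Ioi t, ‖e s‖ / 2 * w s ≤ w t / 2

theorem exists_isVolterraWeight (he : Integrable e) : ∃ w c K, IsVolterraWeight e w c K := by
  obtain ⟨w, c, K, h1, h2, h3, h4, h5⟩ := exists_volterra_weight (he.norm.div_const 2)
  exact ⟨w, c, K, h1, h2, h3, h4, h5⟩

theorem IsVolterraWeight.integrable {w : ℝ → ℝ} {c K : ℝ} (hw : IsVolterraWeight e w c K)
    (he : Integrable e) (A : ℝ) : Integrable fun s => ‖e s‖ / 2 * (A * w s) := by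
  refine (he.norm.div_const 2).mul_bdd (c := |A| * K)
    (hw.continuous.const_mul A |>.aestronglyMeasurable) (Eventually.of_forall fun s => ?_)
  rw [norm_mul, Real.norm_eq_abs, Real.norm_of_nonneg (hw.pos.le.trans (hw.le s))]
  exact mul_le_mul_of_nonneg_left (hw.le_bound s) (abs_nonneg _)

theorem IsVolterraWeight.integral_mul_le {w : ℝ → ℝ} {c K : ℝ} (hw : IsVolterraWeight e w c K)
    {A : ℝ} (hA : 0 ≤ A) (t : ℝ) : ∫ s in Ioi t, ‖e s‖ / 2 * (A * w s) ≤ A / 2 * w t := by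
  have : ∀ s, ‖e s‖ / 2 * (A * w s) = A * (‖e s‖ / 2 * w s) := fun s => by ring
  simp only [this, integral_const_mul]
  have := mul_le_mul_of_nonneg_left (hw.integral_le t) hA
  linarith

/-- One step of the iteration gains the factor `1/4`. -/
theorem IsVolterraWeight.norm_volC_volB_le {w : ℝ → ℝ} {c K : ℝ} (hw : IsVolterraWeight e w c K)
    (he : Integrable e) (he0 : ∀ s ≤ 0, e s = 0) {k : ℂ} (hk : 0 ≤ k.im) {f : ℝ → ℂ} {A : ℝ}
    (hA : 0 ≤ A) (hf : ∀ s > 0, ‖f s‖ ≤ A * w s) (t : ℝ) :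
    ‖volC e (volB e k f) t‖ ≤ A / 4 * w t := by
  have h0 : ∀ s, e s ≠ 0 → 0 < s := fun s h => by
    by_contra hs
    exact h (he0 s (not_lt.1 hs))
  have h1 : ∀ t, ‖volB e k f t‖ ≤ A / 2 * w t := fun t =>
    (norm_volB_le hk (fun s _ h => hf s (h0 s h)) (hw.integrable he A).integrableOn).trans
      (hw.integral_mul_le hA t)
  have h2 := (norm_volC_le (t := t) (fun s _ _ => h1 s)
    (hw.integrable he (A / 2)).integrableOn).trans
      (hw.integral_mul_le (by positivity) t)
  linarith

/-- The zeroth term satisfies `1 ≤ w / c`, and each application of the two operators gains `1/4`.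
The bound does not depend on `k`. -/
theorem norm_neumannTerm_le {w : ℝ → ℝ} {c K : ℝ} (hw : IsVolterraWeight e w c K)
    (he : Integrable e) (he0 : ∀ s ≤ 0, e s = 0) {k : ℂ} (hk : 0 ≤ k.im) (n : ℕ) (t : ℝ) :
    ‖neumannTerm e k n t‖ ≤ c⁻¹ * (1 / 4) ^ n * w t := by
  have hc := hw.pos
  induction n generalizing t with
  | zero =>
    simp only [neumannTerm, norm_one, pow_zero, mul_one]
    rw [inv_mul_eq_div, one_le_div hc]
    exact hw.le t
  | succ n ih =>
    have := hw.norm_volC_volB_le he he0 hk (A := c⁻¹ * (1 / 4) ^ n) (by positivity)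
      (fun s _ => ih s) t
    rw [neumannTerm]
    refine this.trans (le_of_eq ?_)
    ring

theorem isJostFamily_neumannTerm {w : ℝ → ℝ} {c K : ℝ} (hw : IsVolterraWeight e w c K)
    (he : Integrable e) (he0 : ∀ s ≤ 0, e s = 0) (n : ℕ) :
    IsJostFamily (fun k => neumannTerm e k n) (c⁻¹ * (1 / 4) ^ n * K) := by
  have hc := hw.pos
  have hbd : ∀ n, ∀ k : ℂ, 0 ≤ k.im → ∀ t, ‖neumannTerm e k n t‖ ≤ c⁻¹ * (1 / 4) ^ n * K :=
    fun n k hk t => (norm_neumannTerm_le hw he he0 hk n t).trans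
      (mul_le_mul_of_nonneg_left (hw.le_bound t) (by positivity))
  induction n with
  | zero =>
    exact ⟨fun k _ => continuous_const, hbd 0, fun t => continuousOn_const,
      fun t => differentiableOn_const _⟩
  | succ n ih =>
    have := (ih.volB he he0).volC he he0
    exact ⟨this.continuous, hbd (n + 1), this.continuousOn, this.differentiableOn⟩

theorem IsVolterraWeight.summable {w : ℝ → ℝ} {c K : ℝ} (_hw : IsVolterraWeight e w c K) :
    Summable fun n : ℕ => c⁻¹ * (1 / 4 : ℝ) ^ n * K :=
  ((summable_geometric_of_lt_one (by norm_num) (by norm_num)).mul_left _).mul_right _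

/-- The Neumann series has a geometric majorant uniform in `k` and `t`, so the Weierstrass test
transfers the properties of its terms. -/
theorem isJostFamily_psiTwo (he : Integrable e) (he0 : ∀ s ≤ 0, e s = 0) :
    ∃ D, IsJostFamily (psiTwo e) D := by
  obtain ⟨w, c, K, hw⟩ := exists_isVolterraWeight he
  have hfam := isJostFamily_neumannTerm hw he he0
  refine ⟨∑' n : ℕ, c⁻¹ * (1 / 4 : ℝ) ^ n * K, fun k hk => ?_, fun k hk t => ?_, fun t => ?_,
    fun t => ?_⟩
  · exact continuous_tsum (fun n => (hfam n).continuous k hk) hw.summable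
      (fun n t => (hfam n).norm_le k hk t)
  · exact tsum_of_norm_bounded hw.summable.hasSum (fun n => (hfam n).norm_le k hk t)
  · exact continuousOn_tsum (fun n => (hfam n).continuousOn t) hw.summable
      (fun n k hk => (hfam n).norm_le k hk t)
  · exact Complex.differentiableOn_tsum_of_summable_norm hw.summable
      (fun n => (hfam n).differentiableOn t) isOpen_upper
      (fun n k hk => (hfam n).norm_le k (le_of_lt hk) t)

theorem isJostFamily_psiOne (he : Integrable e) (he0 : ∀ s ≤ 0, e s = 0) :
    ∃ D, IsJostFamily (psiOne e) D := by
  obtain ⟨D, hD⟩ := isJostFamily_psiTwo he he0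
  exact ⟨_, hD.volB he he0⟩

theorem psiTwo_eq (he : Integrable e) (he0 : ∀ s ≤ 0, e s = 0) {k : ℂ} (hk : 0 ≤ k.im) (t : ℝ) :
    psiTwo e k t = 1 + volC e (psiOne e k) t := by
  obtain ⟨w, c, K, hw⟩ := exists_isVolterraWeight he
  have hfam := isJostFamily_neumannTerm hw he he0
  have h1 : psiOne e k = fun t => ∑' n, volB e k (neumannTerm e k n) t :=
    funext fun t => volB_tsum he hk hw.summable (fun n => (hfam n).continuous k hk)
      (fun n s => (hfam n).norm_le k hk s) t
  have hfamB := fun n => (hfam n).volB he he0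
  have hs : Summable fun n : ℕ => ∫ s, ‖e s‖ / 2 * (c⁻¹ * (1 / 4 : ℝ) ^ n * K) := by
    simp only [integral_mul_const]
    exact hw.summable.mul_left _
  have hsum : Summable fun n => neumannTerm e k n t :=
    Summable.of_norm_bounded hw.summable fun n => (hfam n).norm_le k hk t
  rw [h1, volC_tsum he hs (fun n => (hfamB n).continuous k hk)
      (fun n s => (hfamB n).norm_le k hk s), psiTwo, hsum.tsum_eq_zero_add]
  rfl

/-- The difference of two bounded solutions is fixed by a map that contracts the weighted norm by
`1/4`, hence is zero. -/
theorem eq_psiTwo_of_volterra (he : Integrable e) (he0 : ∀ s ≤ 0, e s = 0) {k : ℂ}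
    (hk : 0 ≤ k.im) {f : ℝ → ℂ} {D : ℝ} (hf : ContinuousOn f (Ici 0)) (hfD : ∀ s > 0, ‖f s‖ ≤ D)
    (heq : ∀ t, 0 ≤ t → f t = 1 + volC e (volB e k f) t) {t : ℝ} (ht : 0 ≤ t) :
    f t = psiTwo e k t := by
  obtain ⟨w, c, K, hw⟩ := exists_isVolterraWeight he
  obtain ⟨D', hD'⟩ := isJostFamily_psiTwo he he0
  have hfm : AEStronglyMeasurable f (volume.restrict (Ioi 0)) :=
    (hf.mono Ioi_subset_Ici_self).aestronglyMeasurable measurableSet_Ioi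
  have hgm := (hD'.continuous k hk).aestronglyMeasurable (μ := volume.restrict (Ioi 0))
  have hgD : ∀ s > 0, ‖psiTwo e k s‖ ≤ D' := fun s _ => hD'.norm_le k hk s
  have h0 : ∀ s, e s ≠ 0 → 0 < s := fun s h => by
    by_contra hs
    exact h (he0 s (not_lt.1 hs))
  have hBb : ∀ {f : ℝ → ℂ} {D : ℝ}, (∀ s > 0, ‖f s‖ ≤ D) → ∀ t > 0,
      ‖volB e k f t‖ ≤ ∫ s, ‖e s‖ / 2 * |D| := by
    intro f D hfD t _
    have hintegrable : Integrable fun s => ‖e s‖ / 2 * |D| := (he.norm.div_const 2).mul_const _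
    refine (norm_volB_le hk (W := fun _ => |D|)
      (fun s _ h => (hfD s (h0 s h)).trans (le_abs_self _)) hintegrable.integrableOn).trans ?_
    exact setIntegral_le_integral hintegrable (Eventually.of_forall fun s => by positivity)
  set d : ℝ → ℂ := fun s => f s - psiTwo e k s with hd
  have hdeq : ∀ t, 0 ≤ t → d t = volC e (volB e k d) t := by
    intro t ht
    have hB : (fun s => volB e k f s - volB e k (psiTwo e k) s) = volB e k d :=
      funext fun s => volB_sub he he0 hk hfm hfD hgm hgD s
    have := volC_sub he he0 (continuous_volB he he0 hk hfm hfD).aestronglyMeasurable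
      (hBb hfD) (continuous_volB he he0 hk hgm hgD).aestronglyMeasurable (hBb hgD) t
    rw [hB] at this
    rw [← this]
    simp only [hd]
    rw [heq t ht, psiTwo_eq he he0 hk t, psiOne]
    ring
  have hc := hw.pos
  have hDD : 0 ≤ D + D' := add_nonneg ((norm_nonneg _).trans (hfD 1 one_pos))
    ((norm_nonneg _).trans (hgD 1 one_pos))
  have hiter : ∀ n : ℕ, ∀ t > 0, ‖d t‖ ≤ (D + D') / c * (1 / 4) ^ n * w t := by
    intro n
    induction n with
    | zero =>
      intro t ht
      refine (norm_sub_le _ _).trans ((add_le_add (hfD t ht) (hgD t ht)).trans ?_)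
      rw [pow_zero, mul_one, div_mul_eq_mul_div, le_div_iff₀ hc]
      exact mul_le_mul_of_nonneg_left (hw.le t) hDD
    | succ n ih =>
      intro t ht
      rw [hdeq t ht.le]
      refine (hw.norm_volC_volB_le he he0 hk (by positivity) ih t).trans (le_of_eq ?_)
      ring
  have hzero : ∀ t > 0, d t = 0 := by
    intro t ht
    have hlim : Tendsto (fun n : ℕ => (D + D') / c * (1 / 4 : ℝ) ^ n * w t) atTop (𝓝 0) := by
      simpa using ((tendsto_pow_atTop_nhds_zero_of_lt_one (by norm_num : (0 : ℝ) ≤ 1 / 4)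
        (by norm_num)).const_mul ((D + D') / c)).mul_const (w t)
    exact norm_le_zero_iff.1 (ge_of_tendsto' hlim fun n => hiter n t ht)
  -- The iteration controls `d` only for `t > 0`; the value at `t = 0` comes from the equation,
  -- whose integrals see only `s > 0`.
  have hdt : d t = 0 := by
    rw [hdeq t ht]
    have h4 := hw.norm_volC_volB_le he he0 hk (f := d) (A := 0) le_rfl
      (fun s hs => by simp [hzero s hs]) t
    simpa using h4
  exact sub_eq_zero.1 hdt

end Volterra

/-! ### The spectral functions -/

theorem laxU_mulVec (e k : ℂ) (v : Fin 2 → ℂ) :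
    (laxU e k).mulVec v = ![-(Complex.I * k * v 0 + e / 2 * v 1),
      Complex.I * k * v 1 + starRingEnd ℂ e / 2 * v 0] := by
  ext i
  fin_cases i
  · simp [laxU, laxH, sigma3, Matrix.mulVec, dotProduct, Fin.sum_univ_two]
    ring_nf
    simp
  · simp [laxU, laxH, sigma3, Matrix.mulVec, dotProduct, Fin.sum_univ_two]
    ring_nf
    simp

theorem exists_bound_of_tendsto_atTop {f : ℝ → ℂ} (hf : ContinuousOn f (Ici 0)) {L : ℂ}
    (hL : Tendsto f atTop (𝓝 L)) : ∃ D, ∀ s > 0, ‖f s‖ ≤ D := by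
  obtain ⟨T, hT⟩ := eventually_atTop.1
    ((hL.norm.eventually (gt_mem_nhds (lt_add_one ‖L‖))))
  obtain ⟨C, hC⟩ := (isCompact_Icc (a := (0 : ℝ)) (b := T)).exists_bound_of_continuousOn
    (hf.mono Icc_subset_Ici_self)
  refine ⟨max C (‖L‖ + 1), fun s hs => ?_⟩
  rcases le_total s T with h | h
  · exact (hC s ⟨hs.le, h⟩).trans (le_max_left _ _)
  · exact (hT s h).le.trans (le_max_right _ _)

/-! ### Existence and uniqueness of the Jost column -/

section Jost

variable {E : ℝ → ℂ}

theorem integrable_indicator_pulse (hE : IntegrableOn E (Ioi 0)) :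
    Integrable ((Ioi (0 : ℝ)).indicator E) :=
  hE.integrable_indicator measurableSet_Ioi

theorem indicator_pulse_nonpos (E : ℝ → ℂ) : ∀ s ≤ 0, (Ioi (0 : ℝ)).indicator E s = 0 :=
  fun s hs => indicator_of_notMem (by simpa using hs) E

theorem intervalIntegrable_pulse (hE : IntegrableOn E (Ioi 0)) {t : ℝ} (ht : 0 ≤ t) :
    IntervalIntegrable E volume 0 t := by
  rw [intervalIntegrable_iff_integrableOn_Ioc_of_le ht]
  exact hE.mono_set Ioc_subset_Ioi_self

theorem intervalIntegrable_laxU (hE : IntegrableOn E (Ioi 0)) (k : ℂ) {φ : ℝ → Fin 2 → ℂ}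
    (hφ : ContinuousOn φ (Ici 0)) {t : ℝ} (ht : 0 ≤ t) (i : Fin 2) :
    IntervalIntegrable (fun s => (laxU (E s) k).mulVec (φ s) i) volume 0 t := by
  have hc : ∀ i, ContinuousOn (fun s => φ s i) (uIcc 0 t) := fun i =>
    ((continuous_apply i).comp_continuousOn hφ).mono (by
      rw [uIcc_of_le ht]; exact Icc_subset_Ici_self)
  have hEi := intervalIntegrable_pulse hE ht
  have hEc : IntervalIntegrable (fun s => starRingEnd ℂ (E s)) volume 0 t := by
    rw [intervalIntegrable_iff] at hEi ⊢
    exact Complex.conjCLE.toContinuousLinearMap.integrable_comp hEi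
  fin_cases i
  · simp only [laxU_mulVec]
    exact (((hc 0).const_smul (Complex.I * k)).intervalIntegrable.add
      ((hEi.div_const 2).mul_continuousOn (hc 1))).neg
  · simp only [laxU_mulVec]
    exact ((hc 1).const_smul (Complex.I * k)).intervalIntegrable.add
      ((hEc.div_const 2).mul_continuousOn (hc 0))

theorem intervalIntegral_laxU_apply (hE : IntegrableOn E (Ioi 0)) (k : ℂ) {φ : ℝ → Fin 2 → ℂ}
    (hφ : ContinuousOn φ (Ici 0)) {t : ℝ} (ht : 0 ≤ t) (i : Fin 2) :
    (∫ s in (0 : ℝ)..t, (laxU (E s) k).mulVec (φ s)) i =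
      ∫ s in (0 : ℝ)..t, (laxU (E s) k).mulVec (φ s) i := by
  rw [intervalIntegral.integral_of_le ht, intervalIntegral.integral_of_le ht]
  refine eval_integral (fun j => ?_) i
  exact (intervalIntegrable_iff_integrableOn_Ioc_of_le ht).1 (intervalIntegrable_laxU hE k hφ ht j)

theorem hasDerivAt_exp_mul (c : ℂ) (t : ℝ) :
    HasDerivAt (fun s : ℝ => Complex.exp (c * s)) (c * Complex.exp (c * t)) t := by
  have h : HasDerivAt (fun s : ℝ => c * (s : ℂ)) (c * 1) t :=
    (Complex.ofRealCLM.hasDerivAt (x := t)).const_mul c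
  simpa [mul_comm] using h.cexp

theorem continuous_exp_deriv (c : ℂ) : Continuous fun s : ℝ => c * Complex.exp (c * s) := by
  fun_prop

/-- The components are `e^{-ikt}` times the tail integral of `e^{2iks} (e/2) ψ₂` and `e^{ikt} ψ₂`,
products of an exponential with a primitive of an integrable function; integration by parts gives
the integrated Lax equation. The limits at infinity hold because tails of convergent integrals
vanish. -/
theorem isJostColumn_psi (hE : IntegrableOn E (Ioi 0)) {k : ℂ} (hk : 0 ≤ k.im) :
    IsJostColumn E k fun t => ![Complex.exp (Complex.I * k * t) *
      psiOne ((Ioi 0).indicator E) k t, Complex.exp (Complex.I * k * t) *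
      psiTwo ((Ioi 0).indicator E) k t] := by
  set e := (Ioi (0 : ℝ)).indicator E with hedef
  have he : Integrable e := integrable_indicator_pulse hE
  have he0 : ∀ s ≤ 0, e s = 0 := indicator_pulse_nonpos E
  obtain ⟨D₁, h₁⟩ := isJostFamily_psiOne he he0
  obtain ⟨D₂, h₂⟩ := isJostFamily_psiTwo he he0
  have c₁ := h₁.continuous k hk
  have c₂ := h₂.continuous k hk
  have hH : Integrable fun s : ℝ => Complex.exp (2 * Complex.I * k * s) * (e s / 2) *
      psiTwo e k s :=
    integrable_mul_of_halfLine (integrable_exp_mul he he0 hk) (fun s hs => by simp [he0 s hs])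
      c₂.aestronglyMeasurable (fun s _ => h₂.norm_le k hk s)
  have hH₂ : Integrable fun s : ℝ => starRingEnd ℂ (e s) / 2 * psiOne e k s :=
    integrable_mul_of_halfLine (integrable_conj_div_two he) (fun s hs => by simp [he0 s hs])
      c₁.aestronglyMeasurable (fun s _ => h₁.norm_le k hk s)
  have hφc : Continuous fun t : ℝ => (![Complex.exp (Complex.I * k * t) * psiOne e k t,
      Complex.exp (Complex.I * k * t) * psiTwo e k t] : Fin 2 → ℂ) := by
    refine continuous_pi fun i => ?_
    fin_cases i
    · exact (by fun_prop : Continuous fun t : ℝ => Complex.exp (Complex.I * k * t)).mul c₁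
    · exact (by fun_prop : Continuous fun t : ℝ => Complex.exp (Complex.I * k * t)).mul c₂
  have heE : ∀ t : ℝ, 0 ≤ t → ∀ s ∈ uIoc 0 t, e s = E s := by
    intro t ht s hs
    rw [uIoc_of_le ht] at hs
    exact indicator_of_mem (show s ∈ Ioi 0 from hs.1) E
  refine ⟨hφc.continuousOn, fun t ht => ?_, ?_⟩
  · ext i
    rw [Pi.add_apply, intervalIntegral_laxU_apply hE k hφc.continuousOn ht]
    fin_cases i
    · have hPR := integral_deriv_mul_add_mul (a := 0) (b := t)
        (u := fun t => ∫ s in Ioi t, Complex.exp (2 * Complex.I * k * s) * (e s / 2) *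
          psiTwo e k s)
        (v := fun s => -(Complex.exp (2 * Complex.I * k * s) * (e s / 2) * psiTwo e k s))
        hH.neg.intervalIntegrable
        (fun s _ => by
          rw [intervalIntegral.integral_neg, integral_Ioi_eq_sub hH 0 s, sub_eq_add_neg])
        (hasDerivAt_exp_mul (-(Complex.I * k))) (continuous_exp_deriv _)
      have hrel : ∀ s : ℝ, Complex.exp (-(Complex.I * k) * s) *
          (∫ s in Ioi s, Complex.exp (2 * Complex.I * k * s) * (e s / 2) * psiTwo e k s) =
          Complex.exp (Complex.I * k * s) * psiOne e k s := by
        intro s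
        rw [psiOne, volB_eq, ← mul_assoc, ← Complex.exp_add]
        congr 2; ring
      rw [hrel, hrel] at hPR
      have : ∫ s in (0 : ℝ)..t, (laxU (E s) k).mulVec ![Complex.exp (Complex.I * k * s) *
          psiOne e k s, Complex.exp (Complex.I * k * s) * psiTwo e k s] 0 =
          ∫ s in (0 : ℝ)..t, (-(Complex.I * k) * Complex.exp (-(Complex.I * k) * s) *
          (∫ s in Ioi s, Complex.exp (2 * Complex.I * k * s) * (e s / 2) * psiTwo e k s) +
          Complex.exp (-(Complex.I * k) * s) *
            -(Complex.exp (2 * Complex.I * k * s) * (e s / 2) * psiTwo e k s)) := by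
        refine intervalIntegral.integral_congr_ae (Eventually.of_forall fun s hs => ?_)
        rw [mul_assoc (-(Complex.I * k)), hrel, heE t ht s hs, laxU_mulVec]
        have : Complex.exp (Complex.I * k * s) =
            Complex.exp (-(Complex.I * k) * s) * Complex.exp (2 * Complex.I * k * s) := by
          rw [← Complex.exp_add]; congr 1; ring
        simp only [Matrix.cons_val_zero, Matrix.cons_val_one]
        linear_combination (-(E s / 2 * psiTwo e k s)) * this
      simp only [Fin.zero_eta, Matrix.cons_val_zero] at this ⊢
      rw [this, hPR]
      ring
    · have hψ : ∀ s, psiTwo e k s = psiTwo e k 0 +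
          ∫ r in (0 : ℝ)..s, starRingEnd ℂ (e r) / 2 * psiOne e k r := by
        intro s
        rw [psiTwo_eq he he0 hk, psiTwo_eq he he0 hk, volC, volC, integral_Ioi_eq_sub hH₂ 0 s]
        ring
      have hPR := integral_deriv_mul_add_mul (a := 0) (b := t)
        (u := psiTwo e k) (v := fun s => starRingEnd ℂ (e s) / 2 * psiOne e k s)
        hH₂.intervalIntegrable (fun s _ => hψ s)
        (hasDerivAt_exp_mul (Complex.I * k)) (continuous_exp_deriv _)
      have : ∫ s in (0 : ℝ)..t, (laxU (E s) k).mulVec ![Complex.exp (Complex.I * k * s) *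
          psiOne e k s, Complex.exp (Complex.I * k * s) * psiTwo e k s] 1 =
          ∫ s in (0 : ℝ)..t, (Complex.I * k * Complex.exp (Complex.I * k * s) * psiTwo e k s +
          Complex.exp (Complex.I * k * s) * (starRingEnd ℂ (e s) / 2 * psiOne e k s)) := by
        refine intervalIntegral.integral_congr_ae (Eventually.of_forall fun s hs => ?_)
        rw [heE t ht s hs, laxU_mulVec]
        simp only [Matrix.cons_val_zero, Matrix.cons_val_one]
        ring
      simp only [Fin.mk_one, Matrix.cons_val_one, Matrix.cons_val_fin_one] at this ⊢
      rw [this, hPR]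
      ring
  · rw [tendsto_pi_nhds]
    have hcancel : ∀ t : ℝ, Complex.exp (-(Complex.I * k * t)) *
        Complex.exp (Complex.I * k * t) = 1 := fun t => by
      rw [← Complex.exp_add]; simp
    intro i
    fin_cases i
    · have hb : Tendsto (fun t => ∫ s in Ioi t, ‖e s‖ / 2 * D₂) atTop (𝓝 0) :=
        tendsto_integral_Ioi_zero ((he.norm.div_const 2).mul_const D₂)
      have h0 : Tendsto (psiOne e k) atTop (𝓝 0) := squeeze_zero_norm (fun t =>
        norm_volB_le hk (fun s _ _ => h₂.norm_le k hk s)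
          ((he.norm.div_const 2).mul_const D₂).integrableOn) hb
      simpa [← mul_assoc, hcancel] using h0
    · have hb := tendsto_integral_Ioi_zero hH₂
      have h0 : Tendsto (psiTwo e k) atTop (𝓝 1) := by
        rw [show psiTwo e k = _ from funext (psiTwo_eq he he0 hk)]
        simpa [volC] using hb.neg.const_add 1
      simpa [← mul_assoc, hcancel] using h0

/-- Integrating factors turn the Lax equation into integral equations starting at `0`; the
normalization at infinity determines the initial values, and the result is the Volterra system,
which has only one bounded solution. -/
theorem IsJostColumn.apply_zero (hE : IntegrableOn E (Ioi 0)) {k : ℂ} (hk : 0 ≤ k.im)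
    {φ : ℝ → Fin 2 → ℂ} (h : IsJostColumn E k φ) :
    φ 0 = ![psiOne ((Ioi 0).indicator E) k 0, psiTwo ((Ioi 0).indicator E) k 0] := by
  set e := (Ioi (0 : ℝ)).indicator E with hedef
  have he : Integrable e := integrable_indicator_pulse hE
  have he0 : ∀ s ≤ 0, e s = 0 := indicator_pulse_nonpos E
  have heE : ∀ t : ℝ, 0 ≤ t → ∀ s ∈ uIoc 0 t, e s = E s := by
    intro t ht s hs
    rw [uIoc_of_le ht] at hs
    exact indicator_of_mem (show s ∈ Ioi 0 from hs.1) E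
  have hc : ∀ i, ContinuousOn (fun s => φ s i) (Ici 0) := fun i =>
    (continuous_apply i).comp_continuousOn h.continuousOn
  have heq : ∀ i, ∀ t : ℝ, 0 ≤ t → φ t i = φ 0 i +
      ∫ s in (0 : ℝ)..t, (laxU (E s) k).mulVec (φ s) i := by
    intro i t ht
    rw [← intervalIntegral_laxU_apply hE k h.continuousOn ht, ← Pi.add_apply,
      ← h.equation t ht]
  have hexp : ∀ c : ℂ, Continuous fun t : ℝ => Complex.exp (c * t) := fun c => by fun_prop
  set q : ℝ → ℂ := fun t => Complex.exp (-(Complex.I * k) * t) * φ t 0 with hq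
  set f : ℝ → ℂ := fun t => Complex.exp (-(Complex.I * k) * t) * φ t 1 with hf
  have hqc : ContinuousOn q (Ici 0) := (hexp _).continuousOn.mul (hc 0)
  have hfc : ContinuousOn f (Ici 0) := (hexp _).continuousOn.mul (hc 1)
  have hlim := tendsto_pi_nhds.1 h.normalization
  have hq0 : Tendsto q atTop (𝓝 0) := by simpa [hq] using hlim 0
  have hf1 : Tendsto f atTop (𝓝 1) := by simpa [hf] using hlim 1
  obtain ⟨Dq, hDq⟩ := exists_bound_of_tendsto_atTop hqc hq0
  obtain ⟨Df, hDf⟩ := exists_bound_of_tendsto_atTop hfc hf1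
  have hfm : AEStronglyMeasurable f (volume.restrict (Ioi 0)) :=
    (hfc.mono Ioi_subset_Ici_self).aestronglyMeasurable measurableSet_Ioi
  have hqm : AEStronglyMeasurable q (volume.restrict (Ioi 0)) :=
    (hqc.mono Ioi_subset_Ici_self).aestronglyMeasurable measurableSet_Ioi
  have hH : Integrable fun s : ℝ => Complex.exp (2 * Complex.I * k * s) * (e s / 2) * f s :=
    integrable_mul_of_halfLine (integrable_exp_mul he he0 hk) (fun s hs => by simp [he0 s hs])
      hfm hDf
  have hH₂ : Integrable fun s : ℝ => starRingEnd ℂ (e s) / 2 * q s :=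
    integrable_mul_of_halfLine (integrable_conj_div_two he) (fun s hs => by simp [he0 s hs])
      hqm hDq
  have hfirst : ∀ t : ℝ, 0 ≤ t → Complex.exp (Complex.I * k * t) * φ t 0 = φ 0 0 -
      ∫ s in (0 : ℝ)..t, Complex.exp (2 * Complex.I * k * s) * (e s / 2) * f s := by
    intro t ht
    have hPR := integral_deriv_mul_add_mul (a := 0) (b := t) (u := fun s => φ s 0)
      (intervalIntegrable_laxU hE k h.continuousOn ht 0)
      (fun s hs => heq 0 s (by rw [uIcc_of_le ht] at hs; exact hs.1))
      (hasDerivAt_exp_mul (Complex.I * k)) (continuous_exp_deriv _)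
    have : ∫ s in (0 : ℝ)..t, (Complex.I * k * Complex.exp (Complex.I * k * s) * φ s 0 +
        Complex.exp (Complex.I * k * s) * (laxU (E s) k).mulVec (φ s) 0) =
        ∫ s in (0 : ℝ)..t, -(Complex.exp (2 * Complex.I * k * s) * (e s / 2) * f s) := by
      refine intervalIntegral.integral_congr_ae (Eventually.of_forall fun s hs => ?_)
      rw [heE t ht s hs, laxU_mulVec]
      have : Complex.exp (Complex.I * k * s) =
          Complex.exp (-(Complex.I * k) * s) * Complex.exp (2 * Complex.I * k * s) := by
        rw [← Complex.exp_add]; congr 1; ring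
      simp only [Matrix.cons_val_zero, hf]
      linear_combination (-(E s / 2 * φ s 1)) * this
    rw [this, intervalIntegral.integral_neg] at hPR
    simp only [Complex.ofReal_zero, mul_zero, Complex.exp_zero, one_mul] at hPR
    linear_combination -hPR
  have hsecond : ∀ t : ℝ, 0 ≤ t → f t = φ 0 1 +
      ∫ s in (0 : ℝ)..t, starRingEnd ℂ (e s) / 2 * q s := by
    intro t ht
    have hPR := integral_deriv_mul_add_mul (a := 0) (b := t) (u := fun s => φ s 1)
      (intervalIntegrable_laxU hE k h.continuousOn ht 1)
      (fun s hs => heq 1 s (by rw [uIcc_of_le ht] at hs; exact hs.1))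
      (hasDerivAt_exp_mul (-(Complex.I * k))) (continuous_exp_deriv _)
    have : ∫ s in (0 : ℝ)..t, (-(Complex.I * k) * Complex.exp (-(Complex.I * k) * s) * φ s 1 +
        Complex.exp (-(Complex.I * k) * s) * (laxU (E s) k).mulVec (φ s) 1) =
        ∫ s in (0 : ℝ)..t, starRingEnd ℂ (e s) / 2 * q s := by
      refine intervalIntegral.integral_congr_ae (Eventually.of_forall fun s hs => ?_)
      rw [heE t ht s hs, laxU_mulVec]
      simp only [Matrix.cons_val_one, Matrix.cons_val_fin_one, hq]
      ring
    rw [this] at hPR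
    simp only [Complex.ofReal_zero, mul_zero, Complex.exp_zero, one_mul] at hPR
    simp only [hf]
    linear_combination -hPR
  have hφ00 : φ 0 0 =
      ∫ s in Ioi (0 : ℝ), Complex.exp (2 * Complex.I * k * s) * (e s / 2) * f s := by
    -- This function is `e^{2ikt} q t`, where `q → 0` by the normalization and the exponential has
    -- modulus at most `1`.
    have l1 : Tendsto (fun t : ℝ => Complex.exp (Complex.I * k * t) * φ t 0) atTop (𝓝 0) := by
      refine squeeze_zero_norm' ?_ (tendsto_zero_iff_norm_tendsto_zero.1 hq0)
      filter_upwards [eventually_ge_atTop 0] with t ht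
      have : Complex.exp (Complex.I * k * t) =
          Complex.exp (2 * Complex.I * k * (t - (0 : ℝ))) *
            Complex.exp (-(Complex.I * k) * t) := by
        rw [← Complex.exp_add]; congr 1; push_cast; ring
      rw [this, mul_assoc, norm_mul]
      exact mul_le_of_le_one_left (norm_nonneg _) (norm_exp_two_I_le_one hk ht)
    have l2 := (intervalIntegral_tendsto_integral_Ioi (μ := volume) 0 hH.integrableOn
      tendsto_id).const_sub (φ 0 0)
    have l3 := l1.congr' (by
      filter_upwards [eventually_ge_atTop 0] with t ht using hfirst t ht)
    have := tendsto_nhds_unique l3 l2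
    linear_combination -this
  have hφ01 : φ 0 1 = 1 - ∫ s in Ioi 0, starRingEnd ℂ (e s) / 2 * q s := by
    have l2 := (intervalIntegral_tendsto_integral_Ioi (μ := volume) 0 hH₂.integrableOn
      tendsto_id).const_add (φ 0 1)
    have l3 := hf1.congr' (by
      filter_upwards [eventually_ge_atTop 0] with t ht using hsecond t ht)
    have := tendsto_nhds_unique l3 l2
    linear_combination -this
  have hqB : ∀ t : ℝ, 0 ≤ t → q t = volB e k f t := by
    intro t ht
    rw [volB_eq, integral_Ioi_eq_sub hH 0 t, ← hφ00, ← hfirst t ht, ← mul_assoc,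
      ← Complex.exp_add]
    simp only [hq]
    congr 2; ring
  have hfV : ∀ t : ℝ, 0 ≤ t → f t = 1 + volC e (volB e k f) t := by
    intro t ht
    have : volC e (volB e k f) t = volC e q t := by
      unfold volC
      congr 1
      refine setIntegral_congr_fun measurableSet_Ioi fun s hs => ?_
      simp only [hqB s (ht.trans (le_of_lt hs))]
    rw [this, volC, integral_Ioi_eq_sub hH₂ 0 t, hsecond t ht, hφ01]
    ring
  have hfψ : ∀ t : ℝ, 0 ≤ t → f t = psiTwo e k t := fun t ht =>
    eq_psiTwo_of_volterra he he0 hk hfc hDf hfV ht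
  ext i
  fin_cases i
  · have h1 : φ 0 0 = q 0 := by simp [hq]
    have h2 : volB e k f 0 = psiOne e k 0 := by
      unfold psiOne volB
      refine setIntegral_congr_fun measurableSet_Ioi fun s hs => ?_
      simp only [hfψ s (le_of_lt hs)]
    simpa using h1.trans ((hqB 0 le_rfl).trans h2)
  · have h1 : φ 0 1 = f 0 := by simp [hf]
    simpa using h1.trans (hfψ 0 le_rfl)

/-- All Jost columns agree at `0`, so the choice made in the definition is immaterial. -/
theorem jostAtZero_eq (hE : IntegrableOn E (Ioi 0)) {k : ℂ} (hk : 0 ≤ k.im) :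
    jostAtZero E k = ![psiOne ((Ioi 0).indicator E) k 0, psiTwo ((Ioi 0).indicator E) k 0] := by
  have hex : ∃ φ, IsJostColumn E k φ := ⟨_, isJostColumn_psi hE hk⟩
  rw [jostAtZero, dif_pos hex]
  exact hex.choose_spec.apply_zero hE hk

theorem specA_eq (hE : IntegrableOn E (Ioi 0)) {k : ℂ} (hk : 0 ≤ k.im) :
    specA E k = psiTwo ((Ioi 0).indicator E) k 0 := by
  rw [specA, jostAtZero_eq hE hk]; rfl

theorem specB_eq (hE : IntegrableOn E (Ioi 0)) {k : ℂ} (hk : 0 ≤ k.im) :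
    specB E k = psiOne ((Ioi 0).indicator E) k 0 := by
  rw [specB, jostAtZero_eq hE hk]; rfl

end Jost

/-! ### Behaviour of the spectral functions at infinity -/

section Infinity

variable {e : ℝ → ℂ}

theorem exists_smooth_approx (he : Integrable e) {ε : ℝ} (hε : 0 < ε) :
    ∃ η : ℝ → ℂ, HasCompactSupport η ∧ ContDiff ℝ 1 η ∧ ∫ s, ‖e s - η s‖ ≤ ε := by
  obtain ⟨η, h1, h2, h3⟩ := (memLp_one_iff_integrable.2 he).exist_eLpNorm_sub_le
    ENNReal.one_ne_top le_rfl hε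
  have h2' : ContDiff ℝ 1 η := h2.of_le (by exact_mod_cast le_top)
  refine ⟨η, h1, h2', ?_⟩
  have hi : Integrable (e - η) := he.sub (h2.continuous.integrable_of_hasCompactSupport h1)
  rw [eLpNorm_one_eq_lintegral_enorm, ← ofReal_integral_norm_eq_lintegral_enorm hi] at h3
  exact (ENNReal.ofReal_le_ofReal_iff hε.le).1 h3

/-- Integration by parts in the oscillating integral, for a smooth pulse `η`. -/
theorem exists_norm_volB_le_div (he : Integrable e) (he0 : ∀ s ≤ 0, e s = 0) {η : ℝ → ℂ}
    (hη : HasCompactSupport η) (hη1 : ContDiff ℝ 1 η) :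
    ∃ C, ∀ k : ℂ, 0 ≤ k.im → k ≠ 0 → ∀ t, ‖volB η k (psiTwo e k) t‖ ≤ C / ‖k‖ := by
  obtain ⟨D₁, h₁⟩ := isJostFamily_psiOne he he0
  obtain ⟨D₂, h₂⟩ := isJostFamily_psiTwo he he0
  obtain ⟨A, hA⟩ := hη.exists_bound_of_continuous hη1.continuous
  have hA0 : 0 ≤ A := (norm_nonneg _).trans (hA 0)
  have hD₁ : 0 ≤ D₁ := (norm_nonneg _).trans (h₁.norm_le 0 le_rfl 0)
  have hD₂ : 0 ≤ D₂ := (norm_nonneg _).trans (h₂.norm_le 0 le_rfl 0)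
  have hη'c : Continuous (deriv η) := hη1.continuous_deriv le_rfl
  have hη'i : Integrable (deriv η) := hη'c.integrable_of_hasCompactSupport hη.deriv
  have hηi : Integrable η := hη1.continuous.integrable_of_hasCompactSupport hη
  -- Two boundary terms of size `A D₂ / (4|k|)`, one integral with the derivative on `η` and one
  -- with the derivative on `ψ₂`. The latter derivative is `(conj e / 2) ψ₁`, integrable uniformly
  -- in `k`.
  refine ⟨(2 * A * D₂ + (∫ s, ‖deriv η s‖ * D₂ + A * (‖e s‖ / 2 * D₁))) / 4, ?_⟩
  intro k hk hk0 t
  have hkn : 0 < ‖k‖ := norm_pos_iff.2 hk0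
  have h2I : 2 * Complex.I * k ≠ 0 := by simp [hk0]
  have h2In : ‖2 * Complex.I * k‖ = 2 * ‖k‖ := by simp
  set x : ℝ → ℂ := fun s => Complex.exp (2 * Complex.I * k * (s - t)) with hx
  have hxc : Continuous x := by fun_prop
  have hx1 : ∀ s, t ≤ s → ‖x s‖ ≤ 1 := fun s hs => norm_exp_two_I_le_one hk hs
  have hxd : ∀ s, HasDerivAt x (2 * Complex.I * k * x s) s := by
    intro s
    have h : HasDerivAt (fun s : ℝ => 2 * Complex.I * k * ((s : ℂ) - t))
        (2 * Complex.I * k * 1) s :=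
      ((Complex.ofRealCLM.hasDerivAt (x := s)).sub_const (t : ℂ)).const_mul _
    simpa [hx, mul_comm] using h.cexp
  set g : ℝ → ℂ := fun s => x s * (η s / 2) / (2 * Complex.I * k) with hg
  set g' : ℝ → ℂ := fun s => x s * (η s / 2) + x s * (deriv η s / 2) / (2 * Complex.I * k)
    with hg'
  have hgd : ∀ s, HasDerivAt g (g' s) s := by
    intro s
    have h := (((hxd s).fun_mul (((hη1.differentiable one_ne_zero) s).hasDerivAt.div_const
      2)).div_const (2 * Complex.I * k))
    refine h.congr_deriv ?_
    simp only [hg']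
    field_simp
  have hg'c : Continuous g' := by
    have := hη1.continuous
    fun_prop
  have hH₂ : Integrable fun s : ℝ => starRingEnd ℂ (e s) / 2 * psiOne e k s :=
    integrable_mul_of_halfLine (integrable_conj_div_two he) (fun s hs => by simp [he0 s hs])
      (h₁.continuous k hk).aestronglyMeasurable (fun s _ => h₁.norm_le k hk s)
  have hψ : ∀ s, psiTwo e k s = psiTwo e k t +
      ∫ r in t..s, starRingEnd ℂ (e r) / 2 * psiOne e k r := by
    intro s
    rw [psiTwo_eq he he0 hk, psiTwo_eq he he0 hk, volC, volC, integral_Ioi_eq_sub hH₂ t s]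
    ring
  have hgn : ∀ s, t ≤ s → ‖g s‖ ≤ A / (4 * ‖k‖) := by
    intro s hs
    simp only [hg]
    rw [norm_div, h2In, norm_mul, norm_div, Complex.norm_ofNat,
      div_le_div_iff₀ (by positivity) (by positivity)]
    have : ‖x s‖ * (‖η s‖ / 2) ≤ 1 * (A / 2) := by
      have h1 := hx1 s hs
      have h2 := hA s
      gcongr
    nlinarith
  have hbint : Integrable fun s => ‖deriv η s‖ * D₂ + A * (‖e s‖ / 2 * D₁) :=
    (hη'i.norm.mul_const D₂).add (((he.norm.div_const 2).mul_const D₁).const_mul A)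
  have hlimit := intervalIntegral_tendsto_integral_Ioi (μ := volume) (b := id) t
    ((integrableOn_kernel hηi hk t).mul_bdd (c := D₂)
      (h₂.continuous k hk).aestronglyMeasurable
      (Eventually.of_forall fun s => h₂.norm_le k hk s)) tendsto_id
  refine le_of_tendsto hlimit.norm ?_
  filter_upwards [eventually_ge_atTop t] with T hT
  have hPR := integral_deriv_mul_add_mul (a := t) (b := T) (u := psiTwo e k)
    hH₂.intervalIntegrable (fun s _ => hψ s) hgd hg'c
  have hc₂ := h₂.continuous k hk
  have hsplit : ∫ s in t..T, (g' s * psiTwo e k s + g s *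
      (starRingEnd ℂ (e s) / 2 * psiOne e k s)) =
      (∫ s in t..T, x s * (η s / 2) * psiTwo e k s) +
      ∫ s in t..T, (x s * (deriv η s / 2) / (2 * Complex.I * k) * psiTwo e k s + g s *
      (starRingEnd ℂ (e s) / 2 * psiOne e k s)) := by
    have hηc := hη1.continuous
    have hgc : Continuous g := continuous_iff_continuousAt.2 fun s => (hgd s).continuousAt
    rw [← intervalIntegral.integral_add]
    · congr 1 with s
      simp only [hg']
      ring
    · exact Continuous.intervalIntegrable (by fun_prop) _ _
    · exact (Continuous.intervalIntegrable (by fun_prop) _ _).add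
        (hH₂.intervalIntegrable.continuousOn_mul hgc.continuousOn)
  rw [hsplit] at hPR
  have heq : ∫ s in t..id T, x s * (η s / 2) * psiTwo e k s =
      g T * psiTwo e k T - g t * psiTwo e k t -
      ∫ s in t..T, (x s * (deriv η s / 2) / (2 * Complex.I * k) * psiTwo e k s + g s *
      (starRingEnd ℂ (e s) / 2 * psiOne e k s)) := by
    rw [← hPR]; simp
  have hrem : ‖∫ s in t..T, (x s * (deriv η s / 2) / (2 * Complex.I * k) * psiTwo e k s + g s *
      (starRingEnd ℂ (e s) / 2 * psiOne e k s))‖ ≤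
      (4 * ‖k‖)⁻¹ * ∫ s, (‖deriv η s‖ * D₂ + A * (‖e s‖ / 2 * D₁)) := by
    rw [← integral_const_mul, intervalIntegral.integral_of_le hT]
    refine (norm_integral_le_of_norm_le (hbint.const_mul (4 * ‖k‖)⁻¹).integrableOn ?_).trans
      (setIntegral_le_integral (hbint.const_mul (4 * ‖k‖)⁻¹)
        (Eventually.of_forall fun s => by positivity))
    filter_upwards [ae_restrict_mem measurableSet_Ioc] with s hs
    have hs' : t ≤ s := hs.1.le
    rw [mul_add]
    refine (norm_add_le _ _).trans (add_le_add ?_ ?_)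
    · rw [norm_mul, norm_div, norm_mul, norm_div, h2In, Complex.norm_ofNat]
      calc ‖x s‖ * (‖deriv η s‖ / 2) / (2 * ‖k‖) * ‖psiTwo e k s‖
          ≤ 1 * (‖deriv η s‖ / 2) / (2 * ‖k‖) * D₂ := by
            have h1 := hx1 s hs'
            have h2 := h₂.norm_le k hk s
            gcongr
        _ = _ := by field_simp; ring
    · have hn : ‖starRingEnd ℂ (e s) / 2‖ = ‖e s‖ / 2 := by
        rw [norm_div, RCLike.norm_conj, Complex.norm_ofNat]
      rw [norm_mul, norm_mul, hn]
      calc ‖g s‖ * (‖e s‖ / 2 * ‖psiOne e k s‖)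
          ≤ A / (4 * ‖k‖) * (‖e s‖ / 2 * D₁) := by
            have h1 := hgn s hs'
            have h2 := h₁.norm_le k hk s
            gcongr
        _ = _ := by field_simp
  have hgψ : ∀ s, t ≤ s → ‖g s * psiTwo e k s‖ ≤ (4 * ‖k‖)⁻¹ * (A * D₂) := by
    intro s hs
    rw [norm_mul]
    calc ‖g s‖ * ‖psiTwo e k s‖ ≤ A / (4 * ‖k‖) * D₂ := by
          have h1 := hgn s hs
          have h2 := h₂.norm_le k hk s
          gcongr
      _ = _ := by field_simp
  show ‖∫ s in t..id T, x s * (η s / 2) * psiTwo e k s‖ ≤ _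
  rw [heq]
  refine (norm_sub_le _ _).trans ((add_le_add ((norm_sub_le _ _).trans
    (add_le_add (hgψ T hT) (hgψ t le_rfl))) hrem).trans (le_of_eq ?_))
  generalize (∫ s, (‖deriv η s‖ * D₂ + A * (‖e s‖ / 2 * D₁))) = J
  field_simp
  ring

theorem volB_sub_pulse {η : ℝ → ℂ} (he : Integrable e) (hη : Integrable η) {k : ℂ}
    (hk : 0 ≤ k.im) {f : ℝ → ℂ} (hf : Continuous f) {D : ℝ} (hD : ∀ s, ‖f s‖ ≤ D) (t : ℝ) :
    volB e k f t = volB (fun s => e s - η s) k f t + volB η k f t := by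
  have hintegrable : ∀ {h : ℝ → ℂ}, Integrable h → IntegrableOn (fun s : ℝ =>
      Complex.exp (2 * Complex.I * k * (s - t)) * (h s / 2) * f s) (Ioi t) := fun hh =>
    (integrableOn_kernel hh hk t).mul_bdd (c := D) hf.aestronglyMeasurable
      (Eventually.of_forall hD)
  unfold volB
  rw [← integral_add (hintegrable (h := fun s => e s - η s) (he.sub hη)) (hintegrable hη)]
  congr 1 with s
  ring

/-- Riemann–Lebesgue, uniformly in `t`: the smooth part `η` of the pulse contributes `O(1/|k|)`, the
rest at most half its `L¹` norm times `D₂`, which the accuracy `ε / (D₂ + 1)` makes at most `ε / 2`.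
-/
theorem eventually_norm_psiOne_le (he : Integrable e) (he0 : ∀ s ≤ 0, e s = 0) {ε : ℝ}
    (hε : 0 < ε) : ∀ᶠ k in Bornology.cobounded ℂ ⊓ 𝓟 {k | 0 ≤ k.im},
      ∀ t, ‖psiOne e k t‖ ≤ ε := by
  obtain ⟨D₂, h₂⟩ := isJostFamily_psiTwo he he0
  have hD₂ : 0 ≤ D₂ := (norm_nonneg _).trans (h₂.norm_le 0 le_rfl 0)
  obtain ⟨η, hη, hη1, hηe⟩ := exists_smooth_approx he (ε := ε / (D₂ + 1)) (by positivity)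
  obtain ⟨C, hC⟩ := exists_norm_volB_le_div he he0 hη hη1
  have hηi : Integrable η := hη1.continuous.integrable_of_hasCompactSupport hη
  rw [eventually_inf_principal]
  have hlarge := (tendsto_norm_cobounded_atTop (E := ℂ)).eventually
    (eventually_gt_atTop (max 0 (2 * C / ε)))
  filter_upwards [hlarge] with k hkl hk t
  have hk' : 0 ≤ k.im := hk
  have hkn : 0 < ‖k‖ := (le_max_left _ _).trans_lt hkl
  have hkC : 2 * C / ε < ‖k‖ := (le_max_right _ _).trans_lt hkl
  rw [psiOne, volB_sub_pulse he hηi hk' (h₂.continuous k hk') (h₂.norm_le k hk')]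
  have hintegrable : Integrable fun s => ‖e s - η s‖ / 2 * D₂ :=
    ((he.sub hηi).norm.div_const 2).mul_const D₂
  have b1 : ‖volB (fun s => e s - η s) k (psiTwo e k) t‖ ≤ ε / 2 := by
    refine (norm_volB_le hk' (W := fun _ => D₂) (fun s _ _ => h₂.norm_le k hk' s)
      hintegrable.integrableOn).trans ((setIntegral_le_integral hintegrable
        (Eventually.of_forall fun s => by positivity)).trans ?_)
    rw [integral_mul_const, integral_div]
    calc (∫ s, ‖e s - η s‖) / 2 * D₂ ≤ ε / (D₂ + 1) / 2 * D₂ := by gcongr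
      _ = ε / 2 * (D₂ / (D₂ + 1)) := by field_simp
      _ ≤ ε / 2 * 1 := by
          gcongr
          rw [div_le_one (by positivity)]
          linarith
      _ = ε / 2 := mul_one _
  have b2 : ‖volB η k (psiTwo e k) t‖ ≤ ε / 2 := by
    refine (hC k hk' (norm_pos_iff.1 hkn) t).trans ?_
    rw [div_le_iff₀ hkn]
    rw [div_lt_iff₀ hε] at hkC
    linarith
  exact (norm_add_le _ _).trans (by linarith)

variable {E : ℝ → ℂ}

theorem tendsto_specB (hE : IntegrableOn E (Ioi 0)) :
    Tendsto (specB E) (Bornology.cobounded ℂ ⊓ 𝓟 {k | 0 ≤ k.im}) (𝓝 0) := by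
  rw [Metric.tendsto_nhds]
  intro ε hε
  filter_upwards [eventually_norm_psiOne_le (integrable_indicator_pulse hE)
    (indicator_pulse_nonpos E) (half_pos hε), mem_inf_of_right (mem_principal_self _)] with k h1 hk
  rw [dist_zero_right, specB_eq hE hk]
  exact (h1 0).trans_lt (half_lt_self hε)

/-- `a - 1` is the Volterra integral of `ψ₁` against the pulse, and `ψ₁` tends to zero uniformly in
`t`. -/
theorem tendsto_specA (hE : IntegrableOn E (Ioi 0)) :
    Tendsto (specA E) (Bornology.cobounded ℂ ⊓ 𝓟 {k | 0 ≤ k.im}) (𝓝 1) := by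
  have he := integrable_indicator_pulse hE
  have he0 := indicator_pulse_nonpos E
  set I := ∫ s, ‖(Ioi (0 : ℝ)).indicator E s‖ / 2 with hI
  have hI0 : 0 ≤ I := integral_nonneg fun s => by positivity
  rw [Metric.tendsto_nhds]
  intro ε hε
  have hδ : 0 < ε / (I + 1) := by positivity
  filter_upwards [eventually_norm_psiOne_le he he0 hδ, mem_inf_of_right (mem_principal_self _)]
    with k h1 hk
  rw [specA_eq hE hk, psiTwo_eq he he0 hk, dist_eq_norm, add_sub_cancel_left]
  have hintegrable : Integrable fun s => ‖(Ioi (0 : ℝ)).indicator E s‖ / 2 * (ε / (I + 1)) :=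
    (he.norm.div_const 2).mul_const _
  refine (norm_volC_le (W := fun _ => ε / (I + 1)) (fun s _ _ => h1 s) hintegrable.integrableOn).trans_lt
    ((setIntegral_le_integral hintegrable (Eventually.of_forall fun s => by positivity)).trans_lt ?_)
  rw [integral_mul_const, ← hI, mul_div_assoc', div_lt_iff₀ (by positivity)]
  nlinarith

/-! ### Continuity and holomorphy of `a` and `b` -/

theorem continuousOn_specA (hE : IntegrableOn E (Ioi 0)) :
    ContinuousOn (specA E) {k | 0 ≤ k.im} := by
  obtain ⟨D, h⟩ := isJostFamily_psiTwo (integrable_indicator_pulse hE) (indicator_pulse_nonpos E)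
  exact (h.continuousOn 0).congr fun k hk => specA_eq hE hk

theorem continuousOn_specB (hE : IntegrableOn E (Ioi 0)) :
    ContinuousOn (specB E) {k | 0 ≤ k.im} := by
  obtain ⟨D, h⟩ := isJostFamily_psiOne (integrable_indicator_pulse hE) (indicator_pulse_nonpos E)
  exact (h.continuousOn 0).congr fun k hk => specB_eq hE hk

theorem differentiableOn_specA (hE : IntegrableOn E (Ioi 0)) :
    DifferentiableOn ℂ (specA E) {k | 0 < k.im} := by
  obtain ⟨D, h⟩ := isJostFamily_psiTwo (integrable_indicator_pulse hE) (indicator_pulse_nonpos E)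
  exact (h.differentiableOn 0).congr fun k hk => specA_eq hE (le_of_lt hk)

theorem differentiableOn_specB (hE : IntegrableOn E (Ioi 0)) :
    DifferentiableOn ℂ (specB E) {k | 0 < k.im} := by
  obtain ⟨D, h⟩ := isJostFamily_psiOne (integrable_indicator_pulse hE) (indicator_pulse_nonpos E)
  exact (h.differentiableOn 0).congr fun k hk => specB_eq hE (le_of_lt hk)

end Infinity

/-! ### Triangular factors -/

/-- A one-parameter group of unipotent triangular matrices. -/
structure IsUnipotentFamily (T : ℂ → Matrix (Fin 2) (Fin 2) ℂ) : Prop where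
  mul : ∀ c d, T c * T d = T (c + d)
  zero : T 0 = 1
  differentiable : ∀ i j, Differentiable ℂ fun c => T c i j
  norm_sub_le : ∀ c i j, ‖T c i j - (1 : Matrix (Fin 2) (Fin 2) ℂ) i j‖ ≤ ‖c‖

/-- Upper triangular unipotent matrices. -/
def upperTri (c : ℂ) : Matrix (Fin 2) (Fin 2) ℂ := !![1, c; 0, 1]

/-- Lower triangular unipotent matrices. -/
def lowerTri (c : ℂ) : Matrix (Fin 2) (Fin 2) ℂ := !![1, 0; c, 1]

theorem isUnipotentFamily_upperTri : IsUnipotentFamily upperTri where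
  mul c d := by ext i j; fin_cases i <;> fin_cases j <;> simp [upperTri, add_comm]
  zero := by ext i j; fin_cases i <;> fin_cases j <;> simp [upperTri]
  differentiable i j := by
    fin_cases i <;> fin_cases j <;> simp [upperTri]
  norm_sub_le c i j := by fin_cases i <;> fin_cases j <;> simp [upperTri]

theorem isUnipotentFamily_lowerTri : IsUnipotentFamily lowerTri where
  mul c d := by ext i j; fin_cases i <;> fin_cases j <;> simp [lowerTri]
  zero := by ext i j; fin_cases i <;> fin_cases j <;> simp [lowerTri]
  differentiable i j := by
    fin_cases i <;> fin_cases j <;> simp [lowerTri]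
  norm_sub_le c i j := by fin_cases i <;> fin_cases j <;> simp [lowerTri]

theorem IsUnipotentFamily.mul_neg {T : ℂ → Matrix (Fin 2) (Fin 2) ℂ} (hT : IsUnipotentFamily T)
    (c : ℂ) : T c * T (-c) = 1 := by rw [hT.mul, add_neg_cancel, hT.zero]

theorem IsUnipotentFamily.inv {T : ℂ → Matrix (Fin 2) (Fin 2) ℂ} (hT : IsUnipotentFamily T)
    (c : ℂ) : (T c)⁻¹ = T (-c) := Matrix.inv_eq_right_inv (hT.mul_neg c)

theorem IsUnipotentFamily.continuous {T : ℂ → Matrix (Fin 2) (Fin 2) ℂ}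
    (hT : IsUnipotentFamily T) : Continuous T :=
  continuous_matrix fun i j => (hT.differentiable i j).continuous

theorem BoundedAlong.mono {M : ℂ → Matrix (Fin 2) (Fin 2) ℂ} {l l' : Filter ℂ}
    (h : BoundedAlong M l') (hl : l ≤ l') : BoundedAlong M l := fun i j => (h i j).mono hl

theorem BoundedAlong.congr {M N : ℂ → Matrix (Fin 2) (Fin 2) ℂ} {l : Filter ℂ}
    (h : BoundedAlong M l) (hMN : M =ᶠ[l] N) : BoundedAlong N l := fun i j =>
  (h i j).congr' (hMN.mono fun k hk => by simp only [hk]) EventuallyEq.rfl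

theorem BoundedAlong.sup {M : ℂ → Matrix (Fin 2) (Fin 2) ℂ} {l l' : Filter ℂ}
    (h : BoundedAlong M l) (h' : BoundedAlong M l') : BoundedAlong M (l ⊔ l') :=
  fun i j => (h i j).sup (h' i j)

theorem BoundedAlong.mul {M N : ℂ → Matrix (Fin 2) (Fin 2) ℂ} {l : Filter ℂ}
    (hM : BoundedAlong M l) (hN : BoundedAlong N l) : BoundedAlong (fun k => M k * N k) l := by
  intro i j
  simp only [Matrix.mul_apply, Fin.sum_univ_two]
  have := ((hM i 0).mul (hN 0 j)).add ((hM i 1).mul (hN 1 j))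
  simpa using this

theorem boundedAlong_of_tendsto {M : ℂ → Matrix (Fin 2) (Fin 2) ℂ} {l : Filter ℂ}
    {L : Matrix (Fin 2) (Fin 2) ℂ} (h : Tendsto M l (𝓝 L)) : BoundedAlong M l := fun i j =>
  ((tendsto_pi_nhds.1 (tendsto_pi_nhds.1 h i) j).isBigO_one ℝ)

theorem IsUnipotentFamily.boundedAlong {T : ℂ → Matrix (Fin 2) (Fin 2) ℂ}
    (hT : IsUnipotentFamily T) {g : ℂ → ℂ} {l : Filter ℂ} (hg : g =O[l] fun _ => (1 : ℝ)) :
    BoundedAlong (fun k => T (g k)) l := by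
  intro i j
  have h1 : (fun k => T (g k) i j - (1 : Matrix (Fin 2) (Fin 2) ℂ) i j) =O[l] fun _ => (1 : ℝ) :=
    (IsBigO.of_bound 1 (Eventually.of_forall fun k => by
      simpa using hT.norm_sub_le (g k) i j)).trans hg
  have h2 := h1.add (isBigO_const_const ((1 : Matrix (Fin 2) (Fin 2) ℂ) i j)
    (one_ne_zero (α := ℝ)) l)
  simpa using h2

/-! ### The exponentials -/

/-- This formula carries the causality. Let `Im k ≥ 0`. Inside the circle the second factor is at
least `t` for `k ≠ 0`, `x > 0`; outside, it exceeds `t - x` by a term whose product with `Im k` is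
at most `x / 2`. -/
theorem theta_im (t x : ℝ) (k : ℂ) :
    (theta t x k).im = k.im * (t - x + x / (4 * ‖k‖ ^ 2)) := by
  have h : (1 / (4 * k)).im = -(k.im / (4 * ‖k‖ ^ 2)) := by
    rw [one_div, Complex.inv_im, Complex.normSq_eq_norm_sq]
    simp only [Complex.mul_im, Complex.re_ofNat, Complex.im_ofNat, zero_mul, add_zero, norm_mul,
      Complex.norm_ofNat]
    rcases eq_or_ne ‖k‖ 0 with h0 | h0
    · simp [h0]
    · field_simp
  unfold theta
  rw [Complex.sub_im, Complex.mul_im, Complex.mul_im, Complex.add_im, h]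
  simp
  ring

theorem norm_eMinus (t x : ℝ) (k : ℂ) :
    ‖eMinus t x k‖ = Real.exp (2 * (k.im * (t - x + x / (4 * ‖k‖ ^ 2)))) := by
  rw [eMinus, Complex.norm_exp, ← theta_im]
  congr 1
  simp

theorem norm_ePlus (t x : ℝ) (k : ℂ) :
    ‖ePlus t x k‖ = Real.exp (-(2 * (k.im * (t - x + x / (4 * ‖k‖ ^ 2))))) := by
  rw [ePlus, Complex.norm_exp, ← theta_im]
  congr 1
  simp

theorem eMinus_mul_ePlus (t x : ℝ) (k : ℂ) : eMinus t x k * ePlus t x k = 1 := by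
  rw [eMinus, ePlus, ← Complex.exp_add, neg_add_cancel, Complex.exp_zero]

theorem theta_conj (t x : ℝ) (k : ℂ) :
    theta t x (starRingEnd ℂ k) = starRingEnd ℂ (theta t x k) := by
  simp [theta, Complex.conj_ofNat]

theorem conj_eMinus_conj (t x : ℝ) (k : ℂ) :
    starRingEnd ℂ (eMinus t x (starRingEnd ℂ k)) = ePlus t x k := by
  rw [eMinus, ePlus, ← Complex.exp_conj, theta_conj]
  simp [Complex.conj_ofNat]

theorem conj_ePlus_conj (t x : ℝ) (k : ℂ) :
    starRingEnd ℂ (ePlus t x (starRingEnd ℂ k)) = eMinus t x k := by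
  rw [eMinus, ePlus, ← Complex.exp_conj, theta_conj]
  simp [Complex.conj_ofNat]

/-- Outside the circle, `e^{-2iθ}` decays like `exp (-2 (x - t) Im k)`. -/
theorem norm_eMinus_le {t x : ℝ} (hx : 0 < x) {k : ℂ} (hk2 : 1 / 2 ≤ ‖k‖) :
    ‖eMinus t x k‖ ≤ Real.exp x * Real.exp (-(2 * (x - t) * k.im)) := by
  rw [norm_eMinus, ← Real.exp_add, Real.exp_le_exp]
  have hkn : 0 < ‖k‖ := by linarith
  -- Since `Im k ≤ |k|` and `|k| ≥ 1/2`; doubled in the exponent, this is the factor `e^x`.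
  have h1 : k.im * (x / (4 * ‖k‖ ^ 2)) ≤ x / 2 := by
    rw [mul_div_assoc', div_le_div_iff₀ (by positivity) (by positivity)]
    have h2 : k.im ≤ ‖k‖ := (le_abs_self _).trans (Complex.abs_im_le_norm k)
    have h3 : ‖k‖ ≤ 2 * ‖k‖ ^ 2 := by nlinarith
    nlinarith
  nlinarith

theorem norm_eMinus_le_exp {t x : ℝ} (hx : 0 < x) (htx : t ≤ x) {k : ℂ} (hk : 0 ≤ k.im)
    (hk2 : 1 / 2 ≤ ‖k‖) : ‖eMinus t x k‖ ≤ Real.exp x := by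
  refine (norm_eMinus_le hx hk2).trans ?_
  refine mul_le_of_le_one_right (Real.exp_pos _).le ?_
  rw [Real.exp_le_one_iff]
  have := mul_nonneg (mul_nonneg zero_le_two (sub_nonneg.2 htx)) hk
  linarith

theorem norm_ePlus_le_one {t x : ℝ} (ht : 0 ≤ t) (hx : 0 < x) {k : ℂ} (hk : 0 ≤ k.im)
    (hk2 : ‖k‖ ≤ 1 / 2) : ‖ePlus t x k‖ ≤ 1 := by
  rw [norm_ePlus, Real.exp_le_one_iff]
  rcases eq_or_ne k 0 with rfl | h0
  · simp
  have hkn : 0 < ‖k‖ := norm_pos_iff.2 h0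
  have h1 : x ≤ x / (4 * ‖k‖ ^ 2) := by
    rw [le_div_iff₀ (by positivity)]
    have : 4 * ‖k‖ ^ 2 ≤ 1 := by nlinarith
    nlinarith
  have := mul_nonneg hk (show 0 ≤ t - x + x / (4 * ‖k‖ ^ 2) by linarith)
  linarith

theorem differentiableAt_theta (t x : ℝ) {k : ℂ} (hk : k ≠ 0) :
    DifferentiableAt ℂ (theta t x) k := by
  have h : (4 : ℂ) * k ≠ 0 := by simpa using hk
  have h2 : DifferentiableAt ℂ (fun k : ℂ => 1 / (4 * k)) k :=
    (differentiableAt_const _).fun_div (by fun_prop) h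
  exact (by fun_prop : DifferentiableAt ℂ (fun k : ℂ => k * (t : ℂ)) k).sub
    ((differentiableAt_id.add h2).mul_const _)

theorem differentiableAt_eMinus (t x : ℝ) {k : ℂ} (hk : k ≠ 0) :
    DifferentiableAt ℂ (eMinus t x) k :=
  (((differentiableAt_theta t x hk).const_mul _).neg).cexp

theorem differentiableAt_ePlus (t x : ℝ) {k : ℂ} (hk : k ≠ 0) :
    DifferentiableAt ℂ (ePlus t x) k :=
  ((differentiableAt_theta t x hk).const_mul _).cexp

/-! ### Geometry of the domains -/

theorem isOpen_OmegaP : IsOpen OmegaP :=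
  isOpen_upper.inter (isOpen_lt continuous_const continuous_norm)

theorem isOpen_DP : IsOpen DP :=
  isOpen_upper.inter (isOpen_lt continuous_norm continuous_const)

theorem OmegaM_eq : OmegaM = starRingEnd ℂ ⁻¹' OmegaP := by
  ext k; simp [OmegaM, OmegaP]

theorem DM_eq : DM = starRingEnd ℂ ⁻¹' DP := by
  ext k; simp [DM, DP]

theorem closure_OmegaP_subset : closure OmegaP ⊆ {k | 0 ≤ k.im ∧ 1 / 2 ≤ ‖k‖} := by
  refine closure_minimal (fun k hk => ⟨hk.1.le, hk.2.le⟩) ?_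
  exact (isClosed_le continuous_const Complex.continuous_im).inter
    (isClosed_le continuous_const continuous_norm)

theorem closure_DP_subset : closure DP ⊆ {k | 0 ≤ k.im ∧ ‖k‖ ≤ 1 / 2} := by
  refine closure_minimal (fun k hk => ⟨hk.1.le, hk.2.le⟩) ?_
  exact (isClosed_le continuous_const Complex.continuous_im).inter
    (isClosed_le continuous_norm continuous_const)

theorem mem_regions_of_notMem_contour {k : ℂ} (hk : k ∉ contour) :
    (k ∈ OmegaP ∨ k ∈ OmegaM) ∨ (k ∈ DP ∨ k ∈ DM) := by
  have h1 : k.im ≠ 0 := fun h => hk (Or.inl h)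
  have h2 : ‖k‖ ≠ 1 / 2 := fun h => hk (Or.inr h)
  rcases lt_or_gt_of_ne h1 with h | h <;> rcases lt_or_gt_of_ne h2 with h' | h'
  · exact Or.inr (Or.inr ⟨h, h'⟩)
  · exact Or.inl (Or.inr ⟨h, h'⟩)
  · exact Or.inr (Or.inl ⟨h, h'⟩)
  · exact Or.inl (Or.inl ⟨h, h'⟩)

theorem tendsto_conj_nhdsWithin (S : Set ℂ) (p : ℂ) :
    Tendsto (starRingEnd ℂ) (𝓝[starRingEnd ℂ ⁻¹' S] p) (𝓝[S] (starRingEnd ℂ p)) :=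
  tendsto_nhdsWithin_iff.2 ⟨(Complex.continuous_conj.tendsto p).mono_left nhdsWithin_le_nhds,
    eventually_mem_nhdsWithin⟩

theorem conj_mem_closure_of_mem {S : Set ℂ} {p : ℂ} (hp : p ∈ closure (starRingEnd ℂ ⁻¹' S)) :
    starRingEnd ℂ p ∈ closure S :=
  Complex.continuous_conj.closure_preimage_subset S hp

/-! ### Entries of the triangular factors -/

/-- The nontrivial entry `g` of the triangular factor in a domain `S`, with poles on `Z` and polar
parts `P z`. -/
structure IsRegionEntry (S Z : Set ℂ) (g : ℂ → ℂ) (P : ℂ → ℂ → ℂ) : Prop where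
  isOpen : IsOpen S
  differentiableAt : ∀ k ∈ S, k ∉ Z → DifferentiableAt ℂ g k
  tendsto : ∀ p ∈ closure S, p ∉ Z → p ≠ 0 → Tendsto g (𝓝[S] p) (𝓝 (g p))
  bounded_zero : 0 ∈ closure S → g =O[𝓝[S] 0] fun _ => (1 : ℝ)
  polar : ∀ z ∈ Z, (fun k => g k - P z k) =O[𝓝[S \ {z}] z] fun _ => (1 : ℝ)

theorem tendsto_schwarz {f : ℂ → ℂ} {S : Set ℂ} {p L : ℂ}
    (h : Tendsto f (𝓝[S] (starRingEnd ℂ p)) (𝓝 L)) :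
    Tendsto (schwarz f) (𝓝[starRingEnd ℂ ⁻¹' S] p) (𝓝 (starRingEnd ℂ L)) :=
  (Complex.continuous_conj.tendsto L).comp (h.comp (tendsto_conj_nhdsWithin S p))

theorem isBigO_schwarz {f : ℂ → ℂ} {S : Set ℂ} {p : ℂ}
    (h : f =O[𝓝[S] (starRingEnd ℂ p)] fun _ => (1 : ℝ)) :
    schwarz f =O[𝓝[starRingEnd ℂ ⁻¹' S] p] fun _ => (1 : ℝ) :=
  (IsBigO.of_bound 1 (Eventually.of_forall fun k => by simp [schwarz])).trans
    (h.comp_tendsto (tendsto_conj_nhdsWithin S p))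

/-- Reflection reduces `Ω₋` and `D₋` to `Ω₊` and `D₊`. The minus sign matches the opposite signs of
the entries of `G` in conjugate domains. -/
theorem IsRegionEntry.schwarz {S Z : Set ℂ} {g : ℂ → ℂ} {P : ℂ → ℂ → ℂ}
    (h : IsRegionEntry S Z g P) :
    IsRegionEntry (starRingEnd ℂ ⁻¹' S) (starRingEnd ℂ ⁻¹' Z) (fun k => -schwarz g k)
      (fun z k => -MaxwellBloch.schwarz (P (starRingEnd ℂ z)) k) where
  isOpen := h.isOpen.preimage Complex.continuous_conj
  differentiableAt k hk hkZ := by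
    have := (h.differentiableAt _ hk hkZ).conj_conj
    rw [Complex.conj_conj] at this
    exact this.neg
  tendsto p hp hpZ hp0 := by
    refine (tendsto_schwarz (h.tendsto _ (conj_mem_closure_of_mem hp) hpZ ?_)).neg
    simpa using hp0
  bounded_zero h0 := by
    refine (isBigO_schwarz ?_).neg_left
    have := conj_mem_closure_of_mem h0
    rw [map_zero] at this ⊢
    exact h.bounded_zero this
  polar z hz := by
    have h1 := h.polar _ hz
    have hset : starRingEnd ℂ ⁻¹' (S \ {starRingEnd ℂ z}) = starRingEnd ℂ ⁻¹' S \ {z} := by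
      ext k
      simp [(starRingEnd ℂ).injective.eq_iff]
    have h2 := isBigO_schwarz h1
    rw [hset] at h2
    refine h2.neg_left.congr_left fun k => ?_
    simp [MaxwellBloch.schwarz]
    ring

/-! ### Zeros of the spectral functions -/

/-- The properties of the spectral functions on which the Riemann–Hilbert analysis rests. -/
structure IsSpectralPair (a b : ℂ → ℂ) : Prop where
  continuousOn_a : ContinuousOn a {k | 0 ≤ k.im}
  continuousOn_b : ContinuousOn b {k | 0 ≤ k.im}
  differentiableOn_a : DifferentiableOn ℂ a {k | 0 < k.im}
  differentiableOn_b : DifferentiableOn ℂ b {k | 0 < k.im}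
  tendsto_a : Tendsto a (Bornology.cobounded ℂ ⊓ 𝓟 {k | 0 ≤ k.im}) (𝓝 1)
  tendsto_b : Tendsto b (Bornology.cobounded ℂ ⊓ 𝓟 {k | 0 ≤ k.im}) (𝓝 0)
  a_ne_zero : ∀ s : ℝ, 1 / 2 ≤ |s| → a s ≠ 0
  b_ne_zero : ∀ s : ℝ, |s| ≤ 1 / 2 → b s ≠ 0

/-- If zeros accumulated at `p`, then `f` would vanish on the whole half-plane by the identity
theorem, and by continuity at the real point `s`. -/
theorem eventually_ne_zero_of_upper {f : ℂ → ℂ} (hc : ContinuousOn f {k | 0 ≤ k.im})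
    (hd : DifferentiableOn ℂ f {k | 0 < k.im}) {s : ℝ} (hs : f s ≠ 0) {p : ℂ} (hp : 0 < p.im) :
    ∀ᶠ k in 𝓝[≠] p, f k ≠ 0 := by
  have han : AnalyticOnNhd ℂ f {k | 0 < k.im} := hd.analyticOnNhd isOpen_upper
  rcases (han p hp).eventually_eq_zero_or_eventually_ne_zero with h | h
  · exfalso
    have hconv : IsPreconnected {k : ℂ | 0 < k.im} := (convex_halfSpace_im_gt 0).isPreconnected
    have h0 := han.eqOn_zero_of_preconnected_of_eventuallyEq_zero hconv hp h
    have hcl : (s : ℂ) ∈ closure {k : ℂ | 0 < k.im} := by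
      rw [Complex.closure_setOfPred_lt_im]; simp
    have := mem_closure_iff_nhdsWithin_neBot.1 hcl
    have h1 : Tendsto f (𝓝[{k | 0 < k.im}] (s : ℂ)) (𝓝 (f s)) :=
      (hc s (by simp)).mono fun k hk => show (0 : ℝ) ≤ k.im from le_of_lt hk
    have h2 : Tendsto f (𝓝[{k | 0 < k.im}] (s : ℂ)) (𝓝 0) := by
      refine tendsto_const_nhds.congr' ?_
      filter_upwards [self_mem_nhdsWithin] with k hk using (h0 hk).symm
    exact hs (tendsto_nhds_unique h1 h2)
  · exact h

theorem eq_ofReal_re {p : ℂ} (hp : p.im = 0) : p = ((p.re : ℝ) : ℂ) := by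
  apply Complex.ext <;> simp [hp]

theorem norm_eq_abs_re {p : ℂ} (hp : p.im = 0) : ‖p‖ = |p.re| := by
  rw [eq_ofReal_re hp, Complex.norm_real, Real.norm_eq_abs, Complex.ofReal_re]

/-- The zeros of `f` in the part of the upper half-plane cut out by a closed set `S` are isolated
and do not accumulate on the real axis. -/
theorem eventually_notMem_zeros {f : ℂ → ℂ} {S : Set ℂ} (hS : IsClosed S)
    (hc : ContinuousOn f {k | 0 ≤ k.im}) (hd : DifferentiableOn ℂ f {k | 0 < k.im})
    (hne : ∀ s : ℝ, (s : ℂ) ∈ S → f s ≠ 0) {s₀ : ℝ} (hs₀ : (s₀ : ℂ) ∈ S) (p : ℂ) :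
    ∀ᶠ k in 𝓝[≠] p, ¬(0 < k.im ∧ k ∈ S ∧ f k = 0) := by
  rcases lt_trichotomy p.im 0 with h | h | h
  · have : ∀ᶠ k in 𝓝 p, k.im < 0 :=
      (isOpen_lt Complex.continuous_im continuous_const).mem_nhds h
    filter_upwards [nhdsWithin_le_nhds this] with k hk hk'
    exact absurd hk'.1 (not_lt.2 hk.le)
  · by_cases hpS : p ∈ S
    · have hp0 : f p ≠ 0 := by
        rw [eq_ofReal_re h] at hpS ⊢
        exact hne _ hpS
      have h1 := (hc p (by simp [h])).eventually_ne hp0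
      have h2 := eventually_nhdsWithin_iff.1 h1
      filter_upwards [nhdsWithin_le_nhds h2] with k hk hk'
      exact hk hk'.1.le hk'.2.2
    · have : ∀ᶠ k in 𝓝 p, k ∉ S := hS.isOpen_compl.mem_nhds hpS
      filter_upwards [nhdsWithin_le_nhds this] with k hk hk'
      exact hk hk'.2.1
  · filter_upwards [eventually_ne_zero_of_upper hc hd (hne s₀ hs₀) h] with k hk hk'
    exact hk hk'.2.2

namespace IsSpectralPair

variable {a b : ℂ → ℂ}

theorem eventually_notMem_zerosA (h : IsSpectralPair a b) (p : ℂ) :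
    ∀ᶠ k in 𝓝[≠] p, k ∉ zerosA a :=
  eventually_notMem_zeros (S := {k : ℂ | 1 / 2 ≤ ‖k‖}) (s₀ := 1)
    (isClosed_le continuous_const continuous_norm) h.continuousOn_a h.differentiableOn_a
    (fun s hs => h.a_ne_zero s (by simpa using hs)) (by simp; norm_num) p

theorem eventually_notMem_zerosB (h : IsSpectralPair a b) (p : ℂ) :
    ∀ᶠ k in 𝓝[≠] p, k ∉ zerosB b :=
  eventually_notMem_zeros (S := {k : ℂ | ‖k‖ ≤ 1 / 2}) (s₀ := 0)
    (isClosed_le continuous_norm continuous_const) h.continuousOn_b h.differentiableOn_b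
    (fun s hs => h.b_ne_zero s (by simpa using hs)) (by simp) p

theorem a_ne_zero_of_notMem (h : IsSpectralPair a b) {p : ℂ} (hp : 0 ≤ p.im) (hp2 : 1 / 2 ≤ ‖p‖)
    (hpZ : p ∉ zerosA a) : a p ≠ 0 := by
  rcases hp.eq_or_lt with h0 | h0
  · rw [norm_eq_abs_re h0.symm] at hp2
    rw [eq_ofReal_re h0.symm]
    exact h.a_ne_zero _ hp2
  · exact fun hz => hpZ ⟨h0, hp2, hz⟩

theorem b_ne_zero_of_notMem (h : IsSpectralPair a b) {p : ℂ} (hp : 0 ≤ p.im) (hp2 : ‖p‖ ≤ 1 / 2)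
    (hpZ : p ∉ zerosB b) : b p ≠ 0 := by
  rcases hp.eq_or_lt with h0 | h0
  · rw [norm_eq_abs_re h0.symm] at hp2
    rw [eq_ofReal_re h0.symm]
    exact h.b_ne_zero _ hp2
  · exact fun hz => hpZ ⟨h0, hp2, hz⟩

theorem analyticOrderAt_a_ne_top (h : IsSpectralPair a b) {z : ℂ} (hz : 0 < z.im) :
    analyticOrderAt a z ≠ ⊤ := by
  intro htop
  have h1 := eventually_ne_zero_of_upper h.continuousOn_a h.differentiableOn_a
    (h.a_ne_zero 1 (by norm_num)) hz
  obtain ⟨k, hk1, hk2⟩ := (h1.and (nhdsWithin_le_nhds (analyticOrderAt_eq_top.1 htop))).exists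
  exact hk1 hk2

theorem analyticOrderAt_b_ne_top (h : IsSpectralPair a b) {z : ℂ} (hz : 0 < z.im) :
    analyticOrderAt b z ≠ ⊤ := by
  intro htop
  have h1 := eventually_ne_zero_of_upper h.continuousOn_b h.differentiableOn_b
    (h.b_ne_zero 0 (by norm_num)) hz
  obtain ⟨k, hk1, hk2⟩ := (h1.and (nhdsWithin_le_nhds (analyticOrderAt_eq_top.1 htop))).exists
  exact hk1 hk2

theorem analyticAt_a (h : IsSpectralPair a b) {z : ℂ} (hz : 0 < z.im) : AnalyticAt ℂ a z :=
  h.differentiableOn_a.analyticAt (isOpen_upper.mem_nhds hz)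

theorem analyticAt_b (h : IsSpectralPair a b) {z : ℂ} (hz : 0 < z.im) : AnalyticAt ℂ b z :=
  h.differentiableOn_b.analyticAt (isOpen_upper.mem_nhds hz)

theorem tendsto_refl (h : IsSpectralPair a b) :
    Tendsto (refl a b) (Bornology.cobounded ℂ ⊓ 𝓟 {k | 0 ≤ k.im}) (𝓝 0) := by
  have := h.tendsto_b.div h.tendsto_a one_ne_zero
  rwa [zero_div] at this

/-! ### The entry of the triangular factor in each of the four domains -/

theorem isRegionEntry_OmegaP (h : IsSpectralPair a b) (t x : ℝ) :
    IsRegionEntry OmegaP (zerosA a) (fun k => -(refl a b k * eMinus t x k))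
      (fun z k => -(polarSum a b z k * eMinus t x k)) where
  isOpen := isOpen_OmegaP
  differentiableAt k hk hkZ := by
    have hk0 : k ≠ 0 := by rintro rfl; simp [OmegaP] at hk
    have ha : a k ≠ 0 := h.a_ne_zero_of_notMem hk.1.le hk.2.le hkZ
    exact (((h.analyticAt_b hk.1).differentiableAt.div (h.analyticAt_a hk.1).differentiableAt
      ha).mul (differentiableAt_eMinus t x hk0)).neg
  tendsto p hp hpZ hp0 := by
    obtain ⟨h1, h2⟩ := closure_OmegaP_subset hp
    have ha : a p ≠ 0 := h.a_ne_zero_of_notMem h1 h2 hpZ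
    have hsub : OmegaP ⊆ {k | 0 ≤ k.im} := fun k hk => hk.1.le
    have ca : ContinuousWithinAt a OmegaP p := (h.continuousOn_a p h1).mono hsub
    have cb : ContinuousWithinAt b OmegaP p := (h.continuousOn_b p h1).mono hsub
    exact ((cb.div ca ha).mul
      (differentiableAt_eMinus t x hp0).continuousAt.continuousWithinAt).neg
  bounded_zero h0 := by
    have := (closure_OmegaP_subset h0).2
    norm_num at this
  polar z hz := by
    have hz0 : z ≠ 0 := by rintro rfl; simp [zerosA] at hz
    have h1 := (polarSum_sub_isBigO (h.analyticAt_a hz.1) (h.analyticAt_b hz.1)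
      (h.analyticOrderAt_a_ne_top hz.1)).mono
      (nhdsWithin_mono z (fun k (hk : k ∈ OmegaP \ {z}) => hk.2))
    have h2 : eMinus t x =O[𝓝[OmegaP \ {z}] z] fun _ => (1 : ℝ) :=
      ((differentiableAt_eMinus t x hz0).continuousAt.tendsto.mono_left
        nhdsWithin_le_nhds).isBigO_one ℝ
    have h3 := (h1.mul h2).neg_left
    simp only [mul_one] at h3
    refine h3.congr_left fun k => ?_
    simp only [refl]
    ring

/-- Zeros of `a` are harmless: there `refl` is `0` by the convention for division by zero, and its
inverse `0` is the true value of `a / b`. At `0` one has `b ≠ 0`, and the exponential is bounded in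
`D₊`. -/
theorem isRegionEntry_DP (h : IsSpectralPair a b) {t x : ℝ} (ht : 0 ≤ t) (hx : 0 < x) :
    IsRegionEntry DP (zerosB b) (fun k => -((refl a b k)⁻¹ * ePlus t x k))
      (fun z k => -(polarSum b a z k * ePlus t x k)) where
  isOpen := isOpen_DP
  differentiableAt k hk hkZ := by
    have hk0 : k ≠ 0 := by rintro rfl; simp [DP] at hk
    have hb : b k ≠ 0 := h.b_ne_zero_of_notMem hk.1.le hk.2.le hkZ
    simp only [refl, inv_div]
    exact (((h.analyticAt_a hk.1).differentiableAt.div (h.analyticAt_b hk.1).differentiableAt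
      hb).mul (differentiableAt_ePlus t x hk0)).neg
  tendsto p hp hpZ hp0 := by
    obtain ⟨h1, h2⟩ := closure_DP_subset hp
    have hb : b p ≠ 0 := h.b_ne_zero_of_notMem h1 h2 hpZ
    have hsub : DP ⊆ {k | 0 ≤ k.im} := fun k hk => hk.1.le
    have ca : ContinuousWithinAt a DP p := (h.continuousOn_a p h1).mono hsub
    have cb : ContinuousWithinAt b DP p := (h.continuousOn_b p h1).mono hsub
    simp only [refl, inv_div]
    exact ((ca.div cb hb).mul
      (differentiableAt_ePlus t x hp0).continuousAt.continuousWithinAt).neg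
  bounded_zero _ := by
    have hb : b 0 ≠ 0 := by simpa using h.b_ne_zero 0 (by norm_num)
    have hsub : DP ⊆ {k | 0 ≤ k.im} := fun k hk => hk.1.le
    have ca : ContinuousWithinAt a DP 0 := (h.continuousOn_a 0 (by simp)).mono hsub
    have cb : ContinuousWithinAt b DP 0 := (h.continuousOn_b 0 (by simp)).mono hsub
    have h1 : (fun k => a k / b k) =O[𝓝[DP] 0] fun _ => (1 : ℝ) :=
      (Tendsto.div ca cb hb).isBigO_one ℝ
    have h2 : ePlus t x =O[𝓝[DP] 0] fun _ => (1 : ℝ) := by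
      refine IsBigO.of_bound 1 ?_
      filter_upwards [self_mem_nhdsWithin] with k hk
      simpa using norm_ePlus_le_one ht hx hk.1.le hk.2.le
    have h3 := (h1.mul h2).neg_left
    simp only [refl, inv_div]
    simpa using h3
  polar z hz := by
    have hz0 : z ≠ 0 := by rintro rfl; simp [zerosB] at hz
    have h1 := (polarSum_sub_isBigO (h.analyticAt_b hz.1) (h.analyticAt_a hz.1)
      (h.analyticOrderAt_b_ne_top hz.1)).mono
      (nhdsWithin_mono z (fun k (hk : k ∈ DP \ {z}) => hk.2))
    have h2 : ePlus t x =O[𝓝[DP \ {z}] z] fun _ => (1 : ℝ) :=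
      ((differentiableAt_ePlus t x hz0).continuousAt.tendsto.mono_left
        nhdsWithin_le_nhds).isBigO_one ℝ
    have h3 := (h1.mul h2).neg_left
    simp only [mul_one] at h3
    refine h3.congr_left fun k => ?_
    simp only [refl, inv_div]
    ring

theorem isRegionEntry_OmegaM (h : IsSpectralPair a b) (t x : ℝ) :
    IsRegionEntry OmegaM (starRingEnd ℂ ⁻¹' zerosA a)
      (fun k => schwarz (refl a b) k * ePlus t x k)
      (fun z k => schwarz (polarSum a b (starRingEnd ℂ z)) k * ePlus t x k) := by
  have := (h.isRegionEntry_OmegaP t x).schwarz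
  rw [← OmegaM_eq] at this
  simpa only [schwarz, map_neg, map_mul, conj_eMinus_conj, neg_neg] using this

theorem isRegionEntry_DM (h : IsSpectralPair a b) {t x : ℝ} (ht : 0 ≤ t) (hx : 0 < x) :
    IsRegionEntry DM (starRingEnd ℂ ⁻¹' zerosB b)
      (fun k => (schwarz (refl a b) k)⁻¹ * eMinus t x k)
      (fun z k => schwarz (polarSum b a (starRingEnd ℂ z)) k * eMinus t x k) := by
  have := (h.isRegionEntry_DP ht hx).schwarz
  rw [← DM_eq] at this
  simpa only [schwarz, map_neg, map_mul, map_inv₀, conj_ePlus_conj, neg_neg] using this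

end IsSpectralPair

/-! ### Local analysis in one domain -/

theorem IsRegionEntry.tendsto_of_notMem {S Z : Set ℂ} {g : ℂ → ℂ} {P : ℂ → ℂ → ℂ}
    (hg : IsRegionEntry S Z g P) {p : ℂ} (hpZ : p ∉ Z) (hp0 : p ≠ 0) :
    Tendsto g (𝓝[S] p) (𝓝 (g p)) := by
  by_cases hcl : p ∈ closure S
  · exact hg.tendsto p hcl hpZ hp0
  · rw [notMem_closure_iff_nhdsWithin_eq_bot.1 hcl]
    exact tendsto_bot

/-- The exceptional points of the real axis. -/
def cornerSet : Set ℂ := {-(1 / 2), 0, 1 / 2}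

/-- The condition on `p` leaves three cases in the closure of `S`: a pole, a corner, where `M` and
`g` are both bounded, and an ordinary boundary point, where both have limits. -/
theorem boundedAlong_mul_factor {T : ℂ → Matrix (Fin 2) (Fin 2) ℂ} (hT : IsUnipotentFamily T)
    {S Z : Set ℂ} {g : ℂ → ℂ} {P : ℂ → ℂ → ℂ} (hg : IsRegionEntry S Z g P)
    {M : ℂ → Matrix (Fin 2) (Fin 2) ℂ} (hcont : ContinuousUpTo M S (cornerSet ∪ Z))
    (hpole : ∀ z ∈ Z, BoundedAlong (fun k => M k * T (P z k)) (𝓝[S \ {z}] z))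
    (hcorner : ∀ p ∈ cornerSet, BoundedAlong M (𝓝[S] p)) {p : ℂ} (hp : p ∈ S → p ∈ Z) :
    BoundedAlong (fun k => M k * T (g k)) (𝓝[S \ {p}] p) := by
  by_cases hcl : p ∈ closure S
  · by_cases hpZ : p ∈ Z
    · refine ((hpole p hpZ).mul (hT.boundedAlong (hg.polar p hpZ))).congr
        (Eventually.of_forall fun k => ?_)
      simp only [Matrix.mul_assoc, hT.mul, add_sub_cancel]
    · refine BoundedAlong.mono ?_ (nhdsWithin_mono p (sdiff_subset : S \ {p} ⊆ S))
      by_cases hpc : p ∈ cornerSet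
      · refine (hcorner p hpc).mul (hT.boundedAlong ?_)
        by_cases hp0 : p = 0
        · subst hp0
          exact hg.bounded_zero hcl
        · exact (hg.tendsto p hcl hpZ hp0).isBigO_one ℝ
      · have hp0 : p ≠ 0 := by rintro rfl; exact hpc (by simp [cornerSet])
        obtain ⟨L, hL⟩ := hcont p ⟨⟨hcl, fun hi => hpZ (hp (interior_subset hi))⟩, by
          rintro (h | h)
          exacts [hpc h, hpZ h]⟩
        exact (boundedAlong_of_tendsto hL).mul
          (hT.boundedAlong ((hg.tendsto p hcl hpZ hp0).isBigO_one ℝ))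
  · have : 𝓝[S \ {p}] p = ⊥ := by
      rw [← notMem_closure_iff_nhdsWithin_eq_bot]
      exact fun h => hcl (closure_mono sdiff_subset h)
    intro i j
    rw [this]
    exact IsBigO.of_bound 1 (by simp)

/-! ### The triangular factor -/

theorem factorG_OmegaP (r : ℂ → ℂ) (t x : ℝ) {k : ℂ} (hk : k ∈ OmegaP) :
    factorG r t x k = upperTri (-(r k * eMinus t x k)) := by
  rw [factorG, if_pos hk, upperTri]

theorem factorG_OmegaM (r : ℂ → ℂ) (t x : ℝ) {k : ℂ} (hk : k ∈ OmegaM) :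
    factorG r t x k = lowerTri (schwarz r k * ePlus t x k) := by
  have h1 : k ∉ OmegaP := fun h => lt_asymm h.1 hk.1
  rw [factorG, if_neg h1, if_pos hk, lowerTri]

theorem factorG_DP (r : ℂ → ℂ) (t x : ℝ) {k : ℂ} (hk : k ∈ DP) :
    factorG r t x k = lowerTri (-((r k)⁻¹ * ePlus t x k)) := by
  have h1 : k ∉ OmegaP := fun h => lt_asymm h.2 hk.2
  have h2 : k ∉ OmegaM := fun h => lt_asymm h.2 hk.2
  rw [factorG, if_neg h1, if_neg h2, if_pos hk, lowerTri]

theorem factorG_DM (r : ℂ → ℂ) (t x : ℝ) {k : ℂ} (hk : k ∈ DM) :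
    factorG r t x k = upperTri ((schwarz r k)⁻¹ * eMinus t x k) := by
  have h1 : k ∉ OmegaP := fun h => lt_asymm h.2 hk.2
  have h2 : k ∉ OmegaM := fun h => lt_asymm h.2 hk.2
  have h3 : k ∉ DP := fun h => lt_asymm h.1 hk.1
  rw [factorG, if_neg h1, if_neg h2, if_neg h3, if_pos hk, upperTri]

/-- The relation `J G₋ = G₊` on the outer real axis, where `r r^* = |r|²`. Its analogues on the
other three arcs follow; only those on the semicircles need `r` to be nonzero. -/
theorem jumpOuter_mul (r : ℂ → ℂ) (t x : ℝ) {k : ℂ} (hk : k.im = 0) :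
    jumpOuter r t x k * lowerTri (schwarz r k * ePlus t x k) =
      upperTri (-(r k * eMinus t x k)) := by
  have hc : schwarz r k = starRingEnd ℂ (r k) := by
    rw [schwarz, Complex.conj_eq_iff_im.2 hk]
  have hn : (‖r k‖ : ℂ) ^ 2 = r k * starRingEnd ℂ (r k) := by
    rw [Complex.mul_conj, Complex.normSq_eq_norm_sq]; simp
  have he := eMinus_mul_ePlus t x k
  ext i j
  fin_cases i <;> fin_cases j <;> simp [jumpOuter, lowerTri, upperTri, hc, hn]
  linear_combination (-(r k * starRingEnd ℂ (r k))) * he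

theorem jumpInner_mul (r : ℂ → ℂ) (t x : ℝ) {k : ℂ} (hk : k.im = 0) :
    jumpInner r t x k * upperTri ((schwarz r k)⁻¹ * eMinus t x k) =
      lowerTri (-((r k)⁻¹ * ePlus t x k)) := by
  have hc : schwarz r k = starRingEnd ℂ (r k) := by
    rw [schwarz, Complex.conj_eq_iff_im.2 hk]
  have hn : ((‖r k‖ : ℂ) ^ 2)⁻¹ = (r k)⁻¹ * (starRingEnd ℂ (r k))⁻¹ := by
    rw [← mul_inv, Complex.mul_conj, Complex.normSq_eq_norm_sq]; simp
  have he := eMinus_mul_ePlus t x k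
  ext i j
  fin_cases i <;> fin_cases j <;> simp only [jumpInner, lowerTri, upperTri, hc, hn,
    Matrix.mul_apply, Fin.sum_univ_two] <;> simp
  linear_combination (-((r k)⁻¹ * (starRingEnd ℂ (r k))⁻¹)) * he

theorem jumpUp_mul (r : ℂ → ℂ) (t x : ℝ) {k : ℂ} (hr : r k ≠ 0) :
    jumpUp r t x k * lowerTri (-((r k)⁻¹ * ePlus t x k)) =
      upperTri (-(r k * eMinus t x k)) := by
  have he := eMinus_mul_ePlus t x k
  have hr' := mul_inv_cancel₀ hr
  ext i j
  fin_cases i <;> fin_cases j <;> simp [jumpUp, lowerTri, upperTri]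
  linear_combination eMinus t x k * ePlus t x k * hr' + he

theorem jumpDown_mul (r : ℂ → ℂ) (t x : ℝ) {k : ℂ} (hr : schwarz r k ≠ 0) :
    jumpDown r t x k * lowerTri (schwarz r k * ePlus t x k) =
      upperTri ((schwarz r k)⁻¹ * eMinus t x k) := by
  have he := eMinus_mul_ePlus t x k
  have hr' := mul_inv_cancel₀ hr
  ext i j
  fin_cases i <;> fin_cases j <;> simp [jumpDown, lowerTri, upperTri]
  linear_combination eMinus t x k * ePlus t x k * hr' + he

/-! ### The exceptional set -/

/-- All points where a solution need not have boundary values. -/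
def poleSet (a b : ℂ → ℂ) : Set ℂ :=
  cornerSet ∪ ((zerosA a ∪ starRingEnd ℂ ⁻¹' zerosA a) ∪
    (zerosB b ∪ starRingEnd ℂ ⁻¹' zerosB b))

theorem cornerSet_subset_contour : cornerSet ⊆ contour := by
  rintro k (rfl | rfl | rfl) <;> exact Or.inl (by simp)

theorem regularSet_eq (a b : ℂ → ℂ) : regularSet a b = (contour ∪ poleSet a b)ᶜ := by
  ext k
  have h := @cornerSet_subset_contour k
  simp only [regularSet, poleSet, mem_compl_iff, mem_union, mem_preimage, mem_ofPred_eq]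
  tauto

theorem eventually_conj_punctured {Q : ℂ → Prop} {p : ℂ}
    (h : ∀ᶠ k in 𝓝[≠] (starRingEnd ℂ p), Q k) : ∀ᶠ k in 𝓝[≠] p, Q (starRingEnd ℂ k) := by
  have := (tendsto_conj_nhdsWithin {starRingEnd ℂ p}ᶜ p).eventually h
  have hset : starRingEnd ℂ ⁻¹' {starRingEnd ℂ p}ᶜ = {p}ᶜ := by
    ext k
    simp [(starRingEnd ℂ).injective.eq_iff]
  rwa [hset] at this

/-- Statements that hold at infinity in the closed upper half-plane transfer to both
half-planes. -/
theorem eventually_cobounded_conj {Q : ℂ → Prop}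
    (h : ∀ᶠ k in Bornology.cobounded ℂ ⊓ 𝓟 {k | 0 ≤ k.im}, Q k) :
    ∀ᶠ k in Bornology.cobounded ℂ, (0 ≤ k.im → Q k) ∧ (k.im ≤ 0 → Q (starRingEnd ℂ k)) := by
  rw [eventually_inf_principal] at h
  have hconj : Tendsto (starRingEnd ℂ) (Bornology.cobounded ℂ) (Bornology.cobounded ℂ) := by
    rw [← tendsto_norm_atTop_iff_cobounded]
    simpa using tendsto_norm_cobounded_atTop (E := ℂ)
  filter_upwards [h, hconj.eventually h] with k h1 h2
  exact ⟨h1, fun hk => h2 (show 0 ≤ (starRingEnd ℂ k).im by simpa using hk)⟩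

namespace IsSpectralPair

variable {a b : ℂ → ℂ} {t x : ℝ}

theorem eventually_notMem_poleSet (h : IsSpectralPair a b) (p : ℂ) :
    ∀ᶠ k in 𝓝[≠] p, k ∉ poleSet a b := by
  have hfin : ∀ᶠ k in 𝓝[≠] p, k ∉ cornerSet := by
    have : cornerSet.Finite := by
      unfold cornerSet
      exact Set.toFinite _
    have h3 : (cornerSet \ {p}).Finite := this.subset sdiff_subset
    have h4 : ∀ᶠ k in 𝓝 p, k ∉ cornerSet \ {p} :=
      h3.isClosed.isOpen_compl.mem_nhds (fun hm => hm.2 rfl)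
    filter_upwards [nhdsWithin_le_nhds h4, self_mem_nhdsWithin] with k hk hkp hkc
    exact hk ⟨hkc, hkp⟩
  filter_upwards [hfin, h.eventually_notMem_zerosA p, h.eventually_notMem_zerosB p,
    eventually_conj_punctured (h.eventually_notMem_zerosA (starRingEnd ℂ p)),
    eventually_conj_punctured (h.eventually_notMem_zerosB (starRingEnd ℂ p))] with k h1 h2 h3 h4 h5
  rintro (hk | (hk | hk) | (hk | hk))
  exacts [h1 hk, h2 hk, h4 hk, h3 hk, h5 hk]

/-- The zeros of `a` are bounded because `a → 1`, and those of `b` count only in the disc. -/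
theorem eventually_mem_regularSet (h : IsSpectralPair a b) :
    ∀ᶠ k in Bornology.cobounded ℂ, k ∉ contour → k ∈ regularSet a b := by
  have h1 := eventually_cobounded_conj (h.tendsto_a.eventually_ne one_ne_zero)
  have h2 := (tendsto_norm_cobounded_atTop (E := ℂ)).eventually (eventually_gt_atTop (1 / 2))
  filter_upwards [h1, h2] with k hk hk2 hkc
  refine ⟨hkc, fun hz => hk.1 hz.1.le hz.2.2, fun hz => hk.2 ?_ hz.2.2,
    fun hz => not_lt.2 hz.2.1 hk2, fun hz => not_lt.2 hz.2.1 ?_⟩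
  · have := hz.1
    simp only [Complex.conj_im] at this
    linarith
  · simpa using hk2

theorem tendsto_factorG_OmegaP (h : IsSpectralPair a b) {p : ℂ} (hp : p ∉ zerosA a)
    (hp0 : p ≠ 0) : Tendsto (factorG (refl a b) t x) (𝓝[OmegaP] p)
      (𝓝 (upperTri (-(refl a b p * eMinus t x p)))) := by
  refine ((isUnipotentFamily_upperTri.continuous.tendsto _).comp
    ((h.isRegionEntry_OmegaP t x).tendsto_of_notMem hp hp0)).congr' ?_
  filter_upwards [self_mem_nhdsWithin] with k hk using (factorG_OmegaP _ t x hk).symm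

theorem tendsto_factorG_OmegaM (h : IsSpectralPair a b) {p : ℂ}
    (hp : starRingEnd ℂ p ∉ zerosA a) (hp0 : p ≠ 0) :
    Tendsto (factorG (refl a b) t x) (𝓝[OmegaM] p)
      (𝓝 (lowerTri (schwarz (refl a b) p * ePlus t x p))) := by
  refine ((isUnipotentFamily_lowerTri.continuous.tendsto _).comp
    ((h.isRegionEntry_OmegaM t x).tendsto_of_notMem hp hp0)).congr' ?_
  filter_upwards [self_mem_nhdsWithin] with k hk using (factorG_OmegaM _ t x hk).symm

theorem tendsto_factorG_DP (h : IsSpectralPair a b) (ht : 0 ≤ t) (hx : 0 < x) {p : ℂ}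
    (hp : p ∉ zerosB b) (hp0 : p ≠ 0) : Tendsto (factorG (refl a b) t x) (𝓝[DP] p)
      (𝓝 (lowerTri (-((refl a b p)⁻¹ * ePlus t x p)))) := by
  refine ((isUnipotentFamily_lowerTri.continuous.tendsto _).comp
    ((h.isRegionEntry_DP ht hx).tendsto_of_notMem hp hp0)).congr' ?_
  filter_upwards [self_mem_nhdsWithin] with k hk using (factorG_DP _ t x hk).symm

theorem tendsto_factorG_DM (h : IsSpectralPair a b) (ht : 0 ≤ t) (hx : 0 < x) {p : ℂ}
    (hp : starRingEnd ℂ p ∉ zerosB b) (hp0 : p ≠ 0) :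
    Tendsto (factorG (refl a b) t x) (𝓝[DM] p)
      (𝓝 (upperTri ((schwarz (refl a b) p)⁻¹ * eMinus t x p))) := by
  refine ((isUnipotentFamily_upperTri.continuous.tendsto _).comp
    ((h.isRegionEntry_DM ht hx).tendsto_of_notMem hp hp0)).congr' ?_
  filter_upwards [self_mem_nhdsWithin] with k hk using (factorG_DM _ t x hk).symm

theorem norm_entry_OmegaP_le (a b : ℂ → ℂ) (hx : 0 < x) (htx : t ≤ x) {k : ℂ} (hk : k ∈ OmegaP) :
    ‖-(refl a b k * eMinus t x k)‖ ≤ Real.exp x * ‖refl a b k‖ := by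
  rw [norm_neg, norm_mul, mul_comm]
  exact mul_le_mul_of_nonneg_right (norm_eMinus_le_exp hx htx hk.1.le hk.2.le) (norm_nonneg _)

theorem norm_entry_OmegaM_le (a b : ℂ → ℂ) (hx : 0 < x) (htx : t ≤ x) {k : ℂ} (hk : k ∈ OmegaM) :
    ‖schwarz (refl a b) k * ePlus t x k‖ ≤ Real.exp x * ‖refl a b (starRingEnd ℂ k)‖ := by
  have hk' : starRingEnd ℂ k ∈ OmegaP := by rw [OmegaM_eq] at hk; exact hk
  rw [← conj_eMinus_conj, schwarz, norm_mul, RCLike.norm_conj, RCLike.norm_conj, mul_comm]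
  exact mul_le_mul_of_nonneg_right (norm_eMinus_le_exp hx htx hk'.1.le hk'.2.le) (norm_nonneg _)

/-- At infinity the triangular factor and its inverse are controlled by the reflection
coefficient. -/
theorem eventually_norm_factorG_sub_le (a b : ℂ → ℂ) (hx : 0 < x) (htx : t ≤ x) {B : ℂ → ℝ}
    (hB : ∀ k, B (starRingEnd ℂ k) = B k)
    (hr : ∀ᶠ k in Bornology.cobounded ℂ ⊓ 𝓟 {k | 0 ≤ k.im}, ‖refl a b k‖ ≤ B k) :
    ∀ᶠ k in Bornology.cobounded ℂ, k ∉ contour → ∀ i j,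
      ‖factorG (refl a b) t x k i j - (1 : Matrix (Fin 2) (Fin 2) ℂ) i j‖ ≤ Real.exp x * B k ∧
      ‖(factorG (refl a b) t x k)⁻¹ i j - (1 : Matrix (Fin 2) (Fin 2) ℂ) i j‖ ≤
        Real.exp x * B k := by
  have h2 := (tendsto_norm_cobounded_atTop (E := ℂ)).eventually (eventually_gt_atTop (1 / 2))
  have hex := (Real.exp_pos x).le
  filter_upwards [eventually_cobounded_conj hr, h2] with k hk hk2 hkc i j
  rcases mem_regions_of_notMem_contour hkc with (hm | hm) | (hm | hm)
  · have hb := (norm_entry_OmegaP_le a b hx htx hm).trans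
      (mul_le_mul_of_nonneg_left (hk.1 hm.1.le) hex)
    rw [factorG_OmegaP _ t x hm, isUnipotentFamily_upperTri.inv]
    refine ⟨(isUnipotentFamily_upperTri.norm_sub_le _ i j).trans hb,
      (isUnipotentFamily_upperTri.norm_sub_le _ i j).trans ?_⟩
    rwa [norm_neg]
  · have hb := (norm_entry_OmegaM_le a b hx htx hm).trans
      (mul_le_mul_of_nonneg_left (hk.2 hm.1.le) hex)
    rw [hB] at hb
    rw [factorG_OmegaM _ t x hm, isUnipotentFamily_lowerTri.inv]
    refine ⟨(isUnipotentFamily_lowerTri.norm_sub_le _ i j).trans hb,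
      (isUnipotentFamily_lowerTri.norm_sub_le _ i j).trans ?_⟩
    rwa [norm_neg]
  · exact absurd hm.2 (not_lt.2 hk2.le)
  · exact absurd hm.2 (not_lt.2 hk2.le)

theorem tendsto_factorG_cobounded (h : IsSpectralPair a b) (hx : 0 < x) (htx : t ≤ x) :
    Tendsto (factorG (refl a b) t x) (Bornology.cobounded ℂ ⊓ 𝓟 (regularSet a b)) (𝓝 1) := by
  refine tendsto_pi_nhds.2 fun i => tendsto_pi_nhds.2 fun j => ?_
  rw [Metric.tendsto_nhds]
  intro ε hε
  have hδ : 0 < ε / (2 * Real.exp x) := by positivity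
  have hr : ∀ᶠ k in Bornology.cobounded ℂ ⊓ 𝓟 {k | 0 ≤ k.im},
      ‖refl a b k‖ ≤ ε / (2 * Real.exp x) := by
    filter_upwards [Metric.tendsto_nhds.1 h.tendsto_refl _ hδ] with k hk
    rw [dist_zero_right] at hk
    exact hk.le
  rw [eventually_inf_principal]
  filter_upwards [eventually_norm_factorG_sub_le a b hx htx (fun _ => rfl) hr] with k hk hkR
  rw [dist_eq_norm]
  refine ((hk hkR.1 i j).1).trans_lt ?_
  have : Real.exp x * (ε / (2 * Real.exp x)) = ε / 2 := by field_simp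
  rw [this]
  exact half_lt_self hε

end IsSpectralPair

/-! ### Removal of jumps and poles -/

/-- On the domain `S` the matrix function `G` is the unipotent factor `T ∘ g`. -/
structure IsFactorOn (G : ℂ → Matrix (Fin 2) (Fin 2) ℂ) (S Z : Set ℂ)
    (T : ℂ → Matrix (Fin 2) (Fin 2) ℂ) (g : ℂ → ℂ) (P : ℂ → ℂ → ℂ) : Prop where
  unipotent : IsUnipotentFamily T
  entry : IsRegionEntry S Z g P
  eq_on : ∀ k ∈ S, G k = T (g k)

/-- `G` has unimodular boundary values at `p` from `P` and `N` that are related by `J`. -/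
def RemovesJump (G : ℂ → Matrix (Fin 2) (Fin 2) ℂ) (P N : Set ℂ) (p : ℂ)
    (J : Matrix (Fin 2) (Fin 2) ℂ) : Prop :=
  ∃ A B, Tendsto G (𝓝[P] p) (𝓝 A) ∧ Tendsto G (𝓝[N] p) (𝓝 B) ∧
    A.det = 1 ∧ B.det = 1 ∧ J * B = A

/-- Because `M₋ G₋ = M₊ J G₋ = M₊ G₊`. -/
theorem HasJump.tendsto_mul {M G : ℂ → Matrix (Fin 2) (Fin 2) ℂ} {P N : Set ℂ} {p : ℂ}
    {J : Matrix (Fin 2) (Fin 2) ℂ} (hM : HasJump M P N p J) (hG : RemovesJump G P N p J) :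
    ∃ L, Tendsto (fun k => M k * G k) (𝓝[P ∪ N] p) (𝓝 L) := by
  obtain ⟨Mp, Mm, h1, h2, rfl⟩ := hM
  obtain ⟨A, B, h3, h4, hA, hB, rfl⟩ := hG
  refine ⟨Mp * (J * B), ?_⟩
  rw [nhdsWithin_union]
  refine (h1.mul h3).sup ?_
  rw [← Matrix.mul_assoc]
  exact h2.mul h4

/-- For determinant one the inverse is the adjugate, which is continuous in the entries. -/
theorem tendsto_matrix_inv {G : ℂ → Matrix (Fin 2) (Fin 2) ℂ} (hdet : ∀ k, (G k).det = 1)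
    {l : Filter ℂ} {A : Matrix (Fin 2) (Fin 2) ℂ} (h : Tendsto G l (𝓝 A)) :
    Tendsto (fun k => (G k)⁻¹) l (𝓝 A⁻¹) := by
  rcases l.eq_or_neBot with rfl | hl
  · exact tendsto_bot
  have hA : A.det = 1 := by
    have h1 := ((continuous_id.matrix_det).tendsto A).comp h
    refine tendsto_nhds_unique h1 (tendsto_const_nhds.congr fun k => (hdet k).symm)
  have h2 := ((continuous_id.matrix_adjugate).tendsto A).comp h
  rw [Matrix.inv_def, hA, Ring.inverse_one, one_smul]
  refine h2.congr fun k => ?_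
  rw [Matrix.inv_def, hdet, Ring.inverse_one, one_smul]
  rfl

/-- From `J * B = A` one gets `B⁻¹ = A⁻¹ * J`. -/
theorem RemovesJump.hasJump_inv {G : ℂ → Matrix (Fin 2) (Fin 2) ℂ} (hdet : ∀ k, (G k).det = 1)
    {P N : Set ℂ} {p : ℂ} {J : Matrix (Fin 2) (Fin 2) ℂ}
    (hG : RemovesJump G P N p J) : HasJump (fun k => (G k)⁻¹) P N p J := by
  obtain ⟨A, B, h3, h4, hA, hB, rfl⟩ := hG
  have hJ : J.det = 1 := by rwa [Matrix.det_mul, hB, mul_one] at hA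
  refine ⟨_, _, tendsto_matrix_inv hdet h3, tendsto_matrix_inv hdet h4, ?_⟩
  rw [Matrix.mul_inv_rev, Matrix.mul_assoc, Matrix.nonsing_inv_mul _ (by simp [hJ]),
    Matrix.mul_one]

theorem IsRegionEntry.isBigO_one {S Z : Set ℂ} {g : ℂ → ℂ} {P : ℂ → ℂ → ℂ}
    (hg : IsRegionEntry S Z g P) {p : ℂ} (hpZ : p ∉ Z) : g =O[𝓝[S] p] fun _ => (1 : ℝ) := by
  by_cases hcl : p ∈ closure S
  · by_cases hp0 : p = 0
    · subst hp0
      exact hg.bounded_zero hcl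
    · exact (hg.tendsto p hcl hpZ hp0).isBigO_one ℝ
  · rw [notMem_closure_iff_nhdsWithin_eq_bot.1 hcl]
    exact IsBigO.of_bound 1 (by simp)

namespace IsFactorOn

variable {G : ℂ → Matrix (Fin 2) (Fin 2) ℂ} {S Z : Set ℂ}
    {T : ℂ → Matrix (Fin 2) (Fin 2) ℂ} {g : ℂ → ℂ} {P : ℂ → ℂ → ℂ}

theorem differentiableAt (h : IsFactorOn G S Z T g P) {k : ℂ} (hk : k ∈ S) (hkZ : k ∉ Z)
    (i j : Fin 2) : DifferentiableAt ℂ (fun k => G k i j) k := by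
  have h1 : DifferentiableAt ℂ (fun k => T (g k) i j) k :=
    (h.unipotent.differentiable i j (g k)).comp k (h.entry.differentiableAt k hk hkZ)
  refine h1.congr_of_eventuallyEq ?_
  filter_upwards [h.entry.isOpen.mem_nhds hk] with k' hk' using by rw [h.eq_on k' hk']

theorem inv_differentiableAt (h : IsFactorOn G S Z T g P) {k : ℂ} (hk : k ∈ S) (hkZ : k ∉ Z)
    (i j : Fin 2) : DifferentiableAt ℂ (fun k => (G k)⁻¹ i j) k := by
  have h1 : DifferentiableAt ℂ (fun k => T (-g k) i j) k :=
    DifferentiableAt.comp (g := fun c => T c i j) (f := fun k => -g k) k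
      (h.unipotent.differentiable i j (-g k)) (h.entry.differentiableAt k hk hkZ).neg
  refine h1.congr_of_eventuallyEq ?_
  filter_upwards [h.entry.isOpen.mem_nhds hk] with k' hk' using by
    rw [h.eq_on k' hk', h.unipotent.inv]

theorem continuousUpTo_inv (h : IsFactorOn G S Z T g P) {C : Set ℂ}
    (hC : 0 ∈ closure S → 0 ∈ C) : ContinuousUpTo (fun k => (G k)⁻¹) S (C ∪ Z) := by
  rintro p ⟨hp, hpC⟩
  have hcl := frontier_subset_closure hp
  have hp0 : p ≠ 0 := by
    rintro rfl
    exact hpC (Or.inl (hC hcl))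
  refine ⟨T (-g p), ((h.unipotent.continuous.tendsto _).comp
    (h.entry.tendsto p hcl (fun hz => hpC (Or.inr hz)) hp0).neg).congr' ?_⟩
  filter_upwards [self_mem_nhdsWithin] with k hk
  rw [h.eq_on k hk, h.unipotent.inv]
  rfl

/-- The product is `T (P z k - g k)`, whose entry is bounded since `P z` carries the singular part
of `g`. -/
theorem boundedAlong_inv_mul (h : IsFactorOn G S Z T g P) {z : ℂ} (hz : z ∈ Z) :
    BoundedAlong (fun k => (G k)⁻¹ * T (P z k)) (𝓝[S \ {z}] z) := by
  refine (h.unipotent.boundedAlong (h.entry.polar z hz).neg_left).congr ?_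
  filter_upwards [self_mem_nhdsWithin] with k hk
  rw [h.eq_on k hk.1, h.unipotent.inv, h.unipotent.mul, neg_sub, sub_eq_neg_add]

theorem boundedAlong_inv (h : IsFactorOn G S Z T g P) {p : ℂ} (hp : p ∉ Z) :
    BoundedAlong (fun k => (G k)⁻¹) (𝓝[S] p) := by
  refine (h.unipotent.boundedAlong (h.entry.isBigO_one hp).neg_left).congr ?_
  filter_upwards [self_mem_nhdsWithin] with k hk
  rw [h.eq_on k hk, h.unipotent.inv]

theorem boundedAlong_mul (h : IsFactorOn G S Z T g P) {M : ℂ → Matrix (Fin 2) (Fin 2) ℂ}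
    (hcont : ContinuousUpTo M S (cornerSet ∪ Z))
    (hpole : ∀ z ∈ Z, BoundedAlong (fun k => M k * T (P z k)) (𝓝[S \ {z}] z))
    (hcorner : ∀ p ∈ cornerSet, BoundedAlong M (𝓝[S] p)) {p : ℂ} (hp : p ∈ S → p ∈ Z) :
    BoundedAlong (fun k => M k * G k) (𝓝[S \ {p}] p) := by
  refine (boundedAlong_mul_factor h.unipotent h.entry hcont hpole hcorner hp).congr ?_
  filter_upwards [self_mem_nhdsWithin] with k hk
  rw [h.eq_on k hk.1]

end IsFactorOn

theorem notMem_contour_OmegaP {k : ℂ} (hk : k ∈ OmegaP) : k ∉ contour := by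
  rintro (h | h)
  exacts [hk.1.ne' h, hk.2.ne' h]

theorem notMem_contour_OmegaM {k : ℂ} (hk : k ∈ OmegaM) : k ∉ contour := by
  rintro (h | h)
  exacts [hk.1.ne h, hk.2.ne' h]

theorem notMem_contour_DP {k : ℂ} (hk : k ∈ DP) : k ∉ contour := by
  rintro (h | h)
  exacts [hk.1.ne' h, hk.2.ne h]

theorem notMem_contour_DM {k : ℂ} (hk : k ∈ DM) : k ∉ contour := by
  rintro (h | h)
  exacts [hk.1.ne h, hk.2.ne h]

theorem det_upperTri (c : ℂ) : (upperTri c).det = 1 := by simp [upperTri]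

theorem det_lowerTri (c : ℂ) : (lowerTri c).det = 1 := by simp [lowerTri]

theorem det_factorG (r : ℂ → ℂ) (t x : ℝ) (k : ℂ) : (factorG r t x k).det = 1 := by
  unfold factorG
  split_ifs <;> simp [Matrix.det_fin_two]

/-! ### The factor `G` in the four domains and across the contour -/

namespace IsSpectralPair

variable {a b : ℂ → ℂ} {t x : ℝ}

theorem isFactorOn_OmegaP (h : IsSpectralPair a b) (t x : ℝ) :
    IsFactorOn (factorG (refl a b) t x) OmegaP (zerosA a) upperTri
      (fun k => -(refl a b k * eMinus t x k))
      (fun z k => -(polarSum a b z k * eMinus t x k)) :=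
  ⟨isUnipotentFamily_upperTri, h.isRegionEntry_OmegaP t x, fun _ => factorG_OmegaP _ t x⟩

theorem isFactorOn_OmegaM (h : IsSpectralPair a b) (t x : ℝ) :
    IsFactorOn (factorG (refl a b) t x) OmegaM (starRingEnd ℂ ⁻¹' zerosA a) lowerTri
      (fun k => schwarz (refl a b) k * ePlus t x k)
      (fun z k => schwarz (polarSum a b (starRingEnd ℂ z)) k * ePlus t x k) :=
  ⟨isUnipotentFamily_lowerTri, h.isRegionEntry_OmegaM t x, fun _ => factorG_OmegaM _ t x⟩

theorem isFactorOn_DP (h : IsSpectralPair a b) (ht : 0 ≤ t) (hx : 0 < x) :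
    IsFactorOn (factorG (refl a b) t x) DP (zerosB b) lowerTri
      (fun k => -((refl a b k)⁻¹ * ePlus t x k))
      (fun z k => -(polarSum b a z k * ePlus t x k)) :=
  ⟨isUnipotentFamily_lowerTri, h.isRegionEntry_DP ht hx, fun _ => factorG_DP _ t x⟩

theorem isFactorOn_DM (h : IsSpectralPair a b) (ht : 0 ≤ t) (hx : 0 < x) :
    IsFactorOn (factorG (refl a b) t x) DM (starRingEnd ℂ ⁻¹' zerosB b) upperTri
      (fun k => (schwarz (refl a b) k)⁻¹ * eMinus t x k)
      (fun z k => schwarz (polarSum b a (starRingEnd ℂ z)) k * eMinus t x k) :=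
  ⟨isUnipotentFamily_upperTri, h.isRegionEntry_DM ht hx, fun _ => factorG_DM _ t x⟩

theorem removesJump_outer (h : IsSpectralPair a b) {p : ℂ} (hp : p.im = 0) (hp2 : 1 / 2 < ‖p‖) :
    RemovesJump (factorG (refl a b) t x) OmegaP OmegaM p (jumpOuter (refl a b) t x p) := by
  have hp0 : p ≠ 0 := by rintro rfl; norm_num at hp2
  exact ⟨_, _, h.tendsto_factorG_OmegaP (fun hz => hz.1.ne' hp) hp0,
    h.tendsto_factorG_OmegaM (fun hz => hz.1.ne' (by simpa using hp)) hp0,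
    det_upperTri _, det_lowerTri _, jumpOuter_mul _ t x hp⟩

theorem removesJump_inner (h : IsSpectralPair a b) (ht : 0 ≤ t) (hx : 0 < x) {p : ℂ}
    (hp : p.im = 0) (hp0 : p ≠ 0) :
    RemovesJump (factorG (refl a b) t x) DP DM p (jumpInner (refl a b) t x p) :=
  ⟨_, _, h.tendsto_factorG_DP ht hx (fun hz => hz.1.ne' hp) hp0,
    h.tendsto_factorG_DM ht hx (fun hz => hz.1.ne' (by simpa using hp)) hp0,
    det_lowerTri _, det_upperTri _, jumpInner_mul _ t x hp⟩

theorem removesJump_up (h : IsSpectralPair a b) (ht : 0 ≤ t) (hx : 0 < x) {p : ℂ}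
    (hp : 0 < p.im) (hpa : a p ≠ 0) (hpb : b p ≠ 0) :
    RemovesJump (factorG (refl a b) t x) OmegaP DP p (jumpUp (refl a b) t x p) := by
  have hp0 : p ≠ 0 := by rintro rfl; simp at hp
  exact ⟨_, _, h.tendsto_factorG_OmegaP (fun hz => hpa hz.2.2) hp0,
    h.tendsto_factorG_DP ht hx (fun hz => hpb hz.2.2) hp0, det_upperTri _, det_lowerTri _,
    jumpUp_mul _ t x (div_ne_zero hpb hpa)⟩

theorem removesJump_down (h : IsSpectralPair a b) (ht : 0 ≤ t) (hx : 0 < x) {p : ℂ}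
    (hp : p.im < 0) (hpa : schwarz a p ≠ 0) (hpb : schwarz b p ≠ 0) :
    RemovesJump (factorG (refl a b) t x) DM OmegaM p (jumpDown (refl a b) t x p) := by
  have hp0 : p ≠ 0 := by rintro rfl; simp at hp
  rw [schwarz, map_ne_zero] at hpa hpb
  refine ⟨_, _, h.tendsto_factorG_DM ht hx (fun hz => hpb hz.2.2) hp0,
    h.tendsto_factorG_OmegaM (fun hz => hpa hz.2.2) hp0, det_upperTri _, det_lowerTri _,
    jumpDown_mul _ t x ?_⟩
  rw [schwarz, map_ne_zero]
  exact div_ne_zero hpb hpa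

theorem differentiableOn_factorG (h : IsSpectralPair a b) (ht : 0 ≤ t) (hx : 0 < x) (i j : Fin 2) :
    DifferentiableOn ℂ (fun k => factorG (refl a b) t x k i j) (regularSet a b) := by
  rintro k ⟨hkc, h1, h2, h3, h4⟩
  refine DifferentiableAt.differentiableWithinAt ?_
  rcases mem_regions_of_notMem_contour hkc with (hm | hm) | (hm | hm)
  exacts [(h.isFactorOn_OmegaP t x).differentiableAt hm h1 i j,
    (h.isFactorOn_OmegaM t x).differentiableAt hm h2 i j,
    (h.isFactorOn_DP ht hx).differentiableAt hm h3 i j,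
    (h.isFactorOn_DM ht hx).differentiableAt hm h4 i j]

theorem differentiableOn_factorG_inv (h : IsSpectralPair a b) (ht : 0 ≤ t) (hx : 0 < x)
    (i j : Fin 2) :
    DifferentiableOn ℂ (fun k => (factorG (refl a b) t x k)⁻¹ i j) (regularSet a b) := by
  rintro k ⟨hkc, h1, h2, h3, h4⟩
  refine DifferentiableAt.differentiableWithinAt ?_
  rcases mem_regions_of_notMem_contour hkc with (hm | hm) | (hm | hm)
  exacts [(h.isFactorOn_OmegaP t x).inv_differentiableAt hm h1 i j,
    (h.isFactorOn_OmegaM t x).inv_differentiableAt hm h2 i j,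
    (h.isFactorOn_DP ht hx).inv_differentiableAt hm h3 i j,
    (h.isFactorOn_DM ht hx).inv_differentiableAt hm h4 i j]

/-- Near a point of the contour a domain off the contour consists of regular points. -/
theorem nhdsWithin_le_regularSet (h : IsSpectralPair a b) {S : Set ℂ}
    (hS : ∀ k ∈ S, k ∉ contour) {p : ℂ} (hp : p ∈ contour) :
    𝓝[S] p ≤ 𝓝[regularSet a b] p := by
  rw [nhdsWithin_le_iff]
  have h1 : 𝓝[S] p ≤ 𝓝[≠] p :=
    nhdsWithin_mono p fun k hk hkp => hS k hk (by rw [mem_singleton_iff.1 hkp]; exact hp)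
  filter_upwards [h1 (h.eventually_notMem_poleSet p), self_mem_nhdsWithin] with k hk hkS
  rw [regularSet_eq]
  rintro (hc | hc)
  exacts [hS k hkS hc, hk hc]

end IsSpectralPair

theorem regularSet_subset_regions (a b : ℂ → ℂ) :
    regularSet a b ⊆ (OmegaP ∪ OmegaM) ∪ (DP ∪ DM) := fun _ hk =>
  mem_regions_of_notMem_contour hk.1

/-! ### Solutions of the Riemann–Hilbert problem -/

theorem ContinuousUpTo.mono {M : ℂ → Matrix (Fin 2) (Fin 2) ℂ} {R S S' : Set ℂ}
    (h : ContinuousUpTo M R S) (hS : S ⊆ S') : ContinuousUpTo M R S' := fun k hk =>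
  h k ⟨hk.1, fun hk' => hk.2 (hS hk')⟩

theorem corner_im {p : ℂ} (hp : p ∈ cornerSet) : p.im = 0 := by
  rcases hp with rfl | rfl | rfl <;> simp

theorem mem_zerosA_of_mem_poleSet {a b : ℂ → ℂ} {p : ℂ} (hp : p ∈ poleSet a b) (hS : p ∈ OmegaP) :
    p ∈ zerosA a := by
  rcases hp with hp | (hp | hp) | (hp | hp)
  · exact absurd (corner_im hp) hS.1.ne'
  · exact hp
  · have h1 := hp.1
    rw [Complex.conj_im] at h1
    linarith [hS.1]
  · exact absurd hp.2.1 (not_le.2 hS.2)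
  · exact absurd hp.2.1 (not_le.2 (by simpa using hS.2))

theorem mem_zerosB_of_mem_poleSet {a b : ℂ → ℂ} {p : ℂ} (hp : p ∈ poleSet a b) (hS : p ∈ DP) :
    p ∈ zerosB b := by
  rcases hp with hp | (hp | hp) | (hp | hp)
  · exact absurd (corner_im hp) hS.1.ne'
  · exact absurd hp.2.1 (not_le.2 hS.2)
  · exact absurd hp.2.1 (not_le.2 (by simpa using hS.2))
  · exact hp
  · have h1 := hp.1
    rw [Complex.conj_im] at h1
    linarith [hS.1]

theorem conj_mem_poleSet {a b : ℂ → ℂ} {p : ℂ} (hp : p ∈ poleSet a b) :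
    starRingEnd ℂ p ∈ poleSet a b := by
  rcases hp with hp | (hp | hp) | (hp | hp)
  · refine Or.inl ?_
    rwa [Complex.conj_eq_iff_im.2 (corner_im hp)]
  · exact Or.inr (Or.inl (Or.inr (by simpa using hp)))
  · exact Or.inr (Or.inl (Or.inl hp))
  · exact Or.inr (Or.inr (Or.inr (by simpa using hp)))
  · exact Or.inr (Or.inr (Or.inl hp))

namespace IsRHSolution

variable {a b : ℂ → ℂ} {t x : ℝ} {M : ℂ → Matrix (Fin 2) (Fin 2) ℂ}

theorem exists_tendsto_mul_factorG (hM : IsRHSolution a b t x M) (h : IsSpectralPair a b)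
    (ht : 0 ≤ t) (hx : 0 < x) {p : ℂ} (hp : p ∈ contour \ poleSet a b) :
    ∃ L, Tendsto (fun k => M k * factorG (refl a b) t x k) (𝓝[regularSet a b] p) (𝓝 L) := by
  obtain ⟨hpc, hpX⟩ := hp
  have hpm : p ≠ -(1 / 2) := fun e => hpX (Or.inl (Or.inl e))
  have hp0 : p ≠ 0 := fun e => hpX (Or.inl (Or.inr (Or.inl e)))
  have hpp : p ≠ 1 / 2 := fun e => hpX (Or.inl (Or.inr (Or.inr e)))
  -- Near a nonexceptional point of the contour, the complement of the contour lies in the two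
  -- adjacent domains, so a common limit from these is a limit from the regular set.
  have key : ∀ {P N U : Set ℂ} {J : Matrix (Fin 2) (Fin 2) ℂ}, IsOpen U → p ∈ U →
      (∀ k ∈ U, k ∉ contour → k ∈ P ∪ N) → HasJump M P N p J →
      RemovesJump (factorG (refl a b) t x) P N p J →
      ∃ L, Tendsto (fun k => M k * factorG (refl a b) t x k) (𝓝[regularSet a b] p) (𝓝 L) := by
    intro P N U J hU hpU hPN h1 h2
    obtain ⟨L, hL⟩ := h1.tendsto_mul h2
    refine ⟨L, hL.mono_left ?_⟩
    rw [nhdsWithin_le_iff]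
    filter_upwards [nhdsWithin_le_nhds (hU.mem_nhds hpU), self_mem_nhdsWithin] with k hk hkR
    exact hPN k hk hkR.1
  rcases lt_trichotomy p.im 0 with him | him | him
  · have hn : ‖p‖ = 1 / 2 := hpc.resolve_left him.ne
    have hca : schwarz a p ≠ 0 := by
      rw [schwarz, map_ne_zero]
      exact fun hz => hpX (Or.inr (Or.inl (Or.inr ⟨by simpa using him, by simp [hn], hz⟩)))
    have hcb : schwarz b p ≠ 0 := by
      rw [schwarz, map_ne_zero]
      exact fun hz => hpX (Or.inr (Or.inr (Or.inr ⟨by simpa using him, by simp [hn], hz⟩)))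
    refine key (isOpen_lt Complex.continuous_im continuous_const) him ?_
      (hM.jump_down p him hn hca hcb) (h.removesJump_down ht hx him hca hcb)
    intro k (hk : k.im < 0) hkc
    rcases lt_or_gt_of_ne (fun e => hkc (Or.inr e) : ‖k‖ ≠ 1 / 2) with h' | h'
    exacts [Or.inl ⟨hk, h'⟩, Or.inr ⟨hk, h'⟩]
  · have hn : ‖p‖ ≠ 1 / 2 := by
      intro hn
      rw [norm_eq_abs_re him, abs_eq (by norm_num)] at hn
      rcases hn with hn | hn
      · exact hpp (by rw [eq_ofReal_re him, hn]; norm_num)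
      · exact hpm (by rw [eq_ofReal_re him, hn]; norm_num)
    rcases lt_or_gt_of_ne hn with hn | hn
    · have hj : HasJump M DP DM p (jumpInner (refl a b) t x p) := by
        rw [eq_ofReal_re him]
        refine hM.jump_inner p.re ?_ (by rwa [← norm_eq_abs_re him])
        intro h0
        exact hp0 (Complex.ext h0 him)
      refine key (isOpen_lt continuous_norm continuous_const) hn ?_ hj
        (h.removesJump_inner ht hx him hp0)
      intro k (hk : ‖k‖ < 1 / 2) hkc
      rcases lt_or_gt_of_ne (fun e => hkc (Or.inl e) : k.im ≠ 0) with h' | h'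
      exacts [Or.inr ⟨h', hk⟩, Or.inl ⟨h', hk⟩]
    · have hj : HasJump M OmegaP OmegaM p (jumpOuter (refl a b) t x p) := by
        rw [eq_ofReal_re him]
        exact hM.jump_outer p.re (by rwa [← norm_eq_abs_re him])
      refine key (isOpen_lt continuous_const continuous_norm) hn ?_ hj
        (h.removesJump_outer him hn)
      intro k (hk : 1 / 2 < ‖k‖) hkc
      rcases lt_or_gt_of_ne (fun e => hkc (Or.inl e) : k.im ≠ 0) with h' | h'
      exacts [Or.inr ⟨h', hk⟩, Or.inl ⟨h', hk⟩]
  · have hn : ‖p‖ = 1 / 2 := hpc.resolve_left him.ne'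
    have hca : a p ≠ 0 := fun hz => hpX (Or.inr (Or.inl (Or.inl ⟨him, hn.ge, hz⟩)))
    have hcb : b p ≠ 0 := fun hz => hpX (Or.inr (Or.inr (Or.inl ⟨him, hn.le, hz⟩)))
    refine key (isOpen_lt continuous_const Complex.continuous_im) him ?_
      (hM.jump_up p him hn hca hcb) (h.removesJump_up ht hx him hca hcb)
    intro k (hk : 0 < k.im) hkc
    rcases lt_or_gt_of_ne (fun e => hkc (Or.inr e) : ‖k‖ ≠ 1 / 2) with h' | h'
    exacts [Or.inr ⟨hk, h'⟩, Or.inl ⟨hk, h'⟩]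

/-- The four domains cover the regular set and can be treated separately: if `p` lies inside one of
them, it is a pole for that domain, and otherwise it is at worst a boundary point. -/
theorem boundedAlong_mul_factorG (hM : IsRHSolution a b t x M) (h : IsSpectralPair a b)
    (ht : 0 ≤ t) (hx : 0 < x) {p : ℂ} (hp : p ∈ poleSet a b) :
    BoundedAlong (fun k => M k * factorG (refl a b) t x k) (𝓝[regularSet a b] p) := by
  have hsub : ({-(1 / 2), 1 / 2} : Set ℂ) ⊆ cornerSet := by
    rintro k (rfl | rfl)
    exacts [Or.inl rfl, Or.inr (Or.inr rfl)]
  have hcorner : ∀ {S : Set ℂ}, (∀ k ∈ S, k ∉ contour) → ∀ q ∈ cornerSet,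
      BoundedAlong M (𝓝[S] q) := fun hS q hq =>
    (hM.bounded q hq).mono (h.nhdsWithin_le_regularSet hS (cornerSet_subset_contour hq))
  have hΩp := (h.isFactorOn_OmegaP t x).boundedAlong_mul
    (hM.cont_OmegaP.mono (union_subset_union_left _ hsub)) hM.pole_a
    (hcorner fun _ => notMem_contour_OmegaP) (mem_zerosA_of_mem_poleSet hp)
  have hΩm := (h.isFactorOn_OmegaM t x).boundedAlong_mul
    (hM.cont_OmegaM.mono (union_subset_union_left _ hsub))
    (fun z hz => by simpa [lowerTri] using hM.pole_a_conj _ hz)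
    (hcorner fun _ => notMem_contour_OmegaM) (p := p) (fun hS => by
      rw [OmegaM_eq] at hS
      exact mem_zerosA_of_mem_poleSet (conj_mem_poleSet hp) hS)
  have hDp := (h.isFactorOn_DP ht hx).boundedAlong_mul hM.cont_DP hM.pole_b
    (hcorner fun _ => notMem_contour_DP) (mem_zerosB_of_mem_poleSet hp)
  have hDm := (h.isFactorOn_DM ht hx).boundedAlong_mul hM.cont_DM
    (fun z hz => by simpa [upperTri] using hM.pole_b_conj _ hz)
    (hcorner fun _ => notMem_contour_DM) (p := p) (fun hS => by
      rw [DM_eq] at hS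
      exact mem_zerosB_of_mem_poleSet (conj_mem_poleSet hp) hS)
  refine ((hΩp.sup hΩm).sup (hDp.sup hDm)).mono ?_
  simp only [← nhdsWithin_union, ← union_sdiff_distrib]
  refine nhdsWithin_mono p fun k hk => ⟨regularSet_subset_regions a b hk, ?_⟩
  rintro rfl
  rw [regularSet_eq] at hk
  exact hk (Or.inr hp)

theorem tendsto_cobounded (hM : IsRHSolution a b t x M) :
    Tendsto M (Bornology.cobounded ℂ ⊓ 𝓟 (regularSet a b)) (𝓝 1) := by
  refine tendsto_pi_nhds.2 fun i => tendsto_pi_nhds.2 fun j => ?_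
  have h1 : Tendsto (fun k : ℂ => k⁻¹) (Bornology.cobounded ℂ ⊓ 𝓟 (regularSet a b)) (𝓝 0) :=
    tendsto_inv₀_cobounded.mono_left inf_le_left
  have h2 := (hM.normalization i j).trans_tendsto h1
  have h3 := h2.add_const ((1 : Matrix (Fin 2) (Fin 2) ℂ) i j)
  simpa using h3

/-- Every solution is the inverse of the triangular factor. -/
theorem mul_factorG (hM : IsRHSolution a b t x M) (h : IsSpectralPair a b)
    (ht : 0 ≤ t) (hx : 0 < x) (htx : t ≤ x) {k : ℂ} (hk : k ∈ regularSet a b) :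
    M k * factorG (refl a b) t x k = 1 := by
  ext i j
  have key := eq_const_of_removable_contour
    (f := fun k => (M k * factorG (refl a b) t x k) i j) (X := poleSet a b)
    (c := (1 : Matrix (Fin 2) (Fin 2) ℂ) i j) h.eventually_notMem_poleSet
    (Or.inl (Or.inl rfl)) (Or.inl (Or.inr (Or.inr rfl)))
  rw [← regularSet_eq] at key
  refine key ?_ ?_ ?_ ?_ k hk
  · simp only [Matrix.mul_apply, Fin.sum_univ_two]
    exact ((hM.analytic i 0).mul (h.differentiableOn_factorG ht hx 0 j)).add
      ((hM.analytic i 1).mul (h.differentiableOn_factorG ht hx 1 j))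
  · intro p hp
    obtain ⟨L, hL⟩ := hM.exists_tendsto_mul_factorG h ht hx hp
    exact ⟨L i j, tendsto_pi_nhds.1 (tendsto_pi_nhds.1 hL i) j⟩
  · exact fun p hp => hM.boundedAlong_mul_factorG h ht hx hp i j
  -- Here `r → 0` suffices, without a rate, as the exponentials in `G` are bounded outside the
  -- circle.
  · have := hM.tendsto_cobounded.mul (h.tendsto_factorG_cobounded hx htx)
    rw [mul_one] at this
    exact tendsto_pi_nhds.1 (tendsto_pi_nhds.1 this i) j

theorem eq_inv_factorG (hM : IsRHSolution a b t x M) (h : IsSpectralPair a b)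
    (ht : 0 ≤ t) (hx : 0 < x) (htx : t ≤ x) {k : ℂ} (hk : k ∈ regularSet a b) :
    M k = (factorG (refl a b) t x k)⁻¹ :=
  (Matrix.inv_eq_left_inv (hM.mul_factorG h ht hx htx hk)).symm

end IsRHSolution

/-- The inverse of the triangular factor solves the problem. -/
theorem IsSpectralPair.isRHSolution_inv {a b : ℂ → ℂ} {t x : ℝ} (h : IsSpectralPair a b)
    (ht : 0 ≤ t) (hx : 0 < x) (htx : t ≤ x)
    (hr : refl a b =O[Bornology.cobounded ℂ ⊓ 𝓟 {k | 0 ≤ k.im}] fun k => k⁻¹) :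
    IsRHSolution a b t x fun k => (factorG (refl a b) t x k)⁻¹ where
  analytic := h.differentiableOn_factorG_inv ht hx
  cont_OmegaP := (h.isFactorOn_OmegaP t x).continuousUpTo_inv fun h0 => by
    have := (closure_OmegaP_subset h0).2
    norm_num at this
  cont_OmegaM := (h.isFactorOn_OmegaM t x).continuousUpTo_inv fun h0 => by
    rw [OmegaM_eq] at h0
    have := (closure_OmegaP_subset (conj_mem_closure_of_mem h0)).2
    norm_num at this
  cont_DP := (h.isFactorOn_DP ht hx).continuousUpTo_inv fun _ => Or.inr (Or.inl rfl)
  cont_DM := (h.isFactorOn_DM ht hx).continuousUpTo_inv fun _ => Or.inr (Or.inl rfl)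
  pole_a z hz := (h.isFactorOn_OmegaP t x).boundedAlong_inv_mul hz
  pole_a_conj z hz := by
    have := (h.isFactorOn_OmegaM t x).boundedAlong_inv_mul (z := starRingEnd ℂ z)
      (by simpa using hz)
    simpa only [Complex.conj_conj, lowerTri] using this
  pole_b z hz := (h.isFactorOn_DP ht hx).boundedAlong_inv_mul hz
  pole_b_conj z hz := by
    have := (h.isFactorOn_DM ht hx).boundedAlong_inv_mul (z := starRingEnd ℂ z)
      (by simpa using hz)
    simpa only [Complex.conj_conj, upperTri] using this
  jump_outer s hs :=
    (h.removesJump_outer (by simp) (by simpa using hs)).hasJump_inv (det_factorG _ t x)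
  jump_inner s hs _ :=
    (h.removesJump_inner ht hx (by simp) (by simpa using hs)).hasJump_inv (det_factorG _ t x)
  jump_up k hk _ hka hkb := (h.removesJump_up ht hx hk hka hkb).hasJump_inv (det_factorG _ t x)
  jump_down k hk _ hka hkb := (h.removesJump_down ht hx hk hka hkb).hasJump_inv (det_factorG _ t x)
  bounded p hp := by
    have him : p.im = 0 := corner_im hp
    have him' : (starRingEnd ℂ p).im = 0 := by simp [him]
    refine BoundedAlong.mono ?_ (nhdsWithin_mono p (regularSet_subset_regions a b))
    simp only [nhdsWithin_union]
    exact (((h.isFactorOn_OmegaP t x).boundedAlong_inv fun hz => hz.1.ne' him).sup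
      ((h.isFactorOn_OmegaM t x).boundedAlong_inv fun hz => hz.1.ne' him')).sup
      (((h.isFactorOn_DP ht hx).boundedAlong_inv fun hz => hz.1.ne' him).sup
      ((h.isFactorOn_DM ht hx).boundedAlong_inv fun hz => hz.1.ne' him'))
  -- The only condition that uses `r = O(1/k)`: entries of `G⁻¹ - 1` are at most `e^x` times `|r|`
  -- at `k` or its conjugate.
  normalization i j := by
    obtain ⟨C, hC⟩ := hr.bound
    refine IsBigO.of_bound (Real.exp x * C) ?_
    rw [eventually_inf_principal]
    filter_upwards [IsSpectralPair.eventually_norm_factorG_sub_le a b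
      hx htx (B := fun k => C * ‖k⁻¹‖) (fun k => by simp) hC] with k hk hkR
    rw [mul_assoc]
    exact (hk hkR.1 i j).2

/-! ### Reconstruction of the trivial field and medium -/

theorem tendsto_mul_eMinus_of_tendsto {f : ℂ → ℂ} {t x : ℝ} (hx : 0 < x) (htx : t ≤ x)
    {l : Filter ℂ} (hl : l ≤ Bornology.cobounded ℂ ⊓ 𝓟 {k | 0 ≤ k.im}) (hf : Tendsto f l (𝓝 0)) :
    Tendsto (fun k => f k * eMinus t x k) l (𝓝 0) := by
  have h2 := hl (mem_inf_of_left ((tendsto_norm_cobounded_atTop (E := ℂ)).eventually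
    (eventually_gt_atTop (1 / 2))))
  have h3 := hl (mem_inf_of_right (mem_principal_self {k : ℂ | 0 ≤ k.im}))
  have h4 : Tendsto (fun k => ‖f k‖ * Real.exp x) l (𝓝 0) := by
    simpa using hf.norm.mul_const (Real.exp x)
  refine squeeze_zero_norm' ?_ h4
  filter_upwards [h2, h3] with k hk2 hk
  rw [norm_mul]
  exact mul_le_mul_of_nonneg_left (norm_eMinus_le_exp hx htx hk (le_of_lt hk2)) (norm_nonneg _)

theorem tendsto_mul_exp_neg_norm {δ : ℝ} (hδ : 0 < δ) (C : ℝ) :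
    Tendsto (fun k : ℂ => C * (‖k‖ * Real.exp (-(δ * ‖k‖)))) (Bornology.cobounded ℂ) (𝓝 0) := by
  have h1 : Tendsto (fun y : ℝ => y * Real.exp (-(δ * y))) atTop (𝓝 0) := by
    have := Real.tendsto_pow_mul_exp_neg_atTop_nhds_zero 1
    have h2 := (this.comp (tendsto_id.const_mul_atTop hδ)).const_mul δ⁻¹
    rw [mul_zero] at h2
    refine h2.congr fun y => ?_
    simp only [Function.comp, id, pow_one]
    field_simp
  simpa using (h1.comp (tendsto_norm_cobounded_atTop (E := ℂ))).const_mul C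

theorem eventually_sector_notMem_contour {c : ℝ} (hc : 0 < c) :
    ∀ᶠ k in Bornology.cobounded ℂ, c * ‖k‖ ≤ |k.im| → k ∉ contour := by
  filter_upwards [(tendsto_norm_cobounded_atTop (E := ℂ)).eventually
    (eventually_gt_atTop (1 / 2))] with k hk hks
  rintro (h | h)
  · have : 0 < c * ‖k‖ := mul_pos hc (by linarith)
    rw [h, abs_zero] at hks
    linarith
  · exact hk.ne' h

namespace IsRHSolution

variable {a b : ℂ → ℂ} {t x : ℝ} {M : ℂ → Matrix (Fin 2) (Fin 2) ℂ}

/-- Outside the circle `M = G⁻¹` is lower triangular in `Ω₋`, so only the upper half-plane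
contributes to the limit, with `M₁₂ = r e^{-2iθ}`. -/
theorem tendsto_field (hM : IsRHSolution a b t x M) (h : IsSpectralPair a b)
    (ht : 0 ≤ t) (hx : 0 < x) (htx : t ≤ x) {S : Set ℂ}
    (hS : ∀ᶠ k in Bornology.cobounded ℂ, k ∈ S → k ∉ contour)
    (hlim : Tendsto (fun k => k * refl a b k * eMinus t x k)
      (Bornology.cobounded ℂ ⊓ 𝓟 ({k | 0 ≤ k.im} ∩ S)) (𝓝 0)) :
    Tendsto (fun k => -(4 * Complex.I * k * M k 0 1)) (Bornology.cobounded ℂ ⊓ 𝓟 S) (𝓝 0) := by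
  rw [Metric.tendsto_nhds]
  intro ε hε
  have h1 := Metric.tendsto_nhds.1 hlim (ε / 4) (by positivity)
  rw [eventually_inf_principal] at h1 ⊢
  filter_upwards [h1, hS, h.eventually_mem_regularSet, (tendsto_norm_cobounded_atTop
    (E := ℂ)).eventually (eventually_gt_atTop (1 / 2))] with k hk1 hkS hkR hk2 hk
  have hkc := hkS hk
  rw [hM.eq_inv_factorG h ht hx htx (hkR hkc)]
  rcases mem_regions_of_notMem_contour hkc with (hm | hm) | (hm | hm)
  · have h3 := hk1 ⟨hm.1.le, hk⟩
    rw [factorG_OmegaP _ t x hm, isUnipotentFamily_upperTri.inv]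
    rw [dist_zero_right] at h3 ⊢
    have : -(4 * Complex.I * k * upperTri (- -(refl a b k * eMinus t x k)) 0 1) =
        (-(4 * Complex.I)) * (k * refl a b k * eMinus t x k) := by
      simp [upperTri]
      ring
    rw [this, norm_mul]
    simp only [norm_neg, norm_mul, Complex.norm_ofNat, Complex.norm_I, mul_one] at h3 ⊢
    linarith
  · rw [factorG_OmegaM _ t x hm, isUnipotentFamily_lowerTri.inv]
    simpa [lowerTri] using hε
  · exact absurd hm.2 (not_lt.2 hk2.le)
  · exact absurd hm.2 (not_lt.2 hk2.le)

/-- In the sector `Im k ≥ c|k|` the exponential decays like `exp (-2 (x - t) c |k|)`, which beats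
the factor `k`; of `r` only eventual boundedness is needed. -/
theorem hasField_of_lt (hM : IsRHSolution a b t x M) (h : IsSpectralPair a b)
    (ht : 0 ≤ t) (hx : 0 < x) (htx : t < x) : HasField M 0 := by
  intro c hc
  rw [univ_inter]
  refine hM.tendsto_field h ht hx htx.le (eventually_sector_notMem_contour hc) ?_
  have hδ : 0 < 2 * (x - t) * c := by
    have := sub_pos.2 htx
    positivity
  have hr := Metric.tendsto_nhds.1 h.tendsto_refl 1 one_pos
  rw [eventually_inf_principal] at hr
  refine squeeze_zero_norm' ?_
    ((tendsto_mul_exp_neg_norm hδ (Real.exp x)).mono_left inf_le_left)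
  rw [eventually_inf_principal]
  filter_upwards [hr, (tendsto_norm_cobounded_atTop
    (E := ℂ)).eventually (eventually_gt_atTop (1 / 2))] with k hk hk2 hkS
  obtain ⟨hk0 : 0 ≤ k.im, hkc : c * ‖k‖ ≤ |k.im|⟩ := hkS
  have h1 := hk hk0
  rw [dist_zero_right] at h1
  rw [abs_of_nonneg hk0] at hkc
  have h2 : ‖eMinus t x k‖ ≤ Real.exp x * Real.exp (-(2 * (x - t) * c * ‖k‖)) := by
    refine (norm_eMinus_le hx hk2.le).trans (mul_le_mul_of_nonneg_left ?_ (Real.exp_pos _).le)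
    rw [Real.exp_le_exp]
    have := mul_le_mul_of_nonneg_left hkc (mul_nonneg zero_le_two (sub_pos.2 htx).le)
    linarith
  rw [norm_mul, norm_mul]
  calc ‖k‖ * ‖refl a b k‖ * ‖eMinus t x k‖
      ≤ ‖k‖ * 1 * (Real.exp x * Real.exp (-(2 * (x - t) * c * ‖k‖))) := by gcongr
    _ = _ := by ring

theorem hasField_of_tendstoSector (hM : IsRHSolution a b t x M) (h : IsSpectralPair a b)
    (ht : 0 ≤ t) (hx : 0 < x) (htx : t ≤ x)
    (hr : TendstoSector (fun k => k * refl a b k) {k | 0 ≤ k.im} 0) : HasField M 0 := by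
  intro c hc
  rw [univ_inter]
  exact hM.tendsto_field h ht hx htx (eventually_sector_notMem_contour hc)
    (tendsto_mul_eMinus_of_tendsto hx htx
      (inf_le_inf_left _ (principal_mono.2 inter_subset_left)) (hr c hc))

theorem hasFieldUnrestricted (hM : IsRHSolution a b t x M) (h : IsSpectralPair a b)
    (ht : 0 ≤ t) (hx : 0 < x) (htx : t ≤ x)
    (hr : Tendsto (fun k => k * refl a b k) (Bornology.cobounded ℂ ⊓ 𝓟 {k | 0 ≤ k.im}) (𝓝 0)) :
    HasFieldUnrestricted M 0 := by
  have hle : Bornology.cobounded ℂ ⊓ 𝓟 ({k : ℂ | 0 ≤ k.im} ∩ contourᶜ) ≤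
      Bornology.cobounded ℂ ⊓ 𝓟 {k | 0 ≤ k.im} :=
    inf_le_inf_left _ (principal_mono.2 inter_subset_left)
  exact hM.tendsto_field h ht hx htx (Eventually.of_forall fun _ hk => hk)
    (tendsto_mul_eMinus_of_tendsto hx htx hle (hr.mono_left hle))

end IsRHSolution

theorem tendsto_I_mul_nhdsGT :
    Tendsto (fun y : ℝ => Complex.I * y) (𝓝[>] 0) (𝓝[DP] 0) := by
  refine tendsto_nhdsWithin_iff.2 ⟨?_, ?_⟩
  · have : Continuous fun y : ℝ => Complex.I * y := by fun_prop
    simpa using (this.tendsto 0).mono_left nhdsWithin_le_nhds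
  · have h1 : ∀ᶠ y : ℝ in 𝓝[>] 0, y < 1 / 2 :=
      nhdsWithin_le_nhds (eventually_lt_nhds (by norm_num))
    filter_upwards [h1, self_mem_nhdsWithin] with y hy hy0
    have hy0' : (0 : ℝ) < y := hy0
    refine ⟨by simpa using hy0', ?_⟩
    simpa [abs_of_pos hy0'] using hy

/-- At `k = iy` the modulus is `exp (2y(x - t) - x/(2y))`, at most `exp (x - x/(2y))` for `0 < y <
1/2`. -/
theorem tendsto_ePlus_I_mul {t x : ℝ} (hx : 0 < x) (ht : 0 ≤ t) :
    Tendsto (fun y : ℝ => ePlus t x (Complex.I * y)) (𝓝[>] 0) (𝓝 0) := by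
  have h1 : Tendsto (fun y : ℝ => x - x / 2 * y⁻¹) (𝓝[>] 0) atBot :=
    tendsto_atBot_add_const_left _ x
      (tendsto_neg_atTop_atBot.comp (tendsto_inv_nhdsGT_zero.const_mul_atTop (by positivity)))
  refine squeeze_zero_norm' ?_ (Real.tendsto_exp_atBot.comp h1)
  have h2 : ∀ᶠ y : ℝ in 𝓝[>] 0, y < 1 / 2 :=
    nhdsWithin_le_nhds (eventually_lt_nhds (by norm_num))
  filter_upwards [h2, self_mem_nhdsWithin] with y hy hy0
  have hy0' : (0 : ℝ) < y := hy0
  rw [norm_ePlus, Function.comp, Real.exp_le_exp]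
  have hn : ‖Complex.I * (y : ℂ)‖ = y := by simp [abs_of_pos hy0']
  have hi : (Complex.I * (y : ℂ)).im = y := by simp
  rw [hn, hi]
  have : 2 * (y * (t - x + x / (4 * y ^ 2))) = 2 * y * (t - x) + x / 2 * y⁻¹ := by
    field_simp
    ring
  rw [this]
  nlinarith [mul_nonneg hy0'.le ht]

/-- In `D₊` the off-diagonal entry of `G⁻¹` is `(a / b) e^{2iθ}`; as `b 0 ≠ 0`, the quotient
converges and the exponential sends the product to `0`. -/
theorem IsRHSolution.hasValueAtZero {a b : ℂ → ℂ} {t x : ℝ} {M : ℂ → Matrix (Fin 2) (Fin 2) ℂ}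
    (hM : IsRHSolution a b t x M) (h : IsSpectralPair a b)
    (ht : 0 ≤ t) (hx : 0 < x) (htx : t ≤ x) : HasValueAtZero M 1 := by
  have hb : b 0 ≠ 0 := by simpa using h.b_ne_zero 0 (by norm_num)
  have hsub : DP ⊆ {k | 0 ≤ k.im} := fun k hk => hk.1.le
  have ca : Tendsto a (𝓝[DP] 0) (𝓝 (a 0)) := (h.continuousOn_a 0 (by simp)).mono hsub
  have cb : Tendsto b (𝓝[DP] 0) (𝓝 (b 0)) := (h.continuousOn_b 0 (by simp)).mono hsub
  have h1 := ((ca.div cb hb).comp tendsto_I_mul_nhdsGT).mul (tendsto_ePlus_I_mul hx ht)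
  rw [mul_zero] at h1
  have h2 := (isUnipotentFamily_lowerTri.continuous.tendsto 0).comp h1
  rw [isUnipotentFamily_lowerTri.zero] at h2
  refine h2.congr' ?_
  have h3 : ∀ᶠ k in 𝓝[DP] (0 : ℂ), k ∈ regularSet a b :=
    h.nhdsWithin_le_regularSet (fun _ => notMem_contour_DP) (Or.inl (by simp))
      self_mem_nhdsWithin
  filter_upwards [tendsto_I_mul_nhdsGT.eventually (h3.and self_mem_nhdsWithin)] with y hy
  rw [hM.eq_inv_factorG h ht hx htx hy.1, factorG_DP _ t x hy.2, isUnipotentFamily_lowerTri.inv,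
    neg_neg]
  simp [refl]

theorem hasMedium_of_hasValueAtZero_one {M : ℂ → Matrix (Fin 2) (Fin 2) ℂ}
    (hM : HasValueAtZero M 1) : HasMedium M 1 0 := by
  refine ⟨1, hM, by simp, ?_⟩
  simp [sigma3]

/-- The spectral functions of an integrable pulse form a spectral pair under the nonvanishing
conditions on the real axis. -/
theorem isSpectralPair_spec {E : ℝ → ℂ} (hE : IntegrableOn E (Ioi 0))
    (ha : ∀ s : ℝ, 1 / 2 ≤ |s| → specA E s ≠ 0) (hb : ∀ s : ℝ, |s| ≤ 1 / 2 → specB E s ≠ 0) :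
    IsSpectralPair (specA E) (specB E) :=
  ⟨continuousOn_specA hE, continuousOn_specB hE, differentiableOn_specA hE,
    differentiableOn_specB hE, tendsto_specA hE, tendsto_specB hE, ha, hb⟩

theorem integrableOn_of_moment {E : ℝ → ℂ} (hloc : LocallyIntegrableOn E (Ici 0))
    (hmoment : IntegrableOn (fun t : ℝ => (1 + t) * ‖E t‖) (Ioi 0)) :
    IntegrableOn E (Ioi 0) := by
  refine Integrable.mono hmoment
    (hloc.aestronglyMeasurable.mono_measure (Measure.restrict_mono Ioi_subset_Ici_self le_rfl)) ?_
  filter_upwards [self_mem_ae_restrict measurableSet_Ioi] with s hs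
  have hs' : (0 : ℝ) < s := hs
  rw [norm_mul, norm_norm, Real.norm_of_nonneg (by linarith)]
  nlinarith [norm_nonneg (E s)]

end MaxwellBloch

/-! ### The causality principle -/

theorem theorem3p2 (E₁ : ℝ → ℂ)
    (hloc : LocallyIntegrableOn E₁ (Set.Ici 0))
    (hmoment : IntegrableOn (fun t : ℝ => (1 + t) * ‖E₁ t‖) (Set.Ioi 0))
    (hne : ¬ E₁ =ᵐ[volume.restrict (Set.Ioi 0)] 0)
    (a b r : ℂ → ℂ)
    (ha : a = MaxwellBloch.specA E₁) (hb : b = MaxwellBloch.specB E₁)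
    (hr : r = MaxwellBloch.refl a b)
    -- `r` is finite on the real contour outside the circle, `1 / r` is finite inside it
    (ha0 : ∀ s : ℝ, 1 / 2 ≤ |s| → a s ≠ 0)
    (hb0 : ∀ s : ℝ, |s| ≤ 1 / 2 → b s ≠ 0)
    (t x : ℝ) (ht : 0 ≤ t) (hx : 0 < x) (htx : t ≤ x) :
    -- existence, as soon as `r = O(1/k)` in the closed upper half-plane
    (r =O[Bornology.cobounded ℂ ⊓ 𝓟 {k | 0 ≤ k.im}] (fun k => k⁻¹) →
      ∃ M, MaxwellBloch.IsRHSolution a b t x M) ∧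
    -- uniqueness and triviality
    ∀ M, MaxwellBloch.IsRHSolution a b t x M →
      (∀ k ∈ MaxwellBloch.regularSet a b, M k * MaxwellBloch.factorG r t x k = 1) ∧
      -- the reconstructed field and medium are trivial
      (t < x → MaxwellBloch.HasField M 0) ∧
      (MaxwellBloch.TendstoSector (fun k => k * r k) {k | 0 ≤ k.im} 0 →
        MaxwellBloch.HasField M 0) ∧
      (Tendsto (fun k => k * r k) (Bornology.cobounded ℂ ⊓ 𝓟 {k | 0 ≤ k.im}) (𝓝 0) →
        MaxwellBloch.HasFieldUnrestricted M 0) ∧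
      MaxwellBloch.HasValueAtZero M 1 ∧
      MaxwellBloch.HasMedium M 1 0 := by
  subst ha hb hr
  have h := MaxwellBloch.isSpectralPair_spec
    (MaxwellBloch.integrableOn_of_moment hloc hmoment) ha0 hb0
  refine ⟨fun hO => ⟨_, h.isRHSolution_inv ht hx htx hO⟩, fun M hM => ?_⟩
  have h0 := hM.hasValueAtZero h ht hx htx
  exact ⟨fun k hk => hM.mul_factorG h ht hx htx hk, fun hlt => hM.hasField_of_lt h ht hx hlt,
    fun hs => hM.hasField_of_tendstoSector h ht hx htx hs,
    fun hu => hM.hasFieldUnrestricted h ht hx htx hu, h0,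
    MaxwellBloch.hasMedium_of_hasValueAtZero_one h0⟩
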